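/- Let $N\ge 1$ and $0<b_1,b_2<1$, and set $\tau=b_2/b_1$. Let $\mathbb W_N$ be the set of integer $N$-tuples $\mathbf X=(x_1<\dots<x_N)$. A one-row configuration assigns to every site of $\mathbb Z$ one of six vertex types, each given by which of its edges (west, south, east, north) are bold: $a_1$: none; $a_2$: all; $b_1$: south and north; $b_2$: west and east; $c_1$: south and east; $c_2$: west and north. It is required that the east edge of a site is bold if and only if the west edge of the next site is, and that all but finitely many vertices have type $a_1$. For $\mathbf X,\mathbf Y\in\mathbb W_N$ there is at most one such row whose bold south edges are exactly at the sites of $\mathbf X$ and whose bold north edges are exactly at the sites of $\mathbf Y$. Let $\mathcal T^{(N)}(\mathbf X\to\mathbf Y)$ be the product of its vertex weights, where the types $a_1,a_2,b_1,b_2,c_1,c_2$ have weights $1,\,1,\,b_1,\,b_2,\,1-b_1,\,1-b_2$, and let $\mathcal T^{(N)}(\mathbf X\to\mathbf Y)=0$ if there is no such row. Let $\mathcal T^{(N)}_t$ be the $t$-th power of the matrix $\mathcal T^{(N)}$; it is the $t$-step transition matrix of the $N$-particle stochastic six-vertex chain. For $\mathbf Y=(y_1<\dots<y_N)\in\mathbb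 W_N$ put $$P_{\mathbf Y}(x_m=x;t)=\sum_{\mathbf X\in\mathbb W_N:\ x_m=x}\mathcal T^{(N)}_t(\mathbf Y\to\mathbf X).$$ Then for every integer $t\ge 1$, every $1\le m\le N$, every $\mathbf Y\in\mathbb W_N$ and every $x\in\mathbb Z$, this series converges and $$P_{\mathbf Y}(x_m=x;t)=(-1)^{m-1}\tau^{m(m-1)/2}\sum_{k=m}^{N}\ \sum_{\substack{S\subseteq\{1,\dots,N\}\\ |S|=k}}\tau^{\kappa(S)-mk-k(k-1)/2}\binom{k-1}{m-1}_{\tau}\, I_S ,$$ where $$I_S=\frac1{(2\pi \mathrm i)^k}\oint\!\cdots\!\oint\ \prod_{\substack{i,j\in S\\ i<j}}\frac{z_j-z_i}{1-(1+\tau^{-1})z_i+\tau^{-1}z_iz_j}\cdot\frac{1-\prod_{i\in S}z_i}{\prod_{i\in S}(1-z_i)}\ \prod_{i\in S}z_i^{x-y_i-1}\left(\frac{b_1+(1-b_1-b_2)z_i^{-1}}{1-b_2z_i^{-1}}\right)^{t}dz_i .$$ Here $\kappa(S)$ is the sum of the elements of $S$, and $$\binom nk_\tau=\frac{(1-\tau^n)(1-\tau^{n-1})\cdots(1-\tau^{n-k+1})}{(1-\tau)(1-\tau^2)\cdots(1-\tau^k)}$$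 is the $\tau$-binomial coefficient (a polynomial in $\tau$; for $\tau=1$ its value is $\binom nk$). All contours are the positively oriented circle $|z|=R$, for any $R$ large enough that the circle contains all singularities of the integrands: $R>1$, $R>b_2$, and for $|z|=R$ every $w$ with $1-(1+\tau^{-1})z+\tau^{-1}zw=0$ or $1-(1+\tau^{-1})w+\tau^{-1}zw=0$ satisfies $|w|<R$. The integrands are integrable over these contours. -/

import Mathlib

namespace SixVertex

/-- The six types of vertices. -/
inductive Vertex where
  | a₁ | a₂ | b₁ | b₂ | c₁ | c₂

namespace Vertex

/-- Is the line in west direction bold? -/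
def west : Vertex → Bool
  | a₁ => false | a₂ => true | b₁ => false | b₂ => true | c₁ => false | c₂ => true

/-- Is the line in south direction bold? -/
def south : Vertex → Bool
  | a₁ => false | a₂ => true | b₁ => true | b₂ => false | c₁ => true | c₂ => false

/-- Is the line in east direction bold? -/
def east : Vertex → Bool
  | a₁ => false | a₂ => true | b₁ => false | b₂ => true | c₁ => true | c₂ => false

/-- Is the line in north direction bold? -/
def north : Vertex → Bool
  | a₁ => false | a₂ => true | b₁ => true | b₂ => false | c₁ => false | c₂ => true

/-- The weight of a vertex, for the vertex weights `(1, wa₂, wb₁, wb₂, wc₁, wc₂)`. -/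
def weight (wa₂ wb₁ wb₂ wc₁ wc₂ : ℝ) : Vertex → ℝ
  | a₁ => 1 | a₂ => wa₂ | b₁ => wb₁ | b₂ => wb₂ | c₁ => wc₁ | c₂ => wc₂

theorem ext_edges {v w : Vertex} (hW : v.west = w.west) (hS : v.south = w.south)
    (hN : v.north = w.north) : v = w := by
  cases v <;> cases w <;> simp_all [west, south, north]

end Vertex

/-- The set of ordered `N`-tuples of integers `x₁ < x₂ < ⋯ < x_N`
(the coordinate `x_i` has index `i - 1` in `Fin N`). -/
abbrev Config (N : ℕ) : Type := {x : Fin N → ℤ // StrictMono x}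

/-- A one-row configuration of the six-vertex model: bold lines of adjacent vertices agree, and
only finitely many vertices are not of type `a₁`. -/
structure Row where
  type : ℤ → Vertex
  agree : ∀ x : ℤ, (type x).east = (type (x + 1)).west
  finite : {x : ℤ | type x ≠ Vertex.a₁}.Finite

/-- The row `ℓ` sends `X` to `Y`: its bold south lines are at the positions of `X`, its bold north
lines are at the positions of `Y`. -/
def Row.Sends {N : ℕ} (ℓ : Row) (X Y : Config N) : Prop :=
  (∀ x : ℤ, (ℓ.type x).south = true ↔ ∃ i, X.1 i = x) ∧
  (∀ x : ℤ, (ℓ.type x).north = true ↔ ∃ i, Y.1 i = x)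

/-- There is at most one row that sends `X` to `Y`. -/
theorem Row.Sends.unique {N : ℕ} {ℓ ℓ' : Row} {X Y : Config N}
    (h : ℓ.Sends X Y) (h' : ℓ'.Sends X Y) : ℓ = ℓ' := by
  have hS : ∀ x, (ℓ.type x).south = (ℓ'.type x).south := fun x =>
    Bool.eq_iff_iff.2 ((h.1 x).trans (h'.1 x).symm)
  have hN : ∀ x, (ℓ.type x).north = (ℓ'.type x).north := fun x =>
    Bool.eq_iff_iff.2 ((h.2 x).trans (h'.2 x).symm)
  obtain ⟨B, hB⟩ := (ℓ.finite.union ℓ'.finite).bddBelow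
  have low : ∀ x, x < B → ℓ.type x = ℓ'.type x := by
    intro x hx
    have key : x ∉ {x : ℤ | ℓ.type x ≠ Vertex.a₁} ∪ {x : ℤ | ℓ'.type x ≠ Vertex.a₁} :=
      fun hmem => absurd (hB hmem) (not_le.2 hx)
    simp only [Set.mem_union, Set.mem_ofPred_eq, not_or, not_not] at key
    rw [key.1, key.2]
  have all : ∀ x, B - 1 ≤ x → ℓ.type x = ℓ'.type x := by
    intro x hx
    induction x, hx using Int.leInduction with
    | base => exact low _ (by omega)
    | succ x hx ih =>
      refine Vertex.ext_edges ?_ (hS _) (hN _)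
      rw [← ℓ.agree x, ← ℓ'.agree x, ih]
  have : ℓ.type = ℓ'.type := by
    funext x
    rcases lt_or_ge x B with hx | hx
    · exact low x hx
    · exact all x (by omega)
  cases ℓ
  cases ℓ'
  simp_all

/-- The weight of a row: the product of the weights of its vertices
(all but finitely many of them have type `a₁`, of weight `1`). -/
noncomputable def Row.weight (wa₂ wb₁ wb₂ wc₁ wc₂ : ℝ) (ℓ : Row) : ℝ :=
  ∏ᶠ x : ℤ, (ℓ.type x).weight wa₂ wb₁ wb₂ wc₁ wc₂

open Classical in
/-- The transfer matrix `𝒯^{(N)}(X → Y; 1, wa₂, wb₁, wb₂, wc₁, wc₂)`: the weight of the row that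
sends `X` to `Y`, and `0` if there is none. -/
noncomputable def transfer (wa₂ wb₁ wb₂ wc₁ wc₂ : ℝ) {N : ℕ} (X Y : Config N) : ℝ :=
  if h : ∃ ℓ : Row, ℓ.Sends X Y then h.choose.weight wa₂ wb₁ wb₂ wc₁ wc₂ else 0

open Classical in
/-- The `t`-th power of the transfer matrix. For given `X` and `Y` only finitely many terms of
the sum over `Z` do not vanish, since particles only move to the right. -/
noncomputable def transferPow (wa₂ wb₁ wb₂ wc₁ wc₂ : ℝ) {N : ℕ} :
    ℕ → Config N → Config N → ℝ
  | 0, X, Y => if X = Y then 1 else 0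
  | t + 1, X, Y => ∑' Z : Config N,
      transferPow wa₂ wb₁ wb₂ wc₁ wc₂ t X Z * transfer wa₂ wb₁ wb₂ wc₁ wc₂ Z Y

/-- The `t`-step transition probabilities `Y → X` of the `N`-particle stochastic six-vertex chain:
the `t`-th power of the transfer matrix with weights `(1, 1, b₁, b₂, 1 - b₁, 1 - b₂)`. -/
noncomputable def stochasticPow (b₁ b₂ : ℝ) {N : ℕ} (t : ℕ) (Y X : Config N) : ℝ :=
  transferPow 1 b₁ b₂ (1 - b₁) (1 - b₂) t Y X

/-- The probability `P_Y(A; t)` that the chain started from `Y` is in `A` at time `t`. -/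
noncomputable def prob (b₁ b₂ : ℝ) {N : ℕ} (Y : Config N) (A : Set (Config N)) (t : ℕ) : ℝ :=
  ∑' X : A, stochasticPow b₁ b₂ t Y X.1

/-- The `q`-binomial coefficient `(n choose k)_q`, as a polynomial in `q`, by Pascal's rule. -/
def qBinom (q : ℝ) : ℕ → ℕ → ℝ
  | _, 0 => 1
  | 0, _ + 1 => 0
  | n + 1, k + 1 => qBinom q n k + q ^ (k + 1) * qBinom q n (k + 1)

theorem qBinom_mul (q : ℝ) (n k : ℕ) :
    qBinom q n k * ∏ i ∈ Finset.range k, (1 - q ^ (i + 1)) =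
      ∏ i ∈ Finset.range k, (1 - q ^ (n - i)) := by
  induction n generalizing k with
  | zero =>
    cases k with
    | zero => simp [qBinom]
    | succ k => simp [qBinom, Finset.prod_range_succ']
  | succ n ih =>
    cases k with
    | zero => simp [qBinom]
    | succ k =>
      have e1 := ih k
      have e2 := ih (k + 1)
      rw [Finset.prod_range_succ, Finset.prod_range_succ] at e2
      rw [Finset.prod_range_succ, Finset.prod_range_succ']
      simp only [Nat.add_sub_add_right, Nat.sub_zero, qBinom]
      have e3 : (∏ i ∈ Finset.range k, (1 - q ^ (n - i))) * (q ^ (k + 1) * q ^ (n - k)) =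
          (∏ i ∈ Finset.range k, (1 - q ^ (n - i))) * q ^ (n + 1) := by
        rcases le_or_gt k n with hk | hk
        · rw [← pow_add]
          congr 2
          omega
        · rw [Finset.prod_eq_zero (Finset.mem_range.2 hk) (by simp)]
          simp
      linear_combination (1 - q ^ (k + 1)) * e1 + q ^ (k + 1) * e2 - e3

/-- For `q > 0`, `q ≠ 1`, the `q`-binomial coefficient is
`((1 - q ^ n) ⋯ (1 - q ^ (n - k + 1))) / ((1 - q) ⋯ (1 - q ^ k))`. -/
theorem qBinom_eq_div {q : ℝ} (h0 : 0 < q) (h1 : q ≠ 1) (n k : ℕ) :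
    qBinom q n k = (∏ i ∈ Finset.range k, (1 - q ^ (n - i))) /
      ∏ i ∈ Finset.range k, (1 - q ^ (i + 1)) := by
  rw [eq_div_iff, qBinom_mul]
  refine Finset.prod_ne_zero_iff.2 fun i _ hi => h1 ?_
  exact (pow_eq_one_iff_of_nonneg h0.le (Nat.succ_ne_zero i)).1 (sub_eq_zero.1 hi).symm

/-- The quadratic cross-term `1 - (1 + τ⁻¹) u + τ⁻¹ u v`. -/
noncomputable def cross (τ : ℝ) (u v : ℂ) : ℂ :=
  1 - (1 + (τ : ℂ)⁻¹) * u + (τ : ℂ)⁻¹ * u * v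

/-- The circle of radius `R` around the origin contains all singularities of the integrand, in each
variable, when the other variables are on the same circle: the points `0`, `1` and `b₂`, and the
zeros of the cross-terms. -/
def EnclosesSingularities (τ b₂ R : ℝ) : Prop :=
  1 < R ∧ |b₂| < R ∧
    ∀ z w : ℂ, ‖z‖ = R → (cross τ z w = 0 ∨ cross τ w z = 0) → ‖w‖ < R

/-- The integrand of the contour integral indexed by `S ⊆ {1, …, N}`. The variables
`z_s`, `s ∈ S`, are numbered by `Fin S.card` in increasing order of `s`. -/
noncomputable def integrand (b₁ b₂ : ℝ) {N : ℕ} (Y : Config N) (x : ℤ) (t : ℕ)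
    (S : Finset (Fin N)) (z : Fin S.card → ℂ) : ℂ :=
  (∏ i, ∏ j ∈ Finset.Ioi i, (z j - z i) / cross (b₂ / b₁) (z i) (z j)) *
    ((1 - ∏ i, z i) / ∏ i, (1 - z i)) *
    ∏ i, (z i ^ (x - Y.1 (S.orderEmbOfFin rfl i) - 1) *
      (((b₁ : ℂ) + (1 - b₁ - b₂) * (z i)⁻¹) / (1 - b₂ * (z i)⁻¹)) ^ t)

/-- The normalized contour integral `(2πi)^{-|S|} ∮ ⋯ ∮`, over positively oriented circles of
radius `R` around the origin. -/
noncomputable def contourIntegral (b₁ b₂ : ℝ) {N : ℕ} (Y : Config N) (x : ℤ) (t : ℕ) (R : ℝ)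
    (S : Finset (Fin N)) : ℂ :=
  1 / (2 * Real.pi * Complex.I) ^ S.card *
    torusIntegral (integrand b₁ b₂ Y x t S) 0 (fun _ => R)

/-- The sum `κ(S, ℤ_{>0})` of the elements of `S ⊆ {1, …, N}`
(the element `i + 1` of `{1, …, N}` is represented by `i : Fin N`). -/
def kappa {N : ℕ} (S : Finset (Fin N)) : ℤ := ∑ i ∈ S, ((i : ℕ) + 1 : ℤ)

end SixVertex

/-!
The formula is proved by checking that its right side, as a function of the initial configuration,
solves the backward equation of the chain and is the indicator of the event `x_m = x` at time `0`.

In the inverse variables `p = z⁻¹`, all of modulus `r = R⁻¹`, the condition on `R` says that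
`(1 + τ) r + τ r² < 1`, so that no `twoBody τ p q = 1 - (1 + τ) q + τ p q` vanishes for
`|p|, |q| ≤ r`. The integrands for the subsets of size `k` have a common factor: the kernel
`bethe τ p = ∏_{i < j} (p_i - p_j) / twoBody τ p_i p_j`, times a product of functions of one variable
which holds the time `t` as `∏ eigen(p_i) ^ t`. The remaining factors, with their powers of `τ`, add
up over all these subsets to the wave `∑_{s₁ < ⋯ < s_k} ∏ τ ^ s_i p_i ^ y_{s_i}` (`wave_eq_sum`),
and only the wave depends on the initial configuration.

* Backward equation. Written particle by particle, the transfer matrix is a product of local factors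
  (`jumpWeight`, `transfer_eq_jumpWeight`). The mean of the wave after one step is
  `∏ eigen(p_i)` times the wave, up to an error in which two neighbouring variables occur
  only through `twoBody` times a symmetric function (`stepsTo`, by induction on the number of
  particles; the induction also treats the chain whose first particle is pushed). As
  `twoBody τ p_i p_{i+1} * bethe τ p` is antisymmetric in `p_i, p_{i+1}`, such an error integrates to
  zero against the kernel times any symmetric product (`twoBody_mul_mem_betheNull`). Hence a step of
  the chain advances the time by one (`hasSum_pairing_wave`).
* Initial condition. At `t = 0` the integral over the torus is `1` if all the exponents have the
  right sign and `0` otherwise (`integral_bethe_initial`). To see this, integrate over the first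
  variable: replacing `∏_j (p₀ - p_j)` by `∏_j twoBody τ p₀ p_j` splits off the kernel for one
  variable less, and the partial fractions of the difference contribute nothing.
  The sum over the subsets of size `k` then depends only on the number of particles to the left of
  `x`, and the alternating sum with `τ`-binomial coefficients over `k` tells whether this number is
  at least `m` (`sum_qBinom_mul_subsetSum`, `formula_zero`).

The solution of the backward equation determines the probabilities because the transfer matrix and
the indicator are nonnegative (`hasSum_transferPow`); this also gives the convergence of the series.
-/

namespace SixVertex

/-! ### Rows and interlacing -/

/-- Positions `X` before and `Y` after one step interlace: `x₁ ≤ y₁ ≤ x₂ ≤ y₂ ≤ ⋯`. -/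
def Interlaced {N : ℕ} (X Y : Fin N → ℤ) : Prop :=
  (∀ i, X i ≤ Y i) ∧ ∀ i j, i < j → Y i ≤ X j

/-- The vertex with given west, south and north edges. For the two triples of edges that no vertex
has, the value is the vertex with the given west and south edges. -/
def Vertex.ofEdges : Bool → Bool → Bool → Vertex
  | false, false, _ => .a₁
  | true, true, _ => .a₂
  | false, true, true => .b₁
  | true, false, false => .b₂
  | false, true, false => .c₁
  | true, false, true => .c₂

open Classical in
/-- The vertex at the site `x` of the row that sends `X` to `Y`: its west edge is bold when some
particle moves from the left of `x` to `x` or beyond. -/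
noncomputable def siteVertex {N : ℕ} (X Y : Fin N → ℤ) (x : ℤ) : Vertex :=
  Vertex.ofEdges (decide (∃ i, X i < x ∧ x ≤ Y i)) (decide (∃ i, X i = x)) (decide (∃ i, Y i = x))

theorem Vertex.west_ofEdges (w s n : Bool) : (Vertex.ofEdges w s n).west = w := by
  cases w <;> cases s <;> cases n <;> rfl

theorem Vertex.south_ofEdges (w s n : Bool) : (Vertex.ofEdges w s n).south = s := by
  cases w <;> cases s <;> cases n <;> rfl

theorem Vertex.north_ofEdges {w s n : Bool} (h₀ : n = true → w = true ∨ s = true)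
    (h₁ : w = true → s = true → n = true) : (Vertex.ofEdges w s n).north = n := by
  revert h₀ h₁
  cases w <;> cases s <;> cases n <;> simp [Vertex.ofEdges, Vertex.north]

theorem Vertex.east_ofEdges (w s n : Bool) :
    (Vertex.ofEdges w s n).east = true ↔
      (w = true ∧ s = true) ∨ (w = true ∧ n = false) ∨ (s = true ∧ n = false) := by
  cases w <;> cases s <;> cases n <;> simp [Vertex.ofEdges, Vertex.east]

theorem finite_siteVertex_ne {N : ℕ} (X Y : Fin N → ℤ) :
    {x : ℤ | siteVertex X Y x ≠ Vertex.a₁}.Finite := by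
  refine Set.Finite.subset (Set.finite_iUnion fun i : Fin N =>
    (Set.finite_Icc (X i) (Y i)).union (Set.finite_singleton (X i))) fun x hx => ?_
  by_contra hcon
  simp only [Set.mem_iUnion, Set.mem_union, Set.mem_Icc, Set.mem_singleton_iff, not_exists, not_or,
    not_and, not_le] at hcon
  have hw : ¬ ∃ i, X i < x ∧ x ≤ Y i := fun ⟨i, h1, h2⟩ => by
    have := (hcon i).1 h1.le
    omega
  have hs : ¬ ∃ i, X i = x := fun ⟨i, h1⟩ => (hcon i).2 h1.symm
  exact hx (by simp [siteVertex, hw, hs, Vertex.ofEdges])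

section Interlaced

variable {N : ℕ} {X Y : Fin N → ℤ}

/-- A particle that arrives at an occupied site stops there. -/
theorem Interlaced.eq_of_west_south (h : Interlaced X Y) (hX : StrictMono X) {x : ℤ} {i j : Fin N}
    (h1 : X i < x) (h2 : x ≤ Y i) (h3 : X j = x) : Y i = x := by
  have hij : i < j := hX.lt_iff_lt.1 (by omega)
  have := h.2 i j hij
  omega

theorem Interlaced.west_or_south (h : Interlaced X Y) {x : ℤ} {i : Fin N} (h1 : Y i = x) :
    (∃ i, X i < x ∧ x ≤ Y i) ∨ ∃ i, X i = x := by
  rcases (h.1 i).lt_or_eq with h2 | h2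
  · exact Or.inl ⟨i, by omega, by omega⟩
  · exact Or.inr ⟨i, by omega⟩

theorem Interlaced.east_iff (h : Interlaced X Y) (hX : StrictMono X) (hY : StrictMono Y) (x : ℤ) :
    (siteVertex X Y x).east = true ↔ ∃ i, X i ≤ x ∧ x < Y i := by
  simp only [siteVertex, Vertex.east_ofEdges, decide_eq_true_eq, decide_eq_false_iff_not]
  constructor
  · rintro (⟨⟨i, h1, h2⟩, ⟨j, h3⟩⟩ | ⟨⟨i, h1, h2⟩, h3⟩ | ⟨⟨i, h1⟩, h3⟩)
    · have h4 := h.eq_of_west_south hX h1 h2 h3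
      have hij : i < j := hX.lt_iff_lt.1 (by omega)
      exact ⟨j, h3.le, h4 ▸ hY hij⟩
    · exact ⟨i, h1.le, lt_of_le_of_ne h2 fun h4 => h3 ⟨i, h4.symm⟩⟩
    · exact ⟨i, h1.le, lt_of_le_of_ne (h1 ▸ h.1 i) fun h4 => h3 ⟨i, h4.symm⟩⟩
  · rintro ⟨i, h1, h2⟩
    by_cases hw : ∃ i, X i < x ∧ x ≤ Y i
    · by_cases hs : ∃ i, X i = x
      · exact Or.inl ⟨hw, hs⟩
      · refine Or.inr (Or.inl ⟨hw, ?_⟩)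
        rintro ⟨j, h3⟩
        have hji : j < i := hY.lt_iff_lt.1 (by omega)
        have h4 := h.2 j i hji
        exact hs ⟨i, by omega⟩
    · have hX' : X i = x := by
        by_contra hne
        exact hw ⟨i, by omega, h2.le⟩
      refine Or.inr (Or.inr ⟨⟨i, hX'⟩, ?_⟩)
      rintro ⟨j, h3⟩
      have hji : j < i := hY.lt_iff_lt.1 (by omega)
      exact hw ⟨j, hX' ▸ hX hji, h3.ge⟩

end Interlaced

/-- The row of the transition from `X` to `Y`, for interlacing positions. -/
noncomputable def Interlaced.row {N : ℕ} {X Y : Config N} (h : Interlaced X.1 Y.1) : Row where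
  type := siteVertex X.1 Y.1
  agree x := by
    rw [Bool.eq_iff_iff, h.east_iff X.2 Y.2, siteVertex, Vertex.west_ofEdges, decide_eq_true_eq]
    simp only [Int.lt_add_one_iff, Int.add_one_le_iff]
  finite := finite_siteVertex_ne _ _

theorem Interlaced.row_sends {N : ℕ} {X Y : Config N} (h : Interlaced X.1 Y.1) :
    h.row.Sends X Y := by
  refine ⟨fun x => ?_, fun x => ?_⟩
  · simp [Interlaced.row, siteVertex, Vertex.south_ofEdges]
  · simp only [Interlaced.row, siteVertex]
    rw [Vertex.north_ofEdges, decide_eq_true_eq]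
    · simp only [decide_eq_true_eq]
      rintro ⟨i, hi⟩
      exact h.west_or_south hi
    · simp only [decide_eq_true_eq]
      rintro ⟨i, h1, h2⟩ ⟨j, h3⟩
      exact ⟨i, h.eq_of_west_south X.2 h1 h2 h3⟩

/-- The number of particles at `x` or to the left of it. -/
def countLE {N : ℕ} (X : Fin N → ℤ) (x : ℤ) : ℕ := (Finset.univ.filter fun i => X i ≤ x).card

open Classical in
theorem countLE_succ {N : ℕ} {X : Fin N → ℤ} (hX : StrictMono X) (x : ℤ) :
    countLE X (x + 1) = countLE X x + if ∃ i, X i = x + 1 then 1 else 0 := by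
  have h : (Finset.univ.filter fun i => X i ≤ x + 1) =
      (Finset.univ.filter fun i => X i ≤ x) ∪ Finset.univ.filter fun i => X i = x + 1 := by
    ext i
    simp only [Finset.mem_filter, Finset.mem_univ, true_and, Finset.mem_union]
    omega
  rw [countLE, h, Finset.card_union_of_disjoint, ← countLE]
  · congr 1
    split_ifs with h1
    · obtain ⟨i, hi⟩ := h1
      rw [Finset.card_eq_one]
      refine ⟨i, ?_⟩
      ext j
      simp [← hi, hX.injective.eq_iff]
    · simpa [Finset.filter_eq_empty_iff] using h1
  · rw [Finset.disjoint_filter]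
    intros
    omega

theorem countLE_self {N : ℕ} {X : Fin N → ℤ} (hX : StrictMono X) (i : Fin N) :
    countLE X (X i) = i + 1 := by
  have h : (Finset.univ.filter fun j => X j ≤ X i) = Finset.Iic i := by
    ext j
    simp [hX.le_iff_le]
  rw [countLE, h, Fin.card_Iic]

theorem countLE_le_of_lt {N : ℕ} {X : Fin N → ℤ} (hX : StrictMono X) {i : Fin N} {x : ℤ}
    (h : x < X i) : countLE X x ≤ i := by
  rw [← Fin.card_Iio i, countLE]
  refine Finset.card_le_card fun j hj => ?_
  simp only [Finset.mem_filter, Finset.mem_univ, true_and] at hj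
  exact Finset.mem_Iio.2 (hX.lt_iff_lt.1 (by omega))

/-- Conservation of lines: the horizontal edge east of `x` is bold exactly when more particles start
than end at sites up to `x`. -/
theorem Row.Sends.countLE_eq {N : ℕ} {ℓ : Row} {X Y : Config N} (h : ℓ.Sends X Y) (x : ℤ) :
    countLE X.1 x = countLE Y.1 x + (ℓ.type x).east.toNat := by
  classical
  obtain ⟨B, hB⟩ := ℓ.finite.bddBelow
  have low : ∀ x, x < B → ℓ.type x = Vertex.a₁ := by
    intro x hx
    by_contra hne
    exact absurd (hB hne) (not_le.2 hx)
  have key : ∀ x, x < B → countLE X.1 x = countLE Y.1 x + (ℓ.type x).east.toNat := by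
    intro x hx
    have hX : countLE X.1 x = 0 := by
      simp only [countLE, Finset.card_eq_zero, Finset.filter_eq_empty_iff, Finset.mem_univ,
        true_imp_iff]
      intro i hi
      have h1 := (h.1 (X.1 i)).2 ⟨i, rfl⟩
      rw [low _ (by omega)] at h1
      simp [Vertex.south] at h1
    have hY : countLE Y.1 x = 0 := by
      simp only [countLE, Finset.card_eq_zero, Finset.filter_eq_empty_iff, Finset.mem_univ,
        true_imp_iff]
      intro i hi
      have h1 := (h.2 (Y.1 i)).2 ⟨i, rfl⟩
      rw [low _ (by omega)] at h1
      simp [Vertex.north] at h1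
    rw [hX, hY, low x hx]
    rfl
  rcases lt_or_ge x B with hx | hx
  · exact key x hx
  have hx' : B - 1 ≤ x := by omega
  clear hx
  induction x, hx' using Int.leInduction with
  | base => exact key _ (by omega)
  | succ x hx ih =>
    rw [countLE_succ X.2, countLE_succ Y.2, ih]
    simp only [← h.1, ← h.2]
    rw [ℓ.agree]
    generalize ℓ.type (x + 1) = v
    cases v <;> simp [Vertex.west, Vertex.south, Vertex.north, Vertex.east]

theorem Row.Sends.interlaced {N : ℕ} {ℓ : Row} {X Y : Config N} (h : ℓ.Sends X Y) :
    Interlaced X.1 Y.1 := by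
  have hle : ∀ x, countLE Y.1 x ≤ countLE X.1 x ∧ countLE X.1 x ≤ countLE Y.1 x + 1 := fun x => by
    have := h.countLE_eq x
    have := Bool.toNat_le (ℓ.type x).east
    omega
  refine ⟨fun i => ?_, fun i j hij => ?_⟩
  · by_contra hlt
    have h1 := countLE_self Y.2 i
    have h2 := countLE_le_of_lt X.2 (not_le.1 hlt)
    have := hle (Y.1 i)
    omega
  · by_contra hlt
    have h1 := countLE_self X.2 j
    have h2 := countLE_le_of_lt Y.2 (not_le.1 hlt)
    have := hle (X.1 j)
    have : (i : ℕ) < j := hij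
    omega

open Classical in
theorem transfer_eq (wa₂ wb₁ wb₂ wc₁ wc₂ : ℝ) {N : ℕ} (X Y : Config N) :
    transfer wa₂ wb₁ wb₂ wc₁ wc₂ X Y = if Interlaced X.1 Y.1 then
      ∏ᶠ x : ℤ, (siteVertex X.1 Y.1 x).weight wa₂ wb₁ wb₂ wc₁ wc₂ else 0 := by
  unfold transfer
  by_cases h : Interlaced X.1 Y.1
  · have hex : ∃ ℓ : Row, ℓ.Sends X Y := ⟨h.row, h.row_sends⟩
    rw [dif_pos hex, if_pos h, hex.choose_spec.unique h.row_sends]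
    rfl
  · rw [if_neg h, dif_neg]
    rintro ⟨ℓ, hℓ⟩
    exact h hℓ.interlaced

end SixVertex

namespace SixVertex

/-! ### The transition weights, particle by particle -/

/-- The weight of a jump from `Y` to `Z`, computed particle by particle from the left, with stochastic
weights. The flag says that the first particle is pushed, so that it has to move: the vertex at its
site then has type `a₂`. The weight vanishes unless `Y` and `Z` interlace and `Z` is increasing. -/
noncomputable def jumpWeight (b₁ b₂ : ℝ) : Bool → {N : ℕ} → (Fin N → ℤ) → (Fin N → ℤ) → ℝ
  | _, 0, _, _ => 1
  | f, _ + 1, Y, Z =>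
    if Z 0 = Y 0 then
      if f then 0 else b₁ * jumpWeight b₁ b₂ false (Fin.tail Y) (Fin.tail Z)
    else if Y 0 < Z 0 then
      (if f then 1 else 1 - b₁) * b₂ ^ (Z 0 - Y 0 - 1) *
        if ∀ i, Z 0 < Fin.tail Y i then
          (1 - b₂) * jumpWeight b₁ b₂ false (Fin.tail Y) (Fin.tail Z)
        else if ∀ i, Z 0 ≤ Fin.tail Y i then
          jumpWeight b₁ b₂ true (Fin.tail Y) (Fin.tail Z)
        else 0
    else 0

variable {b₁ b₂ : ℝ}

theorem jumpWeight_of_eq (f : Bool) {N : ℕ} {Y Z : Fin (N + 1) → ℤ} (h : Z 0 = Y 0) :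
    jumpWeight b₁ b₂ f Y Z =
      if f then 0 else b₁ * jumpWeight b₁ b₂ false (Fin.tail Y) (Fin.tail Z) := by
  rw [jumpWeight, if_pos h]

theorem jumpWeight_of_lt (f : Bool) {N : ℕ} {Y Z : Fin (N + 1) → ℤ} (h : Y 0 < Z 0)
    (h' : ∀ i, Z 0 < Fin.tail Y i) :
    jumpWeight b₁ b₂ f Y Z = (if f then 1 else 1 - b₁) * b₂ ^ (Z 0 - Y 0 - 1) *
      ((1 - b₂) * jumpWeight b₁ b₂ false (Fin.tail Y) (Fin.tail Z)) := by
  rw [jumpWeight, if_neg h.ne', if_pos h, if_pos h']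

theorem jumpWeight_of_push (f : Bool) {N : ℕ} {Y Z : Fin (N + 1) → ℤ} (h : Y 0 < Z 0)
    (h' : ¬ ∀ i, Z 0 < Fin.tail Y i) (h'' : ∀ i, Z 0 ≤ Fin.tail Y i) :
    jumpWeight b₁ b₂ f Y Z = (if f then 1 else 1 - b₁) * b₂ ^ (Z 0 - Y 0 - 1) *
      jumpWeight b₁ b₂ true (Fin.tail Y) (Fin.tail Z) := by
  rw [jumpWeight, if_neg h.ne', if_pos h, if_neg h', if_pos h'']

theorem jumpWeight_of_not (f : Bool) {N : ℕ} {Y Z : Fin (N + 1) → ℤ}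
    (h : ¬ (Y 0 ≤ Z 0 ∧ ∀ i, Z 0 ≤ Fin.tail Y i)) (hY : ∀ i, Y 0 < Fin.tail Y i) :
    jumpWeight b₁ b₂ f Y Z = 0 := by
  have h1 : Z 0 ≠ Y 0 := fun h1 => h ⟨h1.ge, fun i => h1 ▸ (hY i).le⟩
  rw [jumpWeight, if_neg h1]
  by_cases h2 : Y 0 < Z 0
  · have h3 : ¬ ∀ i, Z 0 ≤ Fin.tail Y i := fun h3 => h ⟨h2.le, h3⟩
    rw [if_pos h2, if_neg (fun h4 => h3 fun i => (h4 i).le : ¬ ∀ i, Z 0 < Fin.tail Y i),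
      if_neg h3, mul_zero]
  · rw [if_neg h2]

theorem jumpWeight_nonneg (hb₁ : 0 ≤ b₁) (hb₁' : b₁ ≤ 1) (hb₂ : 0 ≤ b₂) (hb₂' : b₂ ≤ 1) {N : ℕ}
    (f : Bool) (Y Z : Fin N → ℤ) : 0 ≤ jumpWeight b₁ b₂ f Y Z := by
  induction N generalizing f with
  | zero => simp [jumpWeight]
  | succ N ih =>
    have h1 : 0 ≤ 1 - b₁ := by linarith
    have h2 : 0 ≤ 1 - b₂ := by linarith
    have h3 := ih false (Fin.tail Y) (Fin.tail Z)
    have h4 := ih true (Fin.tail Y) (Fin.tail Z)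
    rw [jumpWeight]
    split_ifs <;> positivity

theorem jumpWeight_true {N : ℕ} (Y Z : Fin (N + 1) → ℤ) :
    (1 - b₁) * jumpWeight b₁ b₂ true Y Z =
      if Z 0 = Y 0 then 0 else jumpWeight b₁ b₂ false Y Z := by
  rw [jumpWeight, jumpWeight]
  split_ifs <;> simp_all [mul_assoc]

theorem interlaced_succ_iff {N : ℕ} {Y Z : Fin (N + 1) → ℤ} :
    Interlaced Y Z ↔ Y 0 ≤ Z 0 ∧ (∀ i, Z 0 ≤ Fin.tail Y i) ∧
      Interlaced (Fin.tail Y) (Fin.tail Z) := by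
  simp only [Interlaced, Fin.forall_fin_succ, Fin.tail, Fin.succ_lt_succ_iff, Fin.succ_pos,
    forall_const, Fin.not_lt_zero, false_imp_iff, true_and]
  tauto

theorem strictMono_succ_iff {N : ℕ} {Z : Fin (N + 1) → ℤ} :
    StrictMono Z ↔ (∀ i, Z 0 < Fin.tail Z i) ∧ StrictMono (Fin.tail Z) := by
  simp only [StrictMono, Fin.forall_fin_succ, Fin.tail, Fin.succ_lt_succ_iff, Fin.succ_pos,
    forall_const, Fin.not_lt_zero, false_imp_iff, true_and]

theorem jumpWeight_ne_zero {N : ℕ} {f : Bool} {Y Z : Fin N → ℤ} (hY : StrictMono Y)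
    (h : jumpWeight b₁ b₂ f Y Z ≠ 0) :
    Interlaced Y Z ∧ StrictMono Z ∧ (f = true → ∀ i : Fin N, (i : ℕ) = 0 → Y i < Z i) := by
  induction N generalizing f with
  | zero => exact ⟨⟨fun i => i.elim0, fun i => i.elim0⟩, fun i => i.elim0, fun _ i => i.elim0⟩
  | succ N ih =>
    rw [strictMono_succ_iff] at hY
    rw [interlaced_succ_iff, strictMono_succ_iff]
    have hd : Y 0 < Z 0 → f = true → ∀ i : Fin (N + 1), (i : ℕ) = 0 → Y i < Z i := by
      intro h0 _ i hi
      obtain rfl : i = 0 := Fin.ext hi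
      exact h0
    by_cases h0 : Y 0 ≤ Z 0 ∧ ∀ i, Z 0 ≤ Fin.tail Y i
    swap
    · exact absurd (jumpWeight_of_not f h0 hY.1) h
    obtain ⟨h3, h5⟩ := h0
    rcases h3.eq_or_lt with h1 | h3
    · rw [jumpWeight_of_eq f h1.symm] at h
      cases f with
      | true => exact absurd rfl h
      | false =>
        obtain ⟨k1, k2, -⟩ := ih hY.2 (right_ne_zero_of_mul h)
        exact ⟨⟨h3, h5, k1⟩, ⟨fun i => (h1 ▸ hY.1 i).trans_le (k1.1 i), k2⟩, by simp⟩
    by_cases h4 : ∀ i, Z 0 < Fin.tail Y i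
    · rw [jumpWeight_of_lt f h3 h4] at h
      obtain ⟨k1, k2, -⟩ := ih hY.2 (right_ne_zero_of_mul (right_ne_zero_of_mul h))
      exact ⟨⟨h3.le, h5, k1⟩, ⟨fun i => (h4 i).trans_le (k1.1 i), k2⟩, hd h3⟩
    · rw [jumpWeight_of_push f h3 h4 h5] at h
      obtain ⟨k1, k2, k3⟩ := ih hY.2 (right_ne_zero_of_mul h)
      refine ⟨⟨h3.le, h5, k1⟩, ⟨fun i => ?_, k2⟩, hd h3⟩
      cases N with
      | zero => exact i.elim0
      | succ N => exact ((h5 0).trans_lt (k3 rfl 0 rfl)).trans_le (k2.monotone (Fin.zero_le i))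

/-- The factor by which the vertex weight at the site `x` changes when the first particle, moving from
`y` to `z`, is added to the other ones; `c` is the change at the site `z` when `y < z`. -/
noncomputable def firstFactor (b₁ b₂ c : ℝ) (y z x : ℤ) : ℝ :=
  if x = y then (if z = y then b₁ else 1 - b₁)
  else if y < x ∧ x < z then b₂ else if y < x ∧ x = z then c else 1

theorem finprod_firstFactor {y z : ℤ} (h : y ≤ z) (c : ℝ) :
    (Function.mulSupport (firstFactor b₁ b₂ c y z)).Finite ∧
    ∏ᶠ x, firstFactor b₁ b₂ c y z x =
      if z = y then b₁ else (1 - b₁) * b₂ ^ (z - y - 1) * c := by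
  have hsub : Function.mulSupport (firstFactor b₁ b₂ c y z) ⊆ (Finset.Icc y z : Finset ℤ) := by
    intro x hx
    by_contra hcon
    simp only [Finset.coe_Icc, Set.mem_Icc, not_and_or, not_le] at hcon
    refine hx ?_
    rw [firstFactor, if_neg (by omega), if_neg (by omega), if_neg (by omega)]
  refine ⟨(Finset.finite_toSet _).subset hsub, ?_⟩
  rw [finprod_eq_prod_of_mulSupport_subset _ hsub]
  rcases h.eq_or_lt with rfl | h
  · simp [firstFactor]
  rw [if_neg h.ne', ← Finset.Ioc_insert_left h.le, Finset.prod_insert (by simp),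
    ← Finset.Ioo_insert_right h, Finset.prod_insert (by simp)]
  have h1 : ∏ x ∈ Finset.Ioo y z, firstFactor b₁ b₂ c y z x = b₂ ^ (z - y - 1) := by
    rw [Finset.prod_congr rfl (g := fun _ => b₂), Finset.prod_const, Int.card_Ioo,
      ← zpow_natCast, Int.toNat_of_nonneg (by omega)]
    intro x hx
    rw [Finset.mem_Ioo] at hx
    rw [firstFactor, if_neg (by omega), if_pos hx]
  rw [h1, firstFactor, firstFactor, if_pos rfl, if_neg h.ne', if_neg h.ne',
    if_neg (by omega), if_pos ⟨h, rfl⟩]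
  ring

theorem siteVertex_weight_succ (hb₁ : b₁ ≠ 1) {N : ℕ} {Y Z : Fin (N + 1) → ℤ}
    (hY : StrictMono Y) (hZ : StrictMono Z) (h : Interlaced Y Z) (x : ℤ) :
    (siteVertex Y Z x).weight 1 b₁ b₂ (1 - b₁) (1 - b₂) =
      firstFactor b₁ b₂ (if ∀ i, Z 0 < Fin.tail Y i then 1 - b₂ else (1 - b₁)⁻¹) (Y 0) (Z 0) x *
      (siteVertex (Fin.tail Y) (Fin.tail Z) x).weight 1 b₁ b₂ (1 - b₁) (1 - b₂) := by
  have hb₁' : 1 - b₁ ≠ 0 := sub_ne_zero.2 hb₁.symm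
  rw [strictMono_succ_iff] at hY hZ
  rw [interlaced_succ_iff] at h
  obtain ⟨h1, h2, h3⟩ := h
  rw [siteVertex, siteVertex]
  simp only [Fin.exists_fin_succ, ← Fin.tail.eq_1]
  by_cases hout : x < Y 0 ∨ Z 0 < x
  · -- outside the path of the first particle nothing changes
    have e1 : ¬(Y 0 < x ∧ x ≤ Z 0) := by omega
    have e2 : Y 0 ≠ x := by omega
    have e3 : Z 0 ≠ x := by omega
    rw [firstFactor, if_neg (by omega), if_neg (by omega), if_neg (by omega), one_mul]
    simp only [e1, e2, e3, false_or]
  have hx : Y 0 ≤ x ∧ x ≤ Z 0 := by omega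
  have e1 : ¬ ∃ i, Fin.tail Y i < x ∧ x ≤ Fin.tail Z i := by
    rintro ⟨i, hi, -⟩
    have := h2 i
    omega
  have e3 : ¬ ∃ i, Fin.tail Z i = x := by
    rintro ⟨i, hi⟩
    have := hZ.1 i
    omega
  by_cases e2 : ∃ i, Fin.tail Y i = x
  · -- the first particle pushes the second one
    obtain ⟨i, hi⟩ := e2
    have := h2 i
    have := hY.1 i
    have e2' : ∃ i : Fin N, Fin.tail Y i = x := ⟨i, hi⟩
    have e4 : ¬ ∀ i, Z 0 < Fin.tail Y i := fun hcon => by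
      have := hcon i
      omega
    have e5 : Y 0 < x ∧ x ≤ Z 0 := by omega
    rw [firstFactor, if_neg (by omega), if_neg (by omega), if_pos (by omega), if_neg e4]
    simp [e1, e3, e2', e5, Vertex.ofEdges, Vertex.weight, hb₁']
  · simp only [e1, e2, e3, or_false, decide_false]
    rcases hx.1.eq_or_lt with h4 | h4
    · subst h4
      rcases h1.eq_or_lt with h5 | h5
      · simp [firstFactor, ← h5, Vertex.ofEdges, Vertex.weight]
      · simp [firstFactor, h5.ne', Vertex.ofEdges, Vertex.weight]
    rcases hx.2.lt_or_eq with h5 | h5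
    · simp [firstFactor, h4, h4.ne, h4.ne', h5, h5.ne', h5.le, Vertex.ofEdges, Vertex.weight]
    · have e4 : ∀ i, Z 0 < Fin.tail Y i := fun i =>
        lt_of_le_of_ne (h2 i) fun h6 => e2 ⟨i, by omega⟩
      subst h5
      simp [firstFactor, h4, h4.ne, h4.ne', Vertex.ofEdges, Vertex.weight, e4]

theorem finite_mulSupport_siteVertex_weight (wa₂ wb₁ wb₂ wc₁ wc₂ : ℝ) {N : ℕ}
    (X Y : Fin N → ℤ) : (Function.mulSupport fun x =>
      (siteVertex X Y x).weight wa₂ wb₁ wb₂ wc₁ wc₂).Finite := by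
  refine (finite_siteVertex_ne X Y).subset fun x hx h => hx ?_
  simp only at h ⊢
  rw [h]
  rfl

theorem jumpWeight_eq_finprod (hb₁ : b₁ ≠ 1) {N : ℕ} {Y Z : Fin N → ℤ}
    (hY : StrictMono Y) (hZ : StrictMono Z) (h : Interlaced Y Z) :
    jumpWeight b₁ b₂ false Y Z =
      ∏ᶠ x, (siteVertex Y Z x).weight 1 b₁ b₂ (1 - b₁) (1 - b₂) := by
  have hb₁' : 1 - b₁ ≠ 0 := sub_ne_zero.2 hb₁.symm
  induction N with
  | zero => simp [jumpWeight, siteVertex, Vertex.ofEdges, Vertex.weight]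
  | succ N ih =>
    have h' := interlaced_succ_iff.1 h
    have hY' := strictMono_succ_iff.1 hY
    have hZ' := strictMono_succ_iff.1 hZ
    simp_rw [siteVertex_weight_succ hb₁ hY hZ h]
    rw [finprod_mul_distrib (finprod_firstFactor h'.1 _).1
      (finite_mulSupport_siteVertex_weight _ _ _ _ _ _ _), (finprod_firstFactor h'.1 _).2,
      ← ih hY'.2 hZ'.2 h'.2.2]
    rcases h'.1.eq_or_lt with h1 | h1
    · rw [jumpWeight_of_eq _ h1.symm, if_pos h1.symm]
      simp
    rw [if_neg h1.ne']
    by_cases h3 : ∀ i, Z 0 < Fin.tail Y i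
    · rw [jumpWeight_of_lt _ h1 h3, if_pos h3]
      simp [mul_assoc]
    -- the pushed particle carries no factor `1 - b₁` of its own
    rw [jumpWeight_of_push _ h1 h3 h'.2.1, if_neg h3]
    cases N with
    | zero => exact absurd (fun i => i.elim0) h3
    | succ N =>
      have h6 := jumpWeight_true (b₁ := b₁) (b₂ := b₂) (Fin.tail Y) (Fin.tail Z)
      rw [if_neg] at h6
      · rw [← h6]
        field_simp
        simp
      · intro h7
        refine h3 fun i => ?_
        exact ((hZ'.1 0).trans_eq h7).trans_le (hY'.2.monotone (Fin.zero_le i))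

theorem transfer_eq_jumpWeight (hb₁ : b₁ ≠ 1) {N : ℕ} (Y Z : Config N) :
    transfer 1 b₁ b₂ (1 - b₁) (1 - b₂) Y Z = jumpWeight b₁ b₂ false Y.1 Z.1 := by
  rw [transfer_eq]
  split_ifs with h
  · exact (jumpWeight_eq_finprod hb₁ Y.2 Z.2 h).symm
  · by_contra hne
    exact h (jumpWeight_ne_zero Y.2 (Ne.symm hne)).1

end SixVertex

namespace SixVertex

/-! ### Integration over the torus -/

open MeasureTheory

/-- The circle of radius `r` around the origin, the domain of the inverse variables `p = z⁻¹`. The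
absolute value makes `circleMap` land in it for every `r`. -/
abbrev Circ (r : ℝ) : Type := Metric.sphere (0 : ℂ) |r|

/-- The parametrization of the circle by angles, clockwise: it is inverse to the positively oriented
circle of radius `r⁻¹`. -/
noncomputable def circParam (r θ : ℝ) : Circ r := ⟨circleMap 0 r (-θ), circleMap_mem_sphere' 0 r (-θ)⟩

theorem continuous_circParam (r : ℝ) : Continuous (circParam r) :=
  ((continuous_circleMap 0 r).comp continuous_neg).subtype_mk _

/-- The uniform probability measure on the circle. -/
noncomputable def circMeasure (r : ℝ) : Measure (Circ r) :=
  ((ENNReal.ofReal (2 * Real.pi))⁻¹ • volume.restrict (Set.Icc 0 (2 * Real.pi))).map (circParam r)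

instance (r : ℝ) : IsProbabilityMeasure (circMeasure r) := by
  refine ⟨?_⟩
  rw [circMeasure, Measure.map_apply (continuous_circParam r).measurable MeasurableSet.univ]
  simp only [Set.preimage_univ, Measure.smul_apply, Measure.restrict_apply_univ, Real.volume_Icc,
    sub_zero, smul_eq_mul]
  exact ENNReal.inv_mul_cancel (by simp [Real.pi_pos]) ENNReal.ofReal_ne_top

/-- The uniform probability measure on the torus. -/
noncomputable abbrev torusMeasure (r : ℝ) (k : ℕ) : Measure (Fin k → Circ r) :=
  Measure.pi fun _ => circMeasure r

theorem integrable_of_continuous_compact {X : Type*} [TopologicalSpace X] [CompactSpace X]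
    [MeasurableSpace X] [OpensMeasurableSpace X] {μ : Measure X} [IsFiniteMeasure μ]
    {f : X → ℂ} (hf : Continuous f) : Integrable f μ :=
  hf.integrable_of_hasCompactSupport (HasCompactSupport.of_compactSpace f)

variable {r : ℝ}

theorem norm_circ (hr : 0 < r) (w : Circ r) : ‖(w : ℂ)‖ = r := by
  exact (mem_sphere_zero_iff_norm.1 w.2).trans (abs_of_pos hr)

theorem circ_ne_zero (hr : 0 < r) (w : Circ r) : (w : ℂ) ≠ 0 := by
  rw [← norm_pos_iff, norm_circ hr]
  exact hr

/-- Mean value property. -/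
theorem integral_circ {f : ℂ → ℂ} (hr : 0 < r)
    (hf : DifferentiableOn ℂ f (Metric.closedBall 0 r)) :
    ∫ w : Circ r, f w ∂circMeasure r = f 0 := by
  have hc : ContinuousOn f (Metric.sphere 0 r) :=
    hf.continuousOn.mono Metric.sphere_subset_closedBall
  have hd : DiffContOnCl ℂ f (Metric.ball 0 |r|) := by
    rw [abs_of_pos hr]
    exact hf.diffContOnCl_ball subset_rfl
  have hf' : Continuous fun w : Circ r => f w := by
    rw [← abs_of_pos hr] at hc
    exact continuousOn_iff_continuous_domRestrict.1 hc
  rw [← hd.circleAverage, Real.circleAverage_def, circMeasure, integral_map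
    (continuous_circParam r).aemeasurable hf'.aestronglyMeasurable, integral_smul_measure,
    integral_Icc_eq_integral_Ioc, ← intervalIntegral.integral_of_le (by positivity),
    ENNReal.toReal_inv, ENNReal.toReal_ofReal (by positivity)]
  congr 1
  simp only [circParam]
  rw [intervalIntegral.integral_comp_neg (fun θ => f (circleMap 0 r θ)), neg_zero]
  have h : (fun θ => f (circleMap 0 r θ)).Periodic (2 * Real.pi) :=
    fun x => by simp [periodic_circleMap 0 r x]
  have := h.intervalIntegral_add_eq (-(2 * Real.pi)) 0
  simpa using this

theorem integral_torus_insertNth {k : ℕ} (j : Fin (k + 1)) {f : (Fin (k + 1) → Circ r) → ℂ}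
    (hf : Continuous f) :
    ∫ w, f w ∂torusMeasure r (k + 1) =
      ∫ w, ∫ a, f (j.insertNth a w) ∂circMeasure r ∂torusMeasure r k := by
  have h := (measurePreserving_piFinSuccAbove (fun _ : Fin (k + 1) => circMeasure r) j).symm
  rw [← h.integral_comp', integral_prod_symm]
  · rfl
  · refine integrable_of_continuous_compact (hf.comp ?_)
    change Continuous fun x : Circ r × (Fin k → Circ r) =>
      (j.insertNth x.1 x.2 : Fin (k + 1) → Circ r)
    fun_prop

theorem integral_torus_insertNth' {k : ℕ} (j : Fin (k + 1)) {f : (Fin (k + 1) → Circ r) → ℂ}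
    (hf : Continuous f) :
    ∫ w, f w ∂torusMeasure r (k + 1) =
      ∫ a, ∫ w, f (j.insertNth a w) ∂torusMeasure r k ∂circMeasure r := by
  have h := (measurePreserving_piFinSuccAbove (fun _ : Fin (k + 1) => circMeasure r) j).symm
  rw [← h.integral_comp', integral_prod]
  · rfl
  · refine integrable_of_continuous_compact (hf.comp ?_)
    change Continuous fun x : Circ r × (Fin k → Circ r) =>
      (j.insertNth x.1 x.2 : Fin (k + 1) → Circ r)
    fun_prop

theorem integral_torus_comp_perm {k : ℕ} (σ : Equiv.Perm (Fin k)) (f : (Fin k → Circ r) → ℂ) :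
    ∫ w, f (fun i => w (σ i)) ∂torusMeasure r k = ∫ w, f w ∂torusMeasure r k := by
  have h := measurePreserving_piCongrLeft (fun _ : Fin k => circMeasure r) σ.symm
  rw [← h.integral_comp' f]
  congr 1 with w
  congr 1 with i
  have := Equiv.piCongrLeft_apply_apply (fun _ : Fin k => Circ r) σ.symm w (σ i)
  rw [MeasurableEquiv.coe_piCongrLeft]
  simp_all

end SixVertex

namespace SixVertex

/-! ### The Bethe kernel and functions orthogonal to it -/

open MeasureTheory

/-- The cross-term in the inverse variables `p = u⁻¹` and `q = v⁻¹`: it is `τ p q` times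
`cross τ u v`. -/
noncomputable def twoBody (τ : ℝ) (p q : ℂ) : ℂ := 1 - (1 + τ) * q + τ * p * q

/-- The factor of the kernel that belongs to a pair of particles. -/
noncomputable def pairFactor (τ : ℝ) (p q : ℂ) : ℂ := (p - q) / twoBody τ p q

/-- The kernel `∏_{i < j} (p_i - p_j) / twoBody τ p_i p_j`, ordered by its first variable. -/
noncomputable def bethe (τ : ℝ) : {k : ℕ} → (Fin k → ℂ) → ℂ
  | 0, _ => 1
  | _ + 1, p => (∏ j, pairFactor τ (p 0) (Fin.tail p j)) * bethe τ (Fin.tail p)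

theorem bethe_eq_prod (τ : ℝ) {k : ℕ} (p : Fin k → ℂ) :
    bethe τ p = ∏ i, ∏ j ∈ Finset.Ioi i, pairFactor τ (p i) (p j) := by
  induction k with
  | zero => simp [bethe]
  | succ k ih =>
    rw [bethe, ih, Fin.prod_univ_succ, Fin.prod_Ioi_zero]
    simp only [Fin.prod_Ioi_succ]
    rfl

variable {τ r : ℝ}

theorem twoBody_ne_zero (hτ : 0 < τ) (hr : (1 + τ) * r + τ * r ^ 2 < 1) {p q : ℂ} (hp : ‖p‖ ≤ r)
    (hq : ‖q‖ ≤ r) : twoBody τ p q ≠ 0 := by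
  intro h
  have h1 : (1 : ℂ) = (1 + τ) * q - τ * p * q := by
    rw [twoBody] at h
    linear_combination h
  have h2 : ‖(1 + τ : ℂ) * q - τ * p * q‖ ≤ (1 + τ) * r + τ * r * r := by
    refine (norm_sub_le _ _).trans ?_
    have h3 : ‖(1 + τ : ℂ)‖ = 1 + τ := by
      rw [← Complex.ofReal_one, ← Complex.ofReal_add, Complex.norm_real, Real.norm_of_nonneg]
      linarith
    rw [norm_mul, norm_mul, norm_mul, h3, Complex.norm_real, Real.norm_of_nonneg hτ.le]
    have h0 : 0 ≤ r := (norm_nonneg p).trans hp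
    gcongr
  rw [← h1, norm_one] at h2
  nlinarith

theorem radius_lt_one (hτ : 0 < τ) (hr0 : 0 < r) (hr : (1 + τ) * r + τ * r ^ 2 < 1) : r < 1 := by
  nlinarith [mul_pos hτ hr0, mul_pos hτ (pow_pos hr0 2)]

/-- The variables on the circle, as complex numbers. -/
def toC {k : ℕ} (w : Fin k → Circ r) : Fin k → ℂ := fun i => w i

theorem continuous_pairFactor (hτ : 0 < τ) (hr0 : 0 < r) (hr : (1 + τ) * r + τ * r ^ 2 < 1)
    {X : Type*} [TopologicalSpace X] {f g : X → Circ r} (hf : Continuous f) (hg : Continuous g) :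
    Continuous fun x => pairFactor τ (f x) (g x) := by
  unfold pairFactor
  refine Continuous.div (by fun_prop) (by unfold twoBody; fun_prop) fun x => ?_
  exact twoBody_ne_zero hτ hr (norm_circ hr0 _).le (norm_circ hr0 _).le

theorem continuous_bethe (hτ : 0 < τ) (hr0 : 0 < r) (hr : (1 + τ) * r + τ * r ^ 2 < 1) (k : ℕ) :
    Continuous fun w : Fin k → Circ r => bethe τ (toC w) := by
  simp_rw [bethe_eq_prod]
  refine continuous_finsetProd _ fun i _ => continuous_finsetProd _ fun j _ => ?_
  exact continuous_pairFactor hτ hr0 hr (continuous_apply i) (continuous_apply j)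

/-- The continuous functions on the torus that are orthogonal to the Bethe kernel, multiplied by any
function of product form. -/
def betheNull (τ r : ℝ) (hτ : 0 < τ) (hr0 : 0 < r) (hr : (1 + τ) * r + τ * r ^ 2 < 1) (k : ℕ) :
    Submodule ℂ ((Fin k → Circ r) → ℂ) where
  carrier := {F | Continuous F ∧ ∀ s : Circ r → ℂ, Continuous s →
    ∫ w, bethe τ (toC w) * (∏ i, s (w i)) * F w ∂torusMeasure r k = 0}
  zero_mem' := ⟨continuous_const, fun s _ => by simp⟩
  add_mem' := by
    rintro F G ⟨hF, hF'⟩ ⟨hG, hG'⟩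
    refine ⟨hF.add hG, fun s hs => ?_⟩
    have := continuous_bethe hτ hr0 hr k
    simp only [Pi.add_apply, mul_add]
    rw [integral_add, hF' s hs, hG' s hs, add_zero] <;>
      exact integrable_of_continuous_compact (by fun_prop)
  smul_mem' := by
    rintro c F ⟨hF, hF'⟩
    refine ⟨hF.const_smul c, fun s hs => ?_⟩
    simp only [Pi.smul_apply, smul_eq_mul, mul_left_comm _ c]
    rw [integral_const_mul, hF' s hs, mul_zero]

variable {hτ : 0 < τ} {hr0 : 0 < r} {hr : (1 + τ) * r + τ * r ^ 2 < 1}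

theorem mul_tail_mem_betheNull {k : ℕ} {F : (Fin k → Circ r) → ℂ}
    (hF : F ∈ betheNull τ r hτ hr0 hr k) {g : Circ r → ℂ} (hg : Continuous g) :
    (fun w => g (w 0) * F (Fin.tail w)) ∈ betheNull τ r hτ hr0 hr (k + 1) := by
  have hFc : Continuous F := hF.1
  have hcont : Continuous fun w : Fin (k + 1) → Circ r => g (w 0) * F (Fin.tail w) := by
    unfold Fin.tail
    fun_prop
  refine ⟨hcont, fun s hs => ?_⟩
  have := continuous_bethe hτ hr0 hr (k + 1)
  rw [integral_torus_insertNth' 0 (by fun_prop)]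
  simp only [Fin.insertNth_zero']
  refine integral_eq_zero_of_ae (Filter.Eventually.of_forall fun a => ?_)
  -- for fixed `p₀` the pair factors with `p₀` become a part of the function of product form
  have key := hF.2 (fun b => s b * pairFactor τ a b)
    (hs.mul (continuous_pairFactor hτ hr0 hr continuous_const continuous_id))
  have h : ∀ w : Fin k → Circ r,
      bethe τ (toC (Fin.cons a w : Fin (k + 1) → Circ r)) *
        (∏ i, s ((Fin.cons a w : Fin (k + 1) → Circ r) i)) *
        (g ((Fin.cons a w : Fin (k + 1) → Circ r) 0) *
          F (Fin.tail (Fin.cons a w : Fin (k + 1) → Circ r))) =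
      (s a * g a) * (bethe τ (toC w) * (∏ i, s (w i) * pairFactor τ a (w i)) * F w) := by
    intro w
    rw [bethe, Fin.prod_univ_succ, Finset.prod_mul_distrib]
    simp only [Fin.cons_zero, Fin.cons_succ, Fin.tail_cons]
    have h1 : Fin.tail (toC (Fin.cons a w : Fin (k + 1) → Circ r)) = toC w := by
      ext i
      simp [Fin.tail, toC]
    rw [h1]
    simp only [toC, Fin.cons_zero]
    ring
  simp only [h]
  rw [integral_const_mul, key, mul_zero]
  rfl

theorem swap_succ_succ {k : ℕ} (j : Fin k) :
    Equiv.swap (0 : Fin (k + 2)) 1 j.succ.succ = j.succ.succ := by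
  refine Equiv.swap_apply_of_ne_of_ne (Fin.succ_ne_zero _) ?_
  rw [← Fin.succ_zero_eq_one]
  exact fun h => Fin.succ_ne_zero _ (Fin.succ_injective _ h)

/-- The integrand changes sign when the first two variables are exchanged. -/
theorem twoBody_mul_mem_betheNull {k : ℕ} {G : (Fin (k + 2) → Circ r) → ℂ} (hG : Continuous G)
    (hsymm : ∀ w, G (fun i => w (Equiv.swap 0 1 i)) = G w) :
    (fun w => twoBody τ (w 0) (w 1) * G w) ∈ betheNull τ r hτ hr0 hr (k + 2) := by
  have hcont : Continuous fun w : Fin (k + 2) → Circ r => twoBody τ (w 0) (w 1) * G w := by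
    unfold twoBody
    fun_prop
  refine ⟨hcont, fun s hs => ?_⟩
  have h : ∀ w : Fin (k + 2) → Circ r,
      bethe τ (toC w) * (∏ i, s (w i)) * (twoBody τ (w 0) (w 1) * G w) =
      (w 0 - w 1) * ((∏ j : Fin k, pairFactor τ (w 0) (w j.succ.succ)) *
        (∏ j : Fin k, pairFactor τ (w 1) (w j.succ.succ)) *
        bethe τ (Fin.tail (Fin.tail (toC w)))) * (∏ i, s (w i)) * G w := by
    intro w
    have h1 : twoBody τ (w 0) (w 1) ≠ 0 :=
      twoBody_ne_zero hτ hr (norm_circ hr0 _).le (norm_circ hr0 _).le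
    rw [bethe, bethe, Fin.prod_univ_succ]
    simp only [Fin.tail, toC, pairFactor, Fin.succ_zero_eq_one]
    field_simp
  have hanti : ∀ w : Fin (k + 2) → Circ r,
      (fun w => bethe τ (toC w) * (∏ i, s (w i)) * (twoBody τ (w 0) (w 1) * G w))
        (fun i => w (Equiv.swap 0 1 i)) =
      -(bethe τ (toC w) * (∏ i, s (w i)) * (twoBody τ (w 0) (w 1) * G w)) := by
    intro w
    have h2 : ∀ j : Fin k, Equiv.swap (0 : Fin (k + 2)) 1 j.succ.succ = j.succ.succ := fun j =>
      swap_succ_succ j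
    have h3 : Fin.tail (Fin.tail (toC fun i => w (Equiv.swap 0 1 i))) =
        Fin.tail (Fin.tail (toC w)) := by
      ext i
      simp [Fin.tail, toC, h2]
    beta_reduce
    rw [h, h, hsymm, h3, Equiv.prod_comp (Equiv.swap 0 1) fun i => s (w i)]
    simp only [h2, Equiv.swap_apply_left, Equiv.swap_apply_right]
    ring
  have h4 := integral_torus_comp_perm (Equiv.swap 0 1)
    (fun w : Fin (k + 2) → Circ r =>
      bethe τ (toC w) * (∏ i, s (w i)) * (twoBody τ (w 0) (w 1) * G w))
  simp only [hanti] at h4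
  rw [integral_neg] at h4
  exact self_eq_neg.1 h4.symm

end SixVertex

namespace SixVertex

/-! ### Plane waves and the backward equation -/

open MeasureTheory

/-- The sum over all increasing choices `s₁ < ⋯ < s_k` of `k` among the `N` particles of the plane
waves `∏ᵢ τ ^ sᵢ * pᵢ ^ y_{sᵢ}` (with particles numbered from `1`), defined by recursion on the
number of particles. -/
noncomputable def wave (τ : ℝ) : {N : ℕ} → (Fin N → ℤ) → {k : ℕ} → (Fin k → ℂ) → ℂ
  | _, _, 0, _ => 1
  | 0, _, _ + 1, _ => 0
  | _ + 1, Y, k + 1, p =>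
    τ ^ (k + 1) * (p 0 ^ Y 0 * wave τ (Fin.tail Y) (Fin.tail p) + wave τ (Fin.tail Y) p)

theorem wave_zero_right (τ : ℝ) {N : ℕ} (Y : Fin N → ℤ) (p : Fin 0 → ℂ) : wave τ Y p = 1 := by
  cases N <;> rfl

theorem wave_succ (τ : ℝ) {N k : ℕ} (Y : Fin (N + 1) → ℤ) (p : Fin (k + 1) → ℂ) :
    wave τ Y p =
      τ ^ (k + 1) * (p 0 ^ Y 0 * wave τ (Fin.tail Y) (Fin.tail p) + wave τ (Fin.tail Y) p) := rfl

/-- The eigenvalue of a plane wave for one particle that moves alone. -/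
noncomputable def eigen (b₁ b₂ : ℝ) (p : ℂ) : ℂ := (b₁ + (1 - b₁ - b₂) * p) / (1 - b₂ * p)

/-- The value of the mean of `wave` after one step, up to functions orthogonal to the Bethe kernel;
the flag says whether the first particle is pushed. The second term of the last case
has the factor `(1 - b₂) * p / (1 - b₂ * p) - eigen b₁ b₂ p`, the difference between the eigenvalues
of a particle that has to move and of a free one. -/
noncomputable def waveStep (b₁ b₂ τ : ℝ) :
    Bool → {N : ℕ} → (Fin N → ℤ) → {k : ℕ} → (Fin k → ℂ) → ℂ
  | false, _, Y, _, p => (∏ i, eigen b₁ b₂ (p i)) * wave τ Y p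
  | true, _ + 1, Y, k + 1, p => (∏ i, eigen b₁ b₂ (p i)) * wave τ Y p +
      τ ^ (k + 1) * (b₁ * (p 0 - 1) / (1 - b₂ * p 0)) * p 0 ^ Y 0 *
        (∏ i, eigen b₁ b₂ (Fin.tail p i)) * wave τ (Fin.tail Y) (Fin.tail p)
  | true, 0, Y, _, p => (∏ i, eigen b₁ b₂ (p i)) * wave τ Y p
  | true, _, Y, 0, p => (∏ i, eigen b₁ b₂ (p i)) * wave τ Y p

theorem _root_.HasSum.of_eq {β : Type*} {f g : β → ℂ} {a b : ℂ} (h : HasSum f a)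
    (hf : ∀ i, g i = f i) (ha : b = a) : HasSum g b := by
  rw [funext hf, ha]
  exact h

theorem hasSum_cons {N : ℕ} {F : (Fin (N + 1) → ℤ) → ℂ} (T : Finset ℤ) {a : ℤ → ℂ}
    (hF : ∀ Z, Z 0 ∉ T → F Z = 0)
    (ha : ∀ z ∈ T, HasSum (fun Z' : Fin N → ℤ => F (Fin.cons z Z')) (a z)) :
    HasSum F (∑ z ∈ T, a z) := by
  have h : ∀ z ∈ T, HasSum (fun Z : Fin (N + 1) → ℤ => if Z 0 = z then F Z else 0) (a z) := by
    intro z hz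
    have hinj : Function.Injective fun Z' : Fin N → ℤ => (Fin.cons z Z' : Fin (N + 1) → ℤ) :=
      Fin.cons_right_injective (α := fun _ => ℤ) z
    rw [← hinj.hasSum_iff]
    · simpa [Function.comp_def] using ha z hz
    · intro Z hZ
      rw [if_neg]
      rintro rfl
      exact hZ ⟨Fin.tail Z, Fin.cons_self_tail Z⟩
  refine (hasSum_sum h).of_eq (fun Z => ?_) rfl
  by_cases hZ : Z 0 ∈ T
  · simp [hZ]
  · simp [hF Z hZ]

theorem sum_geom_Ioo {b p : ℂ} (hb : b ≠ 0) (hp : p ≠ 0) (hbp : 1 - b * p ≠ 0) {y y' : ℤ}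
    (h : y < y') :
    ∑ z ∈ Finset.Ioo y y', b ^ (z - y - 1) * (1 - b) * p ^ z =
      (1 - b) * p / (1 - b * p) * p ^ y - b ^ (y' - y - 1) * ((1 - b) / (1 - b * p)) * p ^ y' := by
  have h' : y + 1 ≤ y' := h
  clear h
  induction y', h' using Int.leInduction with
  | base =>
    rw [Finset.sum_eq_zero]
    · rw [zpow_add_one₀ hp]
      simp
      ring
    · intro x hx
      rw [Finset.mem_Ioo] at hx
      omega
  | succ z hz ih =>
    have h1 : Finset.Ioo y (z + 1) = insert z (Finset.Ioo y z) := by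
      ext x
      simp only [Finset.mem_Ioo, Finset.mem_insert]
      omega
    rw [h1, Finset.sum_insert (by simp), ih, zpow_add_one₀ hp,
      show z + 1 - y - 1 = (z - y - 1) + 1 by ring, zpow_add_one₀ hb]
    field_simp
    ring

variable {b₁ b₂ τ r : ℝ} {hτ : 0 < τ} {hr0 : 0 < r} {hr : (1 + τ) * r + τ * r ^ 2 < 1}

theorem one_sub_ne_zero {b : ℝ} (hb : 0 < b) (hb' : b < 1) (hr1 : r < 1) {p : ℂ} (hp : ‖p‖ ≤ r) :
    1 - b * p ≠ 0 := by
  intro h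
  have h1 : (1 : ℂ) = b * p := by linear_combination h
  have h2 : ‖(1 : ℂ)‖ = b * ‖p‖ := by
    rw [h1, norm_mul, Complex.norm_real, Real.norm_of_nonneg hb.le]
  rw [norm_one] at h2
  nlinarith [norm_nonneg p]

/-- The mean of `wave` after one step from `Y` is `ψ`, up to functions orthogonal to the Bethe
kernel. -/
def StepsTo (b₁ b₂ τ r : ℝ) (hτ : 0 < τ) (hr0 : 0 < r) (hr : (1 + τ) * r + τ * r ^ 2 < 1) (f : Bool)
    {N : ℕ} (Y : Fin N → ℤ) {k : ℕ} (ψ : (Fin k → Circ r) → ℂ) : Prop :=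
  ∃ v : (Fin k → Circ r) → ℂ,
    (∀ w, HasSum (fun Z => (jumpWeight b₁ b₂ f Y Z : ℂ) * wave τ Z (toC w)) (v w)) ∧
    v - ψ ∈ betheNull τ r hτ hr0 hr k

theorem stepsTo_zero (k : ℕ) (Y : Fin 0 → ℤ) :
    StepsTo b₁ b₂ τ r hτ hr0 hr false Y fun w : Fin k → Circ r =>
      waveStep b₁ b₂ τ false Y (toC w) := by
  refine ⟨_, fun w => ?_, by rw [sub_self]; exact Submodule.zero_mem _⟩
  refine (hasSum_unique fun Z : Fin 0 → ℤ => (jumpWeight b₁ b₂ false Y Z : ℂ) *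
    wave τ Z (toC w)).of_eq (fun _ => rfl) ?_
  cases k <;> simp [waveStep, jumpWeight, wave]

theorem stepsTo_one_true (hb₂ : 0 < b₂) (hb₂' : b₂ < 1) (k : ℕ) (Y : Fin 1 → ℤ) :
    StepsTo b₁ b₂ τ r hτ hr0 hr true Y fun w : Fin k → Circ r =>
      waveStep b₁ b₂ τ true Y (toC w) := by
  have hr1 := radius_lt_one hτ hr0 hr
  refine ⟨_, fun w => ?_, by rw [sub_self]; exact Submodule.zero_mem _⟩
  have hW : ∀ n : ℕ, jumpWeight b₁ b₂ true Y (fun _ => Y 0 + 1 + n) = b₂ ^ n * (1 - b₂) := by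
    intro n
    rw [jumpWeight_of_lt _ (by omega) (fun i => i.elim0)]
    simp [jumpWeight, show Y 0 + 1 + (n : ℤ) - Y 0 - 1 = n by ring]
  have hinj : Function.Injective fun (n : ℕ) (_ : Fin 1) => Y 0 + 1 + (n : ℤ) := by
    intro m n h
    have := congrFun h 0
    simp only at this
    omega
  rw [← hinj.hasSum_iff]
  · simp only [Function.comp_def, hW]
    have hg : ∀ p : ℂ, ‖p‖ ≤ 1 → HasSum (fun n : ℕ => (b₂ * p : ℂ) ^ n) (1 - b₂ * p)⁻¹ := by
      intro p hp
      refine hasSum_geometric_of_norm_lt_one ?_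
      rw [norm_mul, Complex.norm_real, Real.norm_of_nonneg hb₂.le]
      nlinarith [norm_nonneg p]
    match k, w with
    | 0, w =>
      have hb : (1 - b₂ : ℂ) ≠ 0 := by
        rw [← Complex.ofReal_one, ← Complex.ofReal_sub]
        exact Complex.ofReal_ne_zero.2 (by linarith)
      refine ((hg 1 (by simp)).mul_left (1 - b₂ : ℂ)).of_eq (fun n => ?_) ?_
      · rw [wave_zero_right]
        push_cast
        ring
      · simp [waveStep, wave_zero_right, mul_inv_cancel₀ hb]
    | 1, w =>
      have hp : ‖(w 0 : ℂ)‖ ≤ r := (norm_circ hr0 _).le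
      have hp0 : (w 0 : ℂ) ≠ 0 := circ_ne_zero hr0 _
      have hb : (1 - b₂ * w 0 : ℂ) ≠ 0 := one_sub_ne_zero hb₂ hb₂' hr1 hp
      refine ((hg _ (hp.trans hr1.le)).mul_left
        (τ * (1 - b₂) * w 0 ^ (Y 0 + 1) : ℂ)).of_eq (fun n => ?_) ?_
      · simp only [wave, toC]
        rw [zpow_add₀ hp0 _ (n : ℤ), zpow_natCast, mul_pow]
        push_cast
        ring
      · simp only [waveStep, wave, toC, Fin.tail, eigen, Fin.prod_univ_succ, Fin.prod_univ_zero]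
        rw [zpow_add_one₀ hp0]
        field_simp
        ring
    | k + 2, w =>
      refine (hasSum_zero (β := ℕ)).of_eq (fun n => ?_) ?_
      · simp [wave]
      · simp [waveStep, wave]
  · intro Z hZ
    have h : ¬ Y 0 < Z 0 := by
      intro h
      refine hZ ⟨(Z 0 - Y 0 - 1).toNat, funext fun i => ?_⟩
      rw [Subsingleton.elim i 0]
      simp only
      omega
    have h' : jumpWeight b₁ b₂ true Y Z = 0 := by
      rcases lt_trichotomy (Z 0) (Y 0) with h1 | h1 | h1
      · exact jumpWeight_of_not _ (fun h2 => absurd h2.1 (not_le.2 h1)) fun i => i.elim0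
      · rw [jumpWeight_of_eq _ h1, if_pos rfl]
      · exact absurd h1 h
    rw [h', Complex.ofReal_zero, zero_mul]

/-- A pushed particle moves alone, or it pushes the next particle. -/
theorem hasSum_jumpWeight_true {N : ℕ} {Y : Fin (N + 2) → ℤ} (hY : StrictMono Y)
    {g : (Fin (N + 2) → ℤ) → ℂ} {A : ℤ → ℂ} {B : ℂ}
    (hA : ∀ z, HasSum (fun Z => (jumpWeight b₁ b₂ false (Fin.tail Y) Z : ℂ) * g (Fin.cons z Z)) (A z))
    (hB : HasSum (fun Z => (jumpWeight b₁ b₂ true (Fin.tail Y) Z : ℂ) * g (Fin.cons (Y 1) Z)) B) :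
    HasSum (fun Z => (jumpWeight b₁ b₂ true Y Z : ℂ) * g Z)
      (∑ z ∈ Finset.Ioo (Y 0) (Y 1), (b₂ : ℂ) ^ (z - Y 0 - 1) * (1 - b₂) * A z +
        (b₂ : ℂ) ^ (Y 1 - Y 0 - 1) * B) := by
  have h01 : Y 0 < Y 1 := hY (by simp)
  have hY' := strictMono_succ_iff.1 hY
  have hT : ∀ i, Y 1 ≤ Fin.tail Y i := fun i => hY'.2.monotone (Fin.zero_le i)
  have e : ∑ z ∈ Finset.Ioo (Y 0) (Y 1), (b₂ : ℂ) ^ (z - Y 0 - 1) * (1 - b₂) * A z +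
        (b₂ : ℂ) ^ (Y 1 - Y 0 - 1) * B =
      ∑ z ∈ Finset.Ioc (Y 0) (Y 1), if z < Y 1 then (b₂ : ℂ) ^ (z - Y 0 - 1) * (1 - b₂) * A z else
        (b₂ : ℂ) ^ (Y 1 - Y 0 - 1) * B := by
    rw [← Finset.Ioo_insert_right h01, Finset.sum_insert (by simp), if_neg (lt_irrefl _), add_comm]
    congr 1
    refine Finset.sum_congr rfl fun z hz => ?_
    rw [if_pos (Finset.mem_Ioo.1 hz).2]
  rw [e]
  refine hasSum_cons _ (fun Z hZ => ?_) fun z hz => ?_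
  · rw [Finset.mem_Ioc] at hZ
    have h' : jumpWeight b₁ b₂ true Y Z = 0 := by
      by_cases h1 : Z 0 = Y 0
      · rw [jumpWeight_of_eq _ h1, if_pos rfl]
      · refine jumpWeight_of_not _ (fun h2 => hZ ⟨lt_of_le_of_ne h2.1 (Ne.symm h1), ?_⟩) hY'.1
        exact h2.2 0
    rw [h', Complex.ofReal_zero, zero_mul]
  · rw [Finset.mem_Ioc] at hz
    split_ifs with h1
    · refine ((hA z).mul_left _).of_eq (fun Z => ?_) rfl
      rw [jumpWeight_of_lt _ (by simpa using hz.1) (fun i => by simpa using h1.trans_le (hT i))]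
      simp
      ring
    · obtain rfl : z = Y 1 := by omega
      refine (hB.mul_left _).of_eq (fun Z => ?_) rfl
      rw [jumpWeight_of_push _ (by simpa using hz.1) (fun h => absurd (h 0) (by simp [Fin.tail]))
        (by simpa using hT)]
      simp
      ring

/-- A free particle stays, or it moves like a pushed one. -/
theorem hasSum_jumpWeight_false {N : ℕ} {Y : Fin (N + 1) → ℤ}
    {g : (Fin (N + 1) → ℤ) → ℂ} {A B : ℂ}
    (hA : HasSum (fun Z => (jumpWeight b₁ b₂ false (Fin.tail Y) Z : ℂ) * g (Fin.cons (Y 0) Z)) A)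
    (hB : HasSum (fun Z => (jumpWeight b₁ b₂ true Y Z : ℂ) * g Z) B) :
    HasSum (fun Z => (jumpWeight b₁ b₂ false Y Z : ℂ) * g Z) (b₁ * A + (1 - b₁) * B) := by
  have h1 : HasSum (fun Z : Fin (N + 1) → ℤ => if Z 0 = Y 0 then
      (b₁ : ℂ) * (jumpWeight b₁ b₂ false (Fin.tail Y) (Fin.tail Z) * g Z) else 0)
      (∑ z ∈ {Y 0}, b₁ * A) := by
    refine hasSum_cons _ (fun Z hZ => ?_) fun z hz => ?_
    · rw [if_neg (by simpa using hZ)]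
    · rw [Finset.mem_singleton] at hz
      subst hz
      exact (hA.mul_left (b₁ : ℂ)).of_eq (fun Z => by simp) rfl
  rw [Finset.sum_singleton] at h1
  refine (h1.add (hB.mul_left (1 - b₁ : ℂ))).of_eq (fun Z => ?_) rfl
  have h2 := congrArg (fun x : ℝ => (x : ℂ)) (jumpWeight_true (b₁ := b₁) (b₂ := b₂) Y Z)
  simp only [Complex.ofReal_mul, Complex.ofReal_sub, Complex.ofReal_one] at h2
  rw [← mul_assoc (1 - b₁ : ℂ), h2]
  split_ifs with h3
  · rw [jumpWeight_of_eq _ h3]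
    simp
    ring
  · simp

end SixVertex

namespace SixVertex
open MeasureTheory

variable {b₁ b₂ τ r : ℝ} {hτ : 0 < τ} {hr0 : 0 < r} {hr : (1 + τ) * r + τ * r ^ 2 < 1}

theorem continuous_zpow_circ (hr0 : 0 < r) (z : ℤ) : Continuous fun a : Circ r => (a : ℂ) ^ z :=
  continuous_subtype_val.zpow₀ _ fun a => Or.inl (circ_ne_zero hr0 a)

theorem continuous_wave (hr0 : 0 < r) {N : ℕ} (Y : Fin N → ℤ) {k : ℕ} :
    Continuous fun w : Fin k → Circ r => wave τ Y (toC w) := by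
  induction N generalizing k with
  | zero => cases k <;> exact continuous_const
  | succ N ih =>
    cases k with
    | zero => exact continuous_const
    | succ k =>
      have h1 := ih (Fin.tail Y) (k := k + 1)
      have h2 : Continuous fun w : Fin (k + 1) → Circ r =>
          wave τ (Fin.tail Y) (toC (Fin.tail w)) := (ih (Fin.tail Y)).comp (by
        unfold Fin.tail
        fun_prop)
      exact continuous_const.mul ((((continuous_zpow_circ hr0 _).comp
        (continuous_apply 0)).mul h2).add h1)

theorem continuous_eigen (hr0 : 0 < r) (hr1 : r < 1) (hb₂ : 0 < b₂) (hb₂' : b₂ < 1) :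
    Continuous fun a : Circ r => eigen b₁ b₂ a := by
  unfold eigen
  exact Continuous.div (by fun_prop) (by fun_prop) fun a =>
    one_sub_ne_zero hb₂ hb₂' hr1 (norm_circ hr0 a).le

theorem stepsTo_false_succ (hb₂ : 0 < b₂) (hb₂' : b₂ < 1) {N : ℕ} (k : ℕ) (Y : Fin (N + 1) → ℤ)
    (hF : ∀ k, StepsTo b₁ b₂ τ r hτ hr0 hr false (Fin.tail Y) fun w : Fin k → Circ r =>
      waveStep b₁ b₂ τ false (Fin.tail Y) (toC w))
    (hT : ∀ k, StepsTo b₁ b₂ τ r hτ hr0 hr true Y fun w : Fin k → Circ r =>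
      waveStep b₁ b₂ τ true Y (toC w)) :
    StepsTo b₁ b₂ τ r hτ hr0 hr false Y fun w : Fin k → Circ r =>
      waveStep b₁ b₂ τ false Y (toC w) := by
  have hr1 := radius_lt_one hτ hr0 hr
  obtain ⟨vT, hvT, hvT'⟩ := hT k
  obtain ⟨vF, hvF, hvF'⟩ := hF k
  cases k with
  | zero =>
    refine ⟨fun w => b₁ * vF w + (1 - b₁) * vT w, fun w => hasSum_jumpWeight_false ?_ (hvT w), ?_⟩
    · refine (hvF w).of_eq (fun Z => ?_) rfl
      rw [wave_zero_right, wave_zero_right]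
    · convert Submodule.add_mem _ (Submodule.smul_mem _ (b₁ : ℂ) hvF')
        (Submodule.smul_mem _ (1 - b₁ : ℂ) hvT') using 1
      ext w
      simp [waveStep, wave_zero_right]
      ring
  | succ k =>
    obtain ⟨vF₁, hvF₁, hvF₁'⟩ := hF k
    refine ⟨fun w => b₁ * (τ ^ (k + 1) * (w 0 ^ Y 0 * vF₁ (Fin.tail w) + vF w)) +
      (1 - b₁) * vT w, fun w => hasSum_jumpWeight_false ?_ (hvT w), ?_⟩
    · refine ((((hvF₁ (Fin.tail w)).mul_left ((w 0 : ℂ) ^ Y 0)).add (hvF w)).mul_left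
        ((τ : ℂ) ^ (k + 1))).of_eq (fun Z => ?_) rfl
      rw [wave_succ]
      simp only [Fin.cons_zero, Fin.tail_cons]
      change _ * (_ * ((w 0 : ℂ) ^ Y 0 * wave τ Z (toC (Fin.tail w)) + _)) = _
      ring
    · have hz := continuous_zpow_circ hr0 (Y 0)
      convert Submodule.add_mem _ (Submodule.smul_mem _ (b₁ * τ ^ (k + 1) : ℂ)
        (Submodule.add_mem _ (mul_tail_mem_betheNull hvF₁' hz) hvF'))
        (Submodule.smul_mem _ (1 - b₁ : ℂ) hvT') using 1
      ext w
      have hb : (1 - b₂ * w 0 : ℂ) ≠ 0 := one_sub_ne_zero hb₂ hb₂' hr1 (norm_circ hr0 _).le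
      have ht : toC (Fin.tail w) = Fin.tail (toC w) := rfl
      simp only [Pi.add_apply, Pi.sub_apply, Pi.smul_apply, smul_eq_mul, waveStep, ht]
      rw [Fin.prod_univ_succ, wave_succ]
      generalize wave τ (Fin.tail Y) (Fin.tail (toC w)) = A
      generalize wave τ (Fin.tail Y) (toC w) = B
      have hP : ∏ i, eigen b₁ b₂ (Fin.tail (toC w) i) = ∏ i : Fin k, eigen b₁ b₂ (toC w i.succ) := rfl
      rw [hP]
      generalize ∏ i : Fin k, eigen b₁ b₂ (toC w i.succ) = P
      simp only [toC, eigen]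
      field_simp
      ring

/-- The terms of `waveStep` that remain when the next particle is pushed or not: the plane waves in
which both particles take part combine to a multiple of `twoBody`. -/
theorem waveStep_true_identity (hb₁ : b₁ ≠ 0) (hτb : τ = b₂ / b₁) {N k : ℕ}
    (Y : Fin (N + 2) → ℤ) (p : Fin (k + 2) → ℂ)
    (hp₀ : 1 - b₂ * p 0 ≠ 0) (hp₁ : 1 - b₂ * p 1 ≠ 0) (c : ℂ) :
    τ ^ (k + 2) * (((1 - b₂) * p 0 / (1 - b₂ * p 0) * p 0 ^ Y 0 -
        c * ((1 - b₂) / (1 - b₂ * p 0)) * p 0 ^ Y 1) *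
          waveStep b₁ b₂ τ false (Fin.tail Y) (Fin.tail p) +
        (1 - c) * waveStep b₁ b₂ τ false (Fin.tail Y) p) +
      c * (τ ^ (k + 2) * (p 0 ^ Y 1 * waveStep b₁ b₂ τ true (Fin.tail Y) (Fin.tail p) +
        waveStep b₁ b₂ τ true (Fin.tail Y) p)) - waveStep b₁ b₂ τ true Y p =
    twoBody τ (p 0) (p 1) * (-c * τ ^ (2 * k + 3) * (b₁ * (1 - b₂)) *
      (p 0 ^ Y 1 * p 1 ^ Y 1) / ((1 - b₂ * p 0) * (1 - b₂ * p 1)) *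
      (∏ i, eigen b₁ b₂ (Fin.tail (Fin.tail p) i)) *
      wave τ (Fin.tail (Fin.tail Y)) (Fin.tail (Fin.tail p))) := by
  have hb : (b₂ : ℂ) = τ * b₁ := by
    rw [hτb]
    push_cast
    have : (b₁ : ℂ) ≠ 0 := Complex.ofReal_ne_zero.2 hb₁
    field_simp
  have h1 : Fin.tail p 0 = p 1 := rfl
  have h2 : Fin.tail Y 0 = Y 1 := rfl
  have h3 : ∀ i : Fin k, Fin.tail p i.succ = Fin.tail (Fin.tail p) i := fun i => rfl
  have h4 : ∀ i : Fin (k + 1), p i.succ = Fin.tail p i := fun i => rfl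
  simp only [waveStep]
  rw [wave_succ τ Y p, wave_succ τ (Fin.tail Y) p, wave_succ τ (Fin.tail Y) (Fin.tail p),
    Fin.prod_univ_succ (fun i => eigen b₁ b₂ (p i))]
  simp only [h4]
  rw [Fin.prod_univ_succ (fun i => eigen b₁ b₂ (Fin.tail p i))]
  simp only [h1, h2, h3]
  generalize wave τ (Fin.tail (Fin.tail Y)) (Fin.tail (Fin.tail p)) = A
  generalize wave τ (Fin.tail (Fin.tail Y)) (Fin.tail p) = B
  generalize wave τ (Fin.tail (Fin.tail Y)) p = D
  generalize ∏ i, eigen b₁ b₂ (Fin.tail (Fin.tail p) i) = P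
  generalize p 0 ^ Y 0 = u
  generalize p 0 ^ Y 1 = v
  generalize p 1 ^ Y 1 = x
  simp only [eigen, twoBody]
  rw [hb] at hp₀ hp₁ ⊢
  field_simp
  ring

theorem stepsTo_true_add_two (hb₁ : b₁ ≠ 0) (hb₂ : 0 < b₂) (hb₂' : b₂ < 1) (hτb : τ = b₂ / b₁)
    {N : ℕ} (k : ℕ) (Y : Fin (N + 2) → ℤ) (hY : StrictMono Y)
    (hF : ∀ k, StepsTo b₁ b₂ τ r hτ hr0 hr false (Fin.tail Y) fun w : Fin k → Circ r =>
      waveStep b₁ b₂ τ false (Fin.tail Y) (toC w))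
    (hT : ∀ k, StepsTo b₁ b₂ τ r hτ hr0 hr true (Fin.tail Y) fun w : Fin k → Circ r =>
      waveStep b₁ b₂ τ true (Fin.tail Y) (toC w)) :
    StepsTo b₁ b₂ τ r hτ hr0 hr true Y fun w : Fin k → Circ r =>
      waveStep b₁ b₂ τ true Y (toC w) := by
  have hr1 := radius_lt_one hτ hr0 hr
  have h01 : Y 0 < Y 1 := hY (by simp)
  have hb₂0 : (b₂ : ℂ) ≠ 0 := Complex.ofReal_ne_zero.2 hb₂.ne'
  have hbw : ∀ a : Circ r, (1 - b₂ * a : ℂ) ≠ 0 := fun a =>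
    one_sub_ne_zero hb₂ hb₂' hr1 (norm_circ hr0 a).le
  have hb1 : (1 - b₂ : ℂ) ≠ 0 := by
    rw [← Complex.ofReal_one, ← Complex.ofReal_sub]
    exact Complex.ofReal_ne_zero.2 (by linarith)
  have hS0 : ∑ z ∈ Finset.Ioo (Y 0) (Y 1), (b₂ : ℂ) ^ (z - Y 0 - 1) * (1 - b₂) =
      1 - (b₂ : ℂ) ^ (Y 1 - Y 0 - 1) := by
    have := sum_geom_Ioo hb₂0 one_ne_zero (by rwa [mul_one]) h01
    simpa [hb1] using this
  have hS1 := fun a : Circ r => sum_geom_Ioo hb₂0 (circ_ne_zero hr0 a) (hbw a) h01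
  obtain ⟨vF, hvF, hvF'⟩ := hF k
  obtain ⟨vT, hvT, hvT'⟩ := hT k
  cases k with
  | zero =>
    refine ⟨_, fun w => hasSum_jumpWeight_true hY (A := fun _ => vF w) (B := vT w) (fun z => ?_) ?_,
      ?_⟩
    · refine (hvF w).of_eq (fun Z => ?_) rfl
      rw [wave_zero_right, wave_zero_right]
    · refine (hvT w).of_eq (fun Z => ?_) rfl
      rw [wave_zero_right, wave_zero_right]
    · convert Submodule.add_mem _ (Submodule.smul_mem _ (1 - (b₂ : ℂ) ^ (Y 1 - Y 0 - 1)) hvF')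
        (Submodule.smul_mem _ ((b₂ : ℂ) ^ (Y 1 - Y 0 - 1)) hvT') using 1
      ext w
      simp only [Pi.add_apply, Pi.sub_apply, Pi.smul_apply, smul_eq_mul, waveStep, wave_zero_right,
        ← Finset.sum_mul, hS0]
      simp
      ring
  | succ k =>
    obtain ⟨vF₁, hvF₁, hvF₁'⟩ := hF k
    obtain ⟨vT₁, hvT₁, hvT₁'⟩ := hT k
    have hz := continuous_zpow_circ hr0
    refine ⟨_, fun w => hasSum_jumpWeight_true hY
      (A := fun z => τ ^ (k + 1) * (w 0 ^ z * vF₁ (Fin.tail w) + vF w))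
      (B := τ ^ (k + 1) * (w 0 ^ Y 1 * vT₁ (Fin.tail w) + vT w)) (fun z => ?_) ?_, ?_⟩
    · refine ((((hvF₁ (Fin.tail w)).mul_left ((w 0 : ℂ) ^ z)).add (hvF w)).mul_left
        ((τ : ℂ) ^ (k + 1))).of_eq (fun Z => ?_) rfl
      rw [wave_succ]
      simp only [Fin.cons_zero, Fin.tail_cons]
      change _ * (_ * ((w 0 : ℂ) ^ z * wave τ Z (toC (Fin.tail w)) + _)) = _
      ring
    · refine ((((hvT₁ (Fin.tail w)).mul_left ((w 0 : ℂ) ^ Y 1)).add (hvT w)).mul_left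
        ((τ : ℂ) ^ (k + 1))).of_eq (fun Z => ?_) rfl
      rw [wave_succ]
      simp only [Fin.cons_zero, Fin.tail_cons]
      change _ * (_ * ((w 0 : ℂ) ^ Y 1 * wave τ Z (toC (Fin.tail w)) + _)) = _
      ring
    · -- what remains after the sums over the positions of the first particle are evaluated
      let E : (Fin (k + 1) → Circ r) → ℂ := fun w =>
        τ ^ (k + 1) * (((1 - b₂) * w 0 / (1 - b₂ * w 0) * w 0 ^ Y 0 -
          (b₂ : ℂ) ^ (Y 1 - Y 0 - 1) * ((1 - b₂) / (1 - b₂ * w 0)) * w 0 ^ Y 1) *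
            waveStep b₁ b₂ τ false (Fin.tail Y) (Fin.tail (toC w)) +
          (1 - (b₂ : ℂ) ^ (Y 1 - Y 0 - 1)) * waveStep b₁ b₂ τ false (Fin.tail Y) (toC w)) +
        (b₂ : ℂ) ^ (Y 1 - Y 0 - 1) *
          (τ ^ (k + 1) * (w 0 ^ Y 1 * waveStep b₁ b₂ τ true (Fin.tail Y) (Fin.tail (toC w)) +
          waveStep b₁ b₂ τ true (Fin.tail Y) (toC w))) - waveStep b₁ b₂ τ true Y (toC w)
      have hE : E ∈ betheNull τ r hτ hr0 hr (k + 1) := by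
        cases k with
        | zero =>
          convert Submodule.zero_mem _ using 1
          ext w
          have hb : (b₂ : ℂ) = τ * b₁ := by
            rw [hτb]
            push_cast
            have : (b₁ : ℂ) ≠ 0 := Complex.ofReal_ne_zero.2 hb₁
            field_simp
          have h0 := hbw (w 0)
          have h2 : Fin.tail Y 0 = Y 1 := rfl
          simp only [E, waveStep]
          rw [wave_succ τ Y, wave_succ τ (Fin.tail Y)]
          simp only [wave_zero_right, Fin.prod_univ_succ, Fin.prod_univ_zero, h2]
          generalize wave τ (Fin.tail (Fin.tail Y)) (toC w) = D
          simp only [toC, eigen, Pi.zero_apply]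
          rw [hb] at h0 ⊢
          field_simp
          ring
        | succ k =>
          have := fun w : Fin (k + 2) → Circ r => waveStep_true_identity hb₁ hτb Y (toC w)
            (hbw (w 0)) (hbw (w 1)) ((b₂ : ℂ) ^ (Y 1 - Y 0 - 1))
          have hE' : E = _ := funext this
          rw [hE']
          refine twoBody_mul_mem_betheNull ?_ ?_
          · have h1 : Continuous fun w : Fin (k + 2) → Circ r => toC w 0 ^ Y 1 :=
              (hz (Y 1)).comp (continuous_apply 0)
            have h2 : Continuous fun w : Fin (k + 2) → Circ r => toC w 1 ^ Y 1 :=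
              (hz (Y 1)).comp (continuous_apply 1)
            have h3 : Continuous fun w : Fin (k + 2) → Circ r => Fin.tail (Fin.tail w) := by
              unfold Fin.tail
              fun_prop
            have h4 : Continuous fun w : Fin (k + 2) → Circ r =>
                wave τ (Fin.tail (Fin.tail Y)) (Fin.tail (Fin.tail (toC w))) :=
              (continuous_wave hr0 _).comp h3
            have h5 : Continuous fun w : Fin (k + 2) → Circ r =>
                ∏ i, eigen b₁ b₂ (Fin.tail (Fin.tail (toC w)) i) :=
              continuous_finsetProd _ fun i _ =>
                (continuous_eigen hr0 hr1 hb₂ hb₂').comp ((continuous_apply i).comp h3)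
            have h6 : Continuous fun w : Fin (k + 2) → Circ r =>
                (1 - b₂ * toC w 0) * (1 - b₂ * toC w 1) := by
              unfold toC
              fun_prop
            exact (((continuous_const.mul (h1.mul h2)).div h6 fun w =>
              mul_ne_zero (hbw _) (hbw _)).mul h5).mul h4
          · intro w
            have h2 : ∀ j : Fin k, Equiv.swap (0 : Fin (k + 2)) 1 j.succ.succ = j.succ.succ :=
              fun j => swap_succ_succ j
            have h3 : Fin.tail (Fin.tail (toC fun i => w (Equiv.swap 0 1 i))) =
                Fin.tail (Fin.tail (toC w)) := by
              ext i
              simp [Fin.tail, toC, h2]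
            rw [h3]
            simp only [toC, Equiv.swap_apply_left, Equiv.swap_apply_right]
            ring
      have hsum := Submodule.sum_mem (betheNull τ r hτ hr0 hr (k + 1)) (t := Finset.Ioo (Y 0) (Y 1))
        fun z _ => Submodule.smul_mem _ ((b₂ : ℂ) ^ (z - Y 0 - 1) * (1 - b₂) * τ ^ (k + 1))
          (Submodule.add_mem _ (mul_tail_mem_betheNull hvF₁' (hz z)) hvF')
      convert Submodule.add_mem _ (Submodule.add_mem _ hsum (Submodule.smul_mem _
        ((b₂ : ℂ) ^ (Y 1 - Y 0 - 1) * τ ^ (k + 1))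
        (Submodule.add_mem _ (mul_tail_mem_betheNull hvT₁' (hz (Y 1))) hvT'))) hE using 1
      ext w
      have ht : toC (Fin.tail w) = Fin.tail (toC w) := rfl
      have key : ∀ a b : ℂ, ∑ z ∈ Finset.Ioo (Y 0) (Y 1),
          (b₂ : ℂ) ^ (z - Y 0 - 1) * (1 - b₂) * (τ ^ (k + 1) * (w 0 ^ z * a + b)) =
          τ ^ (k + 1) * (((1 - b₂) * w 0 / (1 - b₂ * w 0) * w 0 ^ Y 0 -
            (b₂ : ℂ) ^ (Y 1 - Y 0 - 1) * ((1 - b₂) / (1 - b₂ * w 0)) * w 0 ^ Y 1) * a +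
            (1 - (b₂ : ℂ) ^ (Y 1 - Y 0 - 1)) * b) := by
        intro a b
        rw [← hS1, ← hS0, Finset.sum_mul, Finset.sum_mul, ← Finset.sum_add_distrib, Finset.mul_sum]
        exact Finset.sum_congr rfl fun z _ => by ring
      simp only [Pi.add_apply, Pi.sub_apply, Pi.smul_apply, smul_eq_mul, Finset.sum_apply, E, ht,
        mul_assoc _ _ (_ + _), key]
      simp only [← mul_assoc _ ((τ : ℂ) ^ (k + 1)) (_ + _)]
      ring

theorem stepsTo (hb₁ : b₁ ≠ 0) (hb₂ : 0 < b₂) (hb₂' : b₂ < 1) (hτb : τ = b₂ / b₁) (N : ℕ) :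
    (∀ (Y : Fin N → ℤ), StrictMono Y → ∀ k, StepsTo b₁ b₂ τ r hτ hr0 hr false Y
      fun w : Fin k → Circ r => waveStep b₁ b₂ τ false Y (toC w)) ∧
    ∀ (Y : Fin (N + 1) → ℤ), StrictMono Y → ∀ k, StepsTo b₁ b₂ τ r hτ hr0 hr true Y
      fun w : Fin k → Circ r => waveStep b₁ b₂ τ true Y (toC w) := by
  induction N with
  | zero =>
    exact ⟨fun Y _ k => stepsTo_zero k Y, fun Y _ k => stepsTo_one_true hb₂ hb₂' k Y⟩
  | succ N ih =>
    have h : ∀ (Y : Fin (N + 1) → ℤ), StrictMono Y → ∀ k, StepsTo b₁ b₂ τ r hτ hr0 hr false Y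
        fun w : Fin k → Circ r => waveStep b₁ b₂ τ false Y (toC w) := fun Y hY k =>
      stepsTo_false_succ hb₂ hb₂' k Y (ih.1 _ (strictMono_succ_iff.1 hY).2) (ih.2 Y hY)
    refine ⟨h, fun Y hY k => ?_⟩
    have hY' := (strictMono_succ_iff.1 hY).2
    exact stepsTo_true_add_two hb₁ hb₂ hb₂' hτb k Y hY (h _ hY') (ih.2 _ hY')

end SixVertex

namespace SixVertex

/-! ### The initial condition: evaluation of the integrals at time zero -/

open MeasureTheory

variable {τ r : ℝ}

theorem integral_circ_zpow_neg (hr0 : 0 < r) {m : ℤ} (hm : 1 ≤ m) :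
    ∫ a : Circ r, (a : ℂ) ^ (-m) ∂circMeasure r = 0 := by
  obtain ⟨n, rfl⟩ : ∃ n : ℕ, m = n := ⟨m.toNat, by omega⟩
  have hn : n ≠ 0 := by omega
  have h1 : ∫ a : Circ r, (a : ℂ) ^ n ∂circMeasure r = 0 := by
    rw [integral_circ (f := fun a => a ^ n) hr0 (by fun_prop)]
    simp [hn]
  have h2 : ∀ a : Circ r, (a : ℂ) ^ (-(n : ℤ)) =
      ((r : ℂ) ^ 2)⁻¹ ^ n * (starRingEnd ℂ) ((a : ℂ) ^ n) := by
    intro a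
    have h3 : (a : ℂ) * (starRingEnd ℂ) a = (r : ℂ) ^ 2 := by
      rw [Complex.mul_conj, Complex.normSq_eq_norm_sq, norm_circ hr0]
      push_cast
      rfl
    have h4 := circ_ne_zero hr0 a
    rw [zpow_neg, zpow_natCast, map_pow, ← mul_pow, ← h3, ← inv_pow]
    congr 1
    field_simp
    rw [div_self]
    simpa using h4
  simp only [h2]
  rw [integral_const_mul, integral_conj, h1]
  simp

/-- The coefficients of the geometric series of `1 / (α + β a)`. -/
theorem integral_circ_zpow_div (hr0 : 0 < r) {α β : ℂ} (h : ∀ a : ℂ, ‖a‖ ≤ r → α + β * a ≠ 0)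
    (n : ℤ) : ∫ a : Circ r, (a : ℂ) ^ (-n) / (α + β * a) ∂circMeasure r =
      if 0 ≤ n then (-β) ^ n.toNat / α ^ (n.toNat + 1) else 0 := by
  have hα : α ≠ 0 := by simpa using h 0 (by simpa using hr0.le)
  split_ifs with hn
  · obtain ⟨n, rfl⟩ : ∃ m : ℕ, n = m := ⟨n.toNat, by omega⟩
    clear hn
    rw [Int.toNat_natCast]
    induction n with
    | zero =>
      simp only [Nat.cast_zero, neg_zero, zpow_zero]
      rw [integral_circ (f := fun a => 1 / (α + β * a)) hr0]
      · simp
      · exact DifferentiableOn.div (by fun_prop) (by fun_prop) fun a ha =>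
          h a (by simpa using ha)
    | succ n ih =>
      have h1 : ∀ a : Circ r, (a : ℂ) ^ (-((n + 1 : ℕ) : ℤ)) / (α + β * a) =
          α⁻¹ * (a : ℂ) ^ (-((n + 1 : ℕ) : ℤ)) -
            (β / α) * ((a : ℂ) ^ (-(n : ℤ)) / (α + β * a)) := by
        intro a
        have h2 := h a (norm_circ hr0 a).le
        have h3 := circ_ne_zero hr0 a
        rw [show -(n : ℤ) = -((n + 1 : ℕ) : ℤ) + 1 by push_cast; ring, zpow_add_one₀ h3]
        field_simp
        ring
      have hc : Continuous fun a : Circ r => (a : ℂ) ^ (-(n : ℤ)) / (α + β * a) :=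
        (continuous_zpow_circ hr0 _).div (by fun_prop) fun a => h a (norm_circ hr0 a).le
      simp only [h1]
      rw [integral_sub, integral_const_mul, integral_const_mul, ih,
        integral_circ_zpow_neg hr0 (by omega)]
      · field_simp
        ring
      · exact integrable_of_continuous_compact
          (continuous_const.mul (continuous_zpow_circ hr0 _))
      · exact integrable_of_continuous_compact (continuous_const.mul hc)
  · obtain ⟨m, hm⟩ : ∃ m : ℕ, -n = m := ⟨(-n).toNat, by omega⟩
    rw [hm]
    have hm0 : m ≠ 0 := by omega
    simp only [zpow_natCast]
    rw [integral_circ (f := fun a => a ^ m / (α + β * a)) hr0]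
    · simp [hm0]
    · exact DifferentiableOn.div (by fun_prop) (by fun_prop) fun a ha =>
        h a (by simpa using ha)

theorem continuous_toC {k : ℕ} : Continuous (toC : (Fin k → Circ r) → Fin k → ℂ) := by
  unfold toC
  fun_prop

theorem toC_mem_closedBall (hr0 : 0 < r) {k : ℕ} (w : Fin k → Circ r) :
    toC w ∈ Metric.closedBall (0 : Fin k → ℂ) r := by
  rw [mem_closedBall_zero_iff, pi_norm_le_iff_of_nonneg hr0.le]
  exact fun i => (norm_circ hr0 _).le

theorem continuous_comp_toC (hr0 : 0 < r) {k : ℕ} {H : (Fin k → ℂ) → ℂ}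
    (hH : DifferentiableOn ℂ H (Metric.closedBall 0 r)) :
    Continuous fun w : Fin k → Circ r => H (toC w) :=
  hH.continuousOn.comp_continuous continuous_toC (toC_mem_closedBall hr0)

theorem continuous_prod_zpow (hr0 : 0 < r) {k : ℕ} (m : Fin k → ℤ) :
    Continuous fun w : Fin k → Circ r => ∏ i, (w i : ℂ) ^ m i :=
  continuous_finsetProd _ fun i _ => (continuous_zpow_circ hr0 _).comp (continuous_apply i)

/-- A power series in the variables has no coefficients at monomials with a negative exponent. -/
theorem integral_torus_zpow_mul_eq_zero (hr0 : 0 < r) {k : ℕ} {H : (Fin k → ℂ) → ℂ}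
    (hH : DifferentiableOn ℂ H (Metric.closedBall 0 r)) (m : Fin k → ℤ) (j : Fin k) (c : ℤ)
    (h : 1 ≤ c + m j) :
    ∫ w, (w j : ℂ) ^ c * (∏ i, (w i : ℂ) ^ m i) * H (toC w) ∂torusMeasure r k = 0 := by
  cases k with
  | zero => exact j.elim0
  | succ k =>
  have hcont : Continuous fun w : Fin (k + 1) → Circ r =>
      (w j : ℂ) ^ c * (∏ i, (w i : ℂ) ^ m i) * H (toC w) :=
    (((continuous_zpow_circ hr0 _).comp (continuous_apply j)).mul
      (continuous_prod_zpow hr0 m)).mul (continuous_comp_toC hr0 hH)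
  rw [integral_torus_insertNth j hcont]
  refine integral_eq_zero_of_ae (Filter.Eventually.of_forall fun w => ?_)
  obtain ⟨n, hn⟩ : ∃ n : ℕ, c + m j = n := ⟨(c + m j).toNat, by omega⟩
  have hn0 : n ≠ 0 := by omega
  have h1 : ∀ a : Circ r, ((j.insertNth a w : Fin (k + 1) → Circ r) j : ℂ) ^ c *
      (∏ i, ((j.insertNth a w : Fin (k + 1) → Circ r) i : ℂ) ^ m i) *
        H (toC (j.insertNth a w : Fin (k + 1) → Circ r)) =
      (∏ i, (w i : ℂ) ^ m (j.succAbove i)) *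
        ((a : ℂ) ^ n * H (j.insertNth (a : ℂ) (toC w) : Fin (k + 1) → ℂ)) := by
    intro a
    have h2 : toC (j.insertNth a w : Fin (k + 1) → Circ r) = j.insertNth (a : ℂ) (toC w) := by
      ext i
      refine j.succAboveCases ?_ (fun i => ?_) i <;> simp [toC]
    rw [h2, Fin.prod_univ_succAbove _ j]
    simp only [Fin.insertNth_apply_same, Fin.insertNth_apply_succAbove]
    rw [← zpow_natCast, ← hn, zpow_add₀ (circ_ne_zero hr0 a)]
    ring
  simp only [h1]
  rw [integral_const_mul, integral_circ
    (f := fun a => a ^ n * H (j.insertNth a (toC w) : Fin (k + 1) → ℂ)) hr0]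
  · simp [hn0]
  · refine DifferentiableOn.mul (by fun_prop) (hH.comp (f := fun a : ℂ =>
      (j.insertNth a (toC w) : Fin (k + 1) → ℂ)) ?_ fun a ha => ?_)
    · refine Differentiable.differentiableOn (differentiable_pi.2 fun i => ?_)
      refine j.succAboveCases ?_ (fun i => ?_) i <;> simp
    · rw [mem_closedBall_zero_iff, pi_norm_le_iff_of_nonneg hr0.le]
      intro i
      refine j.succAboveCases ?_ (fun i => ?_) i
      · simpa using ha
      · beta_reduce
        rw [Fin.insertNth_apply_succAbove]
        exact (norm_circ hr0 (w i)).le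

/-- The Vandermonde product. -/
noncomputable def vand {k : ℕ} (p : Fin k → ℂ) : ℂ := ∏ i, ∏ j ∈ Finset.Ioi i, (p i - p j)

/-- The inverse of the product of all cross-terms. -/
noncomputable def crossInv (τ : ℝ) {k : ℕ} (p : Fin k → ℂ) : ℂ :=
  ∏ i, ∏ j ∈ Finset.Ioi i, (twoBody τ (p i) (p j))⁻¹

theorem bethe_eq_vand_mul (τ : ℝ) {k : ℕ} (p : Fin k → ℂ) : bethe τ p = vand p * crossInv τ p := by
  simp only [bethe_eq_prod, vand, crossInv, ← Finset.prod_mul_distrib]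
  rfl

/-- Partial fractions of `1 / ∏ (1 - s q_l)` in the variable `s`, cleared of denominators: the
expansion of a projective Vandermonde determinant in a column. -/
theorem vand_eq_sum {K : ℕ} (q : Fin (K + 1) → ℂ) (s : ℂ) :
    vand q = ∑ i : Fin (K + 1), (-1) ^ (i : ℕ) * q i ^ K * (∏ l, (1 - s * q (i.succAbove l))) *
      vand (fun l => q (i.succAbove l)) := by
  have h1 : ∀ {k : ℕ} (p : Fin k → ℂ), vand p =
      (Matrix.projVandermonde (fun i => 1 - s * p i) p).det := by
    intro k p
    rw [Matrix.det_projVandermonde, vand]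
    refine Finset.prod_congr rfl fun i _ => Finset.prod_congr rfl fun j _ => ?_
    ring
  rw [h1 q, Matrix.det_succ_column_zero]
  refine Finset.sum_congr rfl fun i _ => ?_
  rw [h1, mul_assoc, mul_assoc, mul_assoc, ← Matrix.det_mul_column]
  congr 1
  rw [Matrix.projVandermonde_apply]
  congr 1
  · simp
  · congr 1
    ext l m
    simp [Matrix.projVandermonde_apply, pow_succ', mul_assoc]

end SixVertex

namespace SixVertex
open MeasureTheory

variable {τ r : ℝ}

theorem differentiableOn_finsetProd {E ι : Type*} [NormedAddCommGroup E] [NormedSpace ℂ E]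
    {s : Set E} (u : Finset ι) {f : ι → E → ℂ} (h : ∀ i ∈ u, DifferentiableOn ℂ (f i) s) :
    DifferentiableOn ℂ (fun x => ∏ i ∈ u, f i x) s := by
  classical
  induction u using Finset.induction_on with
  | empty => simp
  | insert a u ha ih =>
    simp only [Finset.prod_insert ha]
    exact (h a (Finset.mem_insert_self a u)).mul
      (ih fun i hi => h i (Finset.mem_insert_of_mem hi))

/-- `F a q` is a polynomial in `a`, of degree less than `d`, whose coefficients are entire functions
of `q`. -/
def IsPolyLT (d : ℕ) {k : ℕ} (F : ℂ → (Fin k → ℂ) → ℂ) : Prop :=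
  ∃ A : ℕ → (Fin k → ℂ) → ℂ, (∀ e, Differentiable ℂ (A e)) ∧
    ∀ a q, F a q = ∑ e ∈ Finset.range d, a ^ e * A e q

theorem IsPolyLT.add {d k : ℕ} {F G : ℂ → (Fin k → ℂ) → ℂ} (hF : IsPolyLT d F)
    (hG : IsPolyLT d G) : IsPolyLT d fun a q => F a q + G a q := by
  obtain ⟨A, hA, hA'⟩ := hF
  obtain ⟨B, hB, hB'⟩ := hG
  refine ⟨fun e q => A e q + B e q, fun e => (hA e).add (hB e), fun a q => ?_⟩
  beta_reduce
  rw [hA', hB', ← Finset.sum_add_distrib]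
  exact Finset.sum_congr rfl fun e _ => by ring

theorem IsPolyLT.const_mul {d k : ℕ} {F : ℂ → (Fin k → ℂ) → ℂ} (hF : IsPolyLT d F)
    {u : (Fin k → ℂ) → ℂ} (hu : Differentiable ℂ u) : IsPolyLT d fun a q => u q * F a q := by
  obtain ⟨A, hA, hA'⟩ := hF
  refine ⟨fun e q => u q * A e q, fun e => hu.mul (hA e), fun a q => ?_⟩
  beta_reduce
  rw [hA', Finset.mul_sum]
  exact Finset.sum_congr rfl fun e _ => by ring

theorem IsPolyLT.succ {d k : ℕ} {F : ℂ → (Fin k → ℂ) → ℂ} (hF : IsPolyLT d F) :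
    IsPolyLT (d + 1) F := by
  obtain ⟨A, hA, hA'⟩ := hF
  refine ⟨fun e q => if e < d then A e q else 0, fun e => ?_, fun a q => ?_⟩
  · by_cases he : e < d
    · simpa [he] using hA e
    · simp [he]
  · rw [Finset.sum_range_succ, hA']
    simp only [lt_irrefl, if_false, mul_zero, add_zero]
    refine Finset.sum_congr rfl fun e he => ?_
    rw [if_pos (Finset.mem_range.1 he)]

theorem IsPolyLT.mul_self {d k : ℕ} {F : ℂ → (Fin k → ℂ) → ℂ} (hF : IsPolyLT d F) :
    IsPolyLT (d + 1) fun a q => a * F a q := by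
  obtain ⟨A, hA, hA'⟩ := hF
  refine ⟨fun e q => if e = 0 then 0 else A (e - 1) q, fun e => ?_, fun a q => ?_⟩
  · by_cases he : e = 0
    · simp [he]
    · simpa [he] using hA (e - 1)
  · beta_reduce
    rw [Finset.sum_range_succ', hA', Finset.mul_sum]
    simp only [Nat.add_eq_zero_iff, one_ne_zero, and_false, if_false, if_true, mul_zero, add_zero,
      Nat.add_sub_cancel]
    exact Finset.sum_congr rfl fun e _ => by ring

theorem IsPolyLT.comp_tail {d k : ℕ} {F : ℂ → (Fin k → ℂ) → ℂ} (hF : IsPolyLT d F) :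
    IsPolyLT d fun a (q : Fin (k + 1) → ℂ) => F a (Fin.tail q) := by
  obtain ⟨A, hA, hA'⟩ := hF
  refine ⟨fun e q => A e (Fin.tail q), fun e => (hA e).comp ?_, fun a q => hA' a _⟩
  unfold Fin.tail
  fun_prop

theorem isPolyLT_prod_twoBody (τ : ℝ) (k : ℕ) :
    IsPolyLT (k + 1) fun a (q : Fin k → ℂ) => ∏ j, twoBody τ a (q j) := by
  induction k with
  | zero => exact ⟨fun _ _ => 1, fun _ => by fun_prop, fun a q => by simp⟩
  | succ k ih =>
    obtain ⟨A, hA, hA'⟩ := ((ih.comp_tail.succ.const_mul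
      (u := fun q : Fin (k + 1) → ℂ => 1 - (1 + τ) * q 0) (by fun_prop)).add
      (ih.comp_tail.mul_self.const_mul (u := fun q : Fin (k + 1) → ℂ => τ * q 0) (by fun_prop)))
    refine ⟨A, hA, fun a q => ?_⟩
    rw [← hA']
    beta_reduce
    rw [Fin.prod_univ_succ]
    simp only [twoBody, Fin.tail]
    ring

/-- The product of the pair factors with a first variable `a` has the value `1` at `a = 1`. -/
theorem exists_isPolyLT_prod_sub (τ : ℝ) (k : ℕ) :
    ∃ P : ℂ → (Fin k → ℂ) → ℂ, IsPolyLT k P ∧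
      ∀ a q, ∏ j, (a - q j) = ∏ j, twoBody τ a (q j) + (1 - a) * P a q := by
  induction k with
  | zero => exact ⟨fun _ _ => 0, ⟨fun _ _ => 0, fun _ => by fun_prop, fun a q => by simp⟩,
      fun a q => by simp⟩
  | succ k ih =>
    obtain ⟨P, hP, hP'⟩ := ih
    refine ⟨_, (((hP.comp_tail.mul_self).add (hP.comp_tail.succ.const_mul
      (u := fun q : Fin (k + 1) → ℂ => -q 0) (by fun_prop))).add
      ((isPolyLT_prod_twoBody τ k).comp_tail.const_mul
      (u := fun q : Fin (k + 1) → ℂ => -(1 - τ * q 0)) (by fun_prop))), fun a q => ?_⟩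
    rw [Fin.prod_univ_succ, Fin.prod_univ_succ]
    have := hP' a (Fin.tail q)
    simp only [Fin.tail] at this ⊢
    rw [this, twoBody]
    ring

theorem differentiableOn_crossInv (hτ : 0 < τ) (hr : (1 + τ) * r + τ * r ^ 2 < 1) (hr0 : 0 < r)
    (k : ℕ) : DifferentiableOn ℂ (fun p : Fin k → ℂ => crossInv τ p) (Metric.closedBall 0 r) := by
  unfold crossInv
  refine differentiableOn_finsetProd _ fun i _ => differentiableOn_finsetProd _ fun j _ => ?_
  refine DifferentiableOn.inv (by unfold twoBody; fun_prop) fun p hp => ?_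
  rw [mem_closedBall_zero_iff, pi_norm_le_iff_of_nonneg hr0.le] at hp
  exact twoBody_ne_zero hτ hr (hp i) (hp j)

theorem differentiable_vand (k : ℕ) : Differentiable ℂ fun p : Fin k → ℂ => vand p := by
  rw [← differentiableOn_univ]
  unfold vand
  exact differentiableOn_finsetProd _ fun i _ => differentiableOn_finsetProd _ fun j _ => by fun_prop

theorem differentiableOn_prod_inv (hr0 : 0 < r) (hr1 : r < 1) (k : ℕ) :
    DifferentiableOn ℂ (fun p : Fin k → ℂ => ∏ i, (1 - p i)⁻¹) (Metric.closedBall 0 r) := by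
  refine differentiableOn_finsetProd _ fun i _ => DifferentiableOn.inv (by fun_prop) fun p hp => ?_
  rw [mem_closedBall_zero_iff, pi_norm_le_iff_of_nonneg hr0.le] at hp
  intro h
  have h1 : (1 : ℂ) = p i := by linear_combination h
  have h2 := hp i
  rw [← h1, norm_one] at h2
  linarith

/-- For fixed `q`, the difference between the product of the pair factors `(a, q_j)` and `1` has
partial fractions with the single poles `1 / twoBody τ a q_i`. The exponent `k` of `q i` is what
makes each of these terms vanish under the integral. -/
theorem exists_partialFractions (hτ : 0 < τ) (hr : (1 + τ) * r + τ * r ^ 2 < 1) (k : ℕ) :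
    ∃ A : ℕ → (Fin (k + 1) → ℂ) → ℂ, (∀ e, Differentiable ℂ (A e)) ∧
      ∀ a : ℂ, ∀ q : Fin (k + 1) → ℂ, ‖a‖ ≤ r → (∀ i, ‖q i‖ ≤ r) →
        (∏ j, pairFactor τ a (q j)) * vand q = vand q + (1 - a) *
          ∑ i : Fin (k + 1), ∑ e ∈ Finset.range (k + 1), (-1) ^ (i : ℕ) * a ^ e / twoBody τ a (q i) *
            q i ^ k * (A e q * vand fun l => q (i.succAbove l)) := by
  obtain ⟨P, ⟨A, hA, hA'⟩, hP⟩ := exists_isPolyLT_prod_sub τ (k + 1)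
  refine ⟨A, hA, fun a q ha hq => ?_⟩
  have hne : ∀ i, twoBody τ a (q i) ≠ 0 := fun i => twoBody_ne_zero hτ hr ha (hq i)
  have hprod : ∏ j, twoBody τ a (q j) ≠ 0 := Finset.prod_ne_zero_iff.2 fun i _ => hne i
  have h1 : ∏ j, pairFactor τ a (q j) = 1 + (1 - a) * P a q / ∏ j, twoBody τ a (q j) := by
    simp only [pairFactor]
    rw [Finset.prod_div_distrib, hP]
    field_simp
  have h2 := vand_eq_sum q (1 + τ - τ * a)
  have h3 : ∀ i, twoBody τ a (q i) = 1 - (1 + τ - τ * a) * q i := fun i => by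
    rw [twoBody]
    ring
  simp only [← h3] at h2
  have h4 : vand q / ∏ j, twoBody τ a (q j) =
      ∑ i : Fin (k + 1), (-1) ^ (i : ℕ) / twoBody τ a (q i) * q i ^ k *
        vand fun l => q (i.succAbove l) := by
    rw [h2, Finset.sum_div]
    refine Finset.sum_congr rfl fun i _ => ?_
    rw [Fin.prod_univ_succAbove _ i]
    have := hne i
    have h5 : ∏ l, twoBody τ a (q (i.succAbove l)) ≠ 0 :=
      Finset.prod_ne_zero_iff.2 fun l _ => hne _
    field_simp
  have h5 : (1 + (1 - a) * P a q / ∏ j, twoBody τ a (q j)) * vand q =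
      vand q + (1 - a) * (P a q * (vand q / ∏ j, twoBody τ a (q j))) := by
    field_simp
  rw [h1, h5, h4, hA', Finset.mul_sum]
  congr 2
  refine Finset.sum_congr rfl fun i _ => ?_
  rw [Finset.sum_mul]
  exact Finset.sum_congr rfl fun e _ => by ring

/-- Integration over `p₀` of a single term of the partial fractions makes a factor `q_i ^ n₀` appear
in the other variables. -/
theorem integral_torus_partialFraction_eq_zero (hτ : 0 < τ) (hr0 : 0 < r)
    (hr : (1 + τ) * r + τ * r ^ 2 < 1) {k : ℕ} (n : Fin (k + 2) → ℤ) (hn : StrictAnti n)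
    (i : Fin (k + 1)) {e : ℕ} (he : e ≤ k) {G : (Fin (k + 1) → ℂ) → ℂ}
    (hG : DifferentiableOn ℂ G (Metric.closedBall 0 r)) :
    ∫ w : Fin (k + 2) → Circ r, (∏ l, (w l : ℂ) ^ (-n l)) * ((w 0 : ℂ) ^ e /
      twoBody τ (w 0) (w i.succ) * (w i.succ : ℂ) ^ k * G (toC (Fin.tail w)))
        ∂torusMeasure r (k + 2) = 0 := by
  have hcont : Continuous fun w : Fin (k + 2) → Circ r =>
      (∏ l, (w l : ℂ) ^ (-n l)) * ((w 0 : ℂ) ^ e /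
      twoBody τ (w 0) (w i.succ) * (w i.succ : ℂ) ^ k * G (toC (Fin.tail w))) := by
    have h1 : Continuous fun w : Fin (k + 2) → Circ r => G (toC (Fin.tail w)) :=
      (continuous_comp_toC hr0 hG).comp (by unfold Fin.tail; fun_prop)
    have h2 : Continuous fun w : Fin (k + 2) → Circ r =>
        (w 0 : ℂ) ^ e / twoBody τ (w 0) (w i.succ) :=
      Continuous.div (by fun_prop) (by unfold twoBody; fun_prop) fun w =>
        twoBody_ne_zero hτ hr (norm_circ hr0 _).le (norm_circ hr0 _).le
    exact (continuous_prod_zpow hr0 _).mul ((h2.mul (by fun_prop)).mul h1)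
  rw [integral_torus_insertNth 0 hcont]
  simp only [Fin.insertNth_zero']
  have h1 : ∀ (w : Fin (k + 1) → Circ r) (a : Circ r),
      (∏ l, ((Fin.cons a w : Fin (k + 2) → Circ r) l : ℂ) ^ (-n l)) *
        (((Fin.cons a w : Fin (k + 2) → Circ r) 0 : ℂ) ^ e /
        twoBody τ ((Fin.cons a w : Fin (k + 2) → Circ r) 0)
          ((Fin.cons a w : Fin (k + 2) → Circ r) i.succ) *
        ((Fin.cons a w : Fin (k + 2) → Circ r) i.succ : ℂ) ^ k *
        G (toC (Fin.tail (Fin.cons a w : Fin (k + 2) → Circ r)))) =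
      ((w i : ℂ) ^ k * (∏ l, (w l : ℂ) ^ (-n l.succ)) * G (toC w)) *
        ((a : ℂ) ^ (-(n 0 - e)) / ((1 - (1 + τ) * w i) + τ * w i * a)) := by
    intro w a
    rw [Fin.prod_univ_succ]
    simp only [Fin.cons_zero, Fin.cons_succ, Fin.tail_cons]
    rw [neg_sub, sub_eq_add_neg, zpow_add₀ (circ_ne_zero hr0 a), zpow_natCast, twoBody,
      show (1 - (1 + τ) * w i + τ * w i * a : ℂ) = 1 - (1 + τ) * w i + τ * a * w i by ring]
    ring
  have h2 : ∀ w : Fin (k + 1) → Circ r, ∀ a : ℂ, ‖a‖ ≤ r →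
      (1 - (1 + τ) * w i : ℂ) + τ * w i * a ≠ 0 := by
    intro w a ha
    have := twoBody_ne_zero hτ hr ha (norm_circ hr0 (w i)).le
    rw [twoBody] at this
    convert this using 1
    ring
  simp only [h1]
  simp only [integral_const_mul, integral_circ_zpow_div hr0 (h2 _)]
  split_ifs with h3
  swap
  · simp
  obtain ⟨m, hm⟩ : ∃ m : ℕ, n 0 - e = m := ⟨(n 0 - e).toNat, by omega⟩
  have h4 : DifferentiableOn ℂ (fun q : Fin (k + 1) → ℂ =>
      (-τ : ℂ) ^ m * q i ^ (k - e) * ((1 - (1 + τ) * q i) ^ (m + 1))⁻¹ * G q)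
      (Metric.closedBall 0 r) := by
    refine DifferentiableOn.mul (DifferentiableOn.mul (by fun_prop)
      (DifferentiableOn.inv (by fun_prop) fun q hq => pow_ne_zero _ ?_)) hG
    rw [mem_closedBall_zero_iff, pi_norm_le_iff_of_nonneg hr0.le] at hq
    have := twoBody_ne_zero hτ hr (p := 0) (by simpa using hr0.le) (hq i)
    simpa [twoBody] using this
  have h5 := integral_torus_zpow_mul_eq_zero hr0 h4 (fun l => -n l.succ) i (n 0) (by
    have := hn (Fin.succ_pos i)
    omega)
  refine (integral_congr_ae (Filter.Eventually.of_forall fun w => ?_)).trans h5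
  rw [hm, Int.toNat_natCast, show n 0 = ((m + e : ℕ) : ℤ) by push_cast; omega, zpow_natCast]
  have h6 : (w i : ℂ) ^ k = (w i : ℂ) ^ (k - e) * (w i : ℂ) ^ e := by
    rw [← pow_add]
    congr 1
    omega
  rw [h6, toC]
  ring

theorem one_sub_circ_ne_zero (hr0 : 0 < r) (hr1 : r < 1) (a : Circ r) : (1 - a : ℂ) ≠ 0 := by
  intro h
  have h1 : (1 : ℂ) = a := by linear_combination h
  have h2 := norm_circ hr0 a
  rw [← h1, norm_one] at h2
  linarith

theorem continuous_initial (hτ : 0 < τ) (hr0 : 0 < r) (hr : (1 + τ) * r + τ * r ^ 2 < 1) {k : ℕ}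
    (n : Fin k → ℤ) : Continuous fun w : Fin k → Circ r =>
      bethe τ (toC w) * ∏ i, ((w i : ℂ) ^ (-n i) * (1 - (w i : ℂ))⁻¹) := by
  have hr1 := radius_lt_one hτ hr0 hr
  simp only [Finset.prod_mul_distrib]
  exact (continuous_bethe hτ hr0 hr k).mul ((continuous_prod_zpow hr0 _).mul
    (continuous_comp_toC hr0 (differentiableOn_prod_inv hr0 hr1 k)))

/-- The integrals at time zero are indicator functions. The variable with the largest exponent is
integrated first; only its pole at `1` contributes. -/
theorem integral_bethe_initial (hτ : 0 < τ) (hr0 : 0 < r) (hr : (1 + τ) * r + τ * r ^ 2 < 1) {k : ℕ}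
    (n : Fin k → ℤ) (hn : StrictAnti n) :
    ∫ w, bethe τ (toC w) * ∏ i, ((w i : ℂ) ^ (-n i) * (1 - (w i : ℂ))⁻¹) ∂torusMeasure r k =
      if ∀ i, 0 ≤ n i then 1 else 0 := by
  have hr1 := radius_lt_one hτ hr0 hr
  split_ifs with hpos
  swap
  · push Not at hpos
    obtain ⟨j, hj⟩ := hpos
    have h1 : DifferentiableOn ℂ (fun p : Fin k → ℂ =>
        vand p * crossInv τ p * ∏ i, (1 - p i)⁻¹) (Metric.closedBall 0 r) :=
      ((differentiable_vand k).differentiableOn.mul (differentiableOn_crossInv hτ hr hr0 k)).mul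
        (differentiableOn_prod_inv hr0 hr1 k)
    refine (integral_congr_ae (Filter.Eventually.of_forall fun w => ?_)).trans
      (integral_torus_zpow_mul_eq_zero hr0 h1 (fun i => -n i) j 0 (by omega))
    rw [bethe_eq_vand_mul, Finset.prod_mul_distrib, zpow_zero]
    simp only [toC]
    ring
  have hmc : ∀ (k : ℕ) (n : Fin (k + 1) → ℤ), Continuous fun w : Fin (k + 1) → Circ r =>
      ((w 0 : ℂ) ^ (-n 0) * (1 - (w 0 : ℂ))⁻¹) * (bethe τ (toC (Fin.tail w)) *
        ∏ i, ((Fin.tail w i : ℂ) ^ (-Fin.tail n i) * (1 - (Fin.tail w i : ℂ))⁻¹)) := by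
    intro k n
    have h1 : Continuous fun a : Circ r => (a : ℂ) ^ (-n 0) * (1 - (a : ℂ))⁻¹ :=
      (continuous_zpow_circ hr0 _).mul (Continuous.inv₀ (by fun_prop) fun a =>
        one_sub_circ_ne_zero hr0 hr1 a)
    exact (h1.comp (continuous_apply 0)).mul ((continuous_initial hτ hr0 hr (Fin.tail n)).comp
      (by unfold Fin.tail; fun_prop))
  induction k with
  | zero => simp [bethe]
  | succ k ih =>
    have hnt : StrictAnti (Fin.tail n) := fun i j hij => hn (Fin.succ_lt_succ_iff.2 hij)
    have h0 : ∫ a : Circ r, (a : ℂ) ^ (-n 0) * (1 - (a : ℂ))⁻¹ ∂circMeasure r = 1 := by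
      have := integral_circ_zpow_div hr0 (α := 1) (β := -1) (fun a ha h => by
        have h1 : (1 : ℂ) = a := by linear_combination h
        rw [← h1, norm_one] at ha
        linarith) (n 0)
      rw [if_pos (hpos 0)] at this
      simpa [div_eq_mul_inv, ← sub_eq_add_neg] using this
    have hmain : ∫ w : Fin (k + 1) → Circ r, ((w 0 : ℂ) ^ (-n 0) * (1 - (w 0 : ℂ))⁻¹) *
        (bethe τ (toC (Fin.tail w)) *
          ∏ i, ((Fin.tail w i : ℂ) ^ (-Fin.tail n i) * (1 - (Fin.tail w i : ℂ))⁻¹))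
        ∂torusMeasure r (k + 1) = 1 := by
      rw [integral_torus_insertNth' 0 (hmc k n)]
      simp only [Fin.insertNth_zero', Fin.cons_zero, Fin.tail_cons, integral_const_mul]
      rw [integral_mul_const, h0, one_mul]
      exact ih (Fin.tail n) hnt fun i => hpos i.succ
    cases k with
    | zero =>
      refine (integral_congr_ae (Filter.Eventually.of_forall fun w => ?_)).trans hmain
      simp [bethe]
    | succ k =>
      obtain ⟨A, hA, hA'⟩ := exists_partialFractions hτ hr k
      let G : Fin (k + 1) → ℕ → (Fin (k + 1) → ℂ) → ℂ := fun i e q =>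
        (-1) ^ (i : ℕ) * (A e q * vand fun l => q (i.succAbove l)) *
          (crossInv τ q * ∏ l, (1 - q l)⁻¹)
      have hG : ∀ i e, DifferentiableOn ℂ (G i e) (Metric.closedBall 0 r) := fun i e =>
        (((differentiable_const _).mul ((hA e).mul ((differentiable_vand k).comp
          (by fun_prop)))).differentiableOn).mul ((differentiableOn_crossInv hτ hr hr0 _).mul
            (differentiableOn_prod_inv hr0 hr1 _))
      let T : Fin (k + 1) → ℕ → (Fin (k + 2) → Circ r) → ℂ := fun i e w =>
        (∏ l, (w l : ℂ) ^ (-n l)) * ((w 0 : ℂ) ^ e / twoBody τ (w 0) (w i.succ) *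
          (w i.succ : ℂ) ^ k * G i e (toC (Fin.tail w)))
      have hTc : ∀ i e, Continuous (T i e) := by
        intro i e
        have h1 : Continuous fun w : Fin (k + 2) → Circ r => G i e (toC (Fin.tail w)) :=
          (continuous_comp_toC hr0 (hG i e)).comp (by unfold Fin.tail; fun_prop)
        have h2 : Continuous fun w : Fin (k + 2) → Circ r =>
            (w 0 : ℂ) ^ e / twoBody τ (w 0) (w i.succ) :=
          Continuous.div (by fun_prop) (by unfold twoBody; fun_prop) fun w =>
            twoBody_ne_zero hτ hr (norm_circ hr0 _).le (norm_circ hr0 _).le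
        exact (continuous_prod_zpow hr0 _).mul ((h2.mul (by fun_prop)).mul h1)
      have hT : ∀ i, ∀ e ∈ Finset.range (k + 1), ∫ w, T i e w ∂torusMeasure r (k + 2) = 0 :=
        fun i e he => integral_torus_partialFraction_eq_zero hτ hr0 hr n hn i
          (Nat.lt_succ_iff.1 (Finset.mem_range.1 he)) (hG i e)
      have hsplit : ∀ w : Fin (k + 2) → Circ r,
          bethe τ (toC w) * ∏ i, ((w i : ℂ) ^ (-n i) * (1 - (w i : ℂ))⁻¹) =
          ((w 0 : ℂ) ^ (-n 0) * (1 - (w 0 : ℂ))⁻¹) * (bethe τ (toC (Fin.tail w)) *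
            ∏ i, ((Fin.tail w i : ℂ) ^ (-Fin.tail n i) * (1 - (Fin.tail w i : ℂ))⁻¹)) +
          ∑ i, ∑ e ∈ Finset.range (k + 1), T i e w := by
        intro w
        have h1 := hA' (w 0) (toC (Fin.tail w)) (norm_circ hr0 _).le
          fun i => (norm_circ hr0 _).le
        have h2 : (1 - w 0 : ℂ) ≠ 0 := one_sub_circ_ne_zero hr0 hr1 _
        have h3 : ∑ i, ∑ e ∈ Finset.range (k + 1), T i e w =
            (∏ l, (w l : ℂ) ^ (-n l)) * (crossInv τ (toC (Fin.tail w)) *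
              ∏ l, (1 - toC (Fin.tail w) l)⁻¹) *
            ∑ i : Fin (k + 1), ∑ e ∈ Finset.range (k + 1), (-1) ^ (i : ℕ) * (w 0 : ℂ) ^ e /
              twoBody τ (w 0) (toC (Fin.tail w) i) * toC (Fin.tail w) i ^ k *
              (A e (toC (Fin.tail w)) * vand fun l => toC (Fin.tail w) (i.succAbove l)) := by
          simp only [Finset.mul_sum]
          refine Finset.sum_congr rfl fun i _ => Finset.sum_congr rfl fun e _ => ?_
          simp only [T, G]
          have : (w i.succ : ℂ) = toC (Fin.tail w) i := rfl
          rw [this]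
          ring
        rw [h3, bethe, bethe_eq_vand_mul τ (toC (Fin.tail w))]
        have h4 : Fin.tail (toC w) = toC (Fin.tail w) := rfl
        have h5 : toC w 0 = w 0 := rfl
        rw [h4, bethe_eq_vand_mul, h5, ← mul_assoc, h1]
        simp only [Finset.prod_mul_distrib]
        rw [Fin.prod_univ_succ (fun i => (w i : ℂ) ^ (-n i)),
          Fin.prod_univ_succ (fun i => (1 - (w i : ℂ))⁻¹)]
        have h6 : ∏ i, (toC (Fin.tail w) i) ^ (-Fin.tail n i) =
          ∏ i : Fin (k + 1), (w i.succ : ℂ) ^ (-n i.succ) := rfl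
        have h7 : ∏ l, (1 - toC (Fin.tail w) l)⁻¹ = ∏ i : Fin (k + 1), (1 - (w i.succ : ℂ))⁻¹ := rfl
        have h8 : ∏ i, (Fin.tail w i : ℂ) ^ (-Fin.tail n i) =
          ∏ i : Fin (k + 1), (w i.succ : ℂ) ^ (-n i.succ) := rfl
        have h9 : ∏ l, (1 - (Fin.tail w l : ℂ))⁻¹ = ∏ i : Fin (k + 1), (1 - (w i.succ : ℂ))⁻¹ := rfl
        rw [h7, h8, h9]
        field_simp
      refine (integral_congr_ae (Filter.Eventually.of_forall hsplit)).trans ?_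
      rw [integral_add (integrable_of_continuous_compact (hmc (k + 1) n))
        (integrable_of_continuous_compact (continuous_finsetSum _ fun i _ =>
          continuous_finsetSum _ fun e _ => hTc i e)), hmain, integral_finsetSum]
      · rw [Finset.sum_eq_zero, add_zero]
        intro i _
        rw [integral_finsetSum]
        · exact Finset.sum_eq_zero fun e he => hT i e he
        · exact fun e _ => integrable_of_continuous_compact (hTc i e)
      · exact fun i _ => integrable_of_continuous_compact
          (continuous_finsetSum _ fun e _ => hTc i e)

end SixVertex

namespace SixVertex

/-! ### Sums over subsets and `τ`-binomial identities -/

/-- The sum of `τ ^ κ(S)` over the subsets `S` of `{1, …, n}` with `k` elements, by recursion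
on `n`. -/
noncomputable def subsetSum (τ : ℝ) : ℕ → ℕ → ℝ
  | _, 0 => 1
  | 0, _ + 1 => 0
  | n + 1, k + 1 => τ ^ (k + 1) * (subsetSum τ n k + subsetSum τ n (k + 1))

theorem subsetSum_zero_right (τ : ℝ) (n : ℕ) : subsetSum τ n 0 = 1 := by
  cases n <;> rfl

theorem subsetSum_eq_zero (τ : ℝ) {n k : ℕ} (h : n < k) : subsetSum τ n k = 0 := by
  induction n generalizing k with
  | zero =>
    cases k with
    | zero => omega
    | succ k => rfl
  | succ n ih =>
    cases k with
    | zero => omega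
    | succ k => rw [subsetSum, ih (by omega), ih (by omega), add_zero, mul_zero]

theorem qBinom_zero_right (q : ℝ) (n : ℕ) : qBinom q n 0 = 1 := by
  cases n <;> rfl

theorem qBinom_eq_zero (q : ℝ) {n k : ℕ} (h : n < k) : qBinom q n k = 0 := by
  induction n generalizing k with
  | zero =>
    cases k with
    | zero => omega
    | succ k => rfl
  | succ n ih =>
    cases k with
    | zero => omega
    | succ k => rw [qBinom, ih (by omega), ih (by omega), mul_zero, add_zero]

/-- Inclusion-exclusion: the alternating sum of `subsetSum τ n k`, with `τ`-binomial coefficients,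
detects whether `n` exceeds `l`. Pascal's rule turns the sum for `n + 1` and `l` into a multiple of
the sum for `n` and `l - 1`. -/
theorem sum_qBinom_mul_subsetSum {τ : ℝ} (hτ : 0 < τ) (l : ℕ) {n K : ℕ} (h : n ≤ K) :
    ∑ j ∈ Finset.range K, (-1) ^ (j + 1) * (τ⁻¹) ^ ((l + 1) * (j + 1)) * qBinom τ j l *
      subsetSum τ n (j + 1) =
    if l < n then -(-1) ^ l * (τ⁻¹) ^ ((l + 1) * l / 2) else 0 := by
  induction n generalizing l with
  | zero => simp [subsetSum]
  | succ n ih =>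
    have hc : ∀ c : ℕ → ℝ, ∑ j ∈ Finset.range K, c j * (subsetSum τ n j + subsetSum τ n (j + 1)) =
        c 0 + ∑ j ∈ Finset.range K, (c j + c (j + 1)) * subsetSum τ n (j + 1) := by
      intro c
      have h1 := Finset.sum_range_succ (fun j => c j * subsetSum τ n j) K
      rw [Finset.sum_range_succ', subsetSum_eq_zero τ (show n < K by omega),
        subsetSum_zero_right] at h1
      simp only [mul_add, add_mul, Finset.sum_add_distrib]
      linear_combination -h1
    have hstep : ∀ j, (-1 : ℝ) ^ (j + 1) * (τ⁻¹) ^ ((l + 1) * (j + 1)) * qBinom τ j l *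
        subsetSum τ (n + 1) (j + 1) = ((-1) ^ (j + 1) * (τ⁻¹) ^ (l * (j + 1)) * qBinom τ j l) *
          (subsetSum τ n j + subsetSum τ n (j + 1)) := by
      intro j
      have h1 : (τ⁻¹) ^ ((l + 1) * (j + 1)) * τ ^ (j + 1) = (τ⁻¹) ^ (l * (j + 1)) := by
        rw [add_mul, one_mul, pow_add, mul_assoc, ← mul_pow, inv_mul_cancel₀ hτ.ne', one_pow,
          mul_one]
      rw [subsetSum, ← h1]
      ring
    rw [Finset.sum_congr rfl fun j _ => hstep j,
      hc fun j => (-1) ^ (j + 1) * (τ⁻¹) ^ (l * (j + 1)) * qBinom τ j l]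
    cases l with
    | zero =>
      rw [Finset.sum_eq_zero]
      · simp [qBinom]
      · intro j _
        simp only [qBinom_zero_right, zero_mul, pow_zero]
        ring
    | succ l =>
      have h1 : ∀ j, ((-1 : ℝ) ^ (j + 1) * (τ⁻¹) ^ ((l + 1) * (j + 1)) * qBinom τ j (l + 1) +
          (-1) ^ (j + 1 + 1) * (τ⁻¹) ^ ((l + 1) * (j + 1 + 1)) * qBinom τ (j + 1) (l + 1)) *
            subsetSum τ n (j + 1) = -(τ⁻¹) ^ (l + 1) * ((-1) ^ (j + 1) *
              (τ⁻¹) ^ ((l + 1) * (j + 1)) * qBinom τ j l * subsetSum τ n (j + 1)) := by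
        intro j
        have h2 : (τ⁻¹) ^ (l + 1) * τ ^ (l + 1) = 1 := by
          rw [← mul_pow, inv_mul_cancel₀ hτ.ne', one_pow]
        rw [qBinom, mul_add (l + 1) (j + 1) 1, mul_one, pow_add]
        linear_combination (-(-1 : ℝ) ^ (j + 1) * (τ⁻¹) ^ ((l + 1) * (j + 1)) *
          qBinom τ j (l + 1) * subsetSum τ n (j + 1)) * h2
      rw [Finset.sum_congr rfl fun j _ => h1 j, ← Finset.mul_sum, ih l (by omega)]
      have h3 : (l + 1 + 1) * (l + 1) / 2 = (l + 1) * l / 2 + (l + 1) := by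
        rw [show (l + 1 + 1) * (l + 1) = (l + 1) * l + (l + 1) * 2 by ring,
          Nat.add_mul_div_right _ _ two_pos]
      rw [h3, qBinom]
      simp only [Nat.add_lt_add_iff_right]
      split_ifs
      · ring
      · ring

theorem kappa_map_succ {N : ℕ} (S : Finset (Fin N)) :
    kappa (S.map (Fin.succEmb N)) = S.card + kappa S := by
  simp only [kappa, Finset.sum_map, Fin.coe_succEmb, Fin.val_succ]
  push_cast
  rw [Finset.sum_add_distrib, Finset.sum_const, nsmul_one]
  ring

theorem zero_notMem_map_succ {N : ℕ} (S : Finset (Fin N)) : 0 ∉ S.map (Fin.succEmb N) := by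
  simp [Fin.succ_ne_zero]

theorem kappa_insert_map_succ {N : ℕ} (S : Finset (Fin N)) :
    kappa (insert 0 (S.map (Fin.succEmb N))) = S.card + 1 + kappa S := by
  have h := kappa_map_succ S
  rw [kappa] at h ⊢
  rw [Finset.sum_insert (zero_notMem_map_succ S), h]
  simp
  ring

theorem sum_powersetCard_succ {M : Type*} [AddCommMonoid M] {N k : ℕ}
    (f : Finset (Fin (N + 1)) → M) :
    ∑ S ∈ Finset.powersetCard (k + 1) Finset.univ, f S =
      ∑ S ∈ Finset.powersetCard k Finset.univ, f (insert 0 (S.map (Fin.succEmb N))) +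
        ∑ S ∈ Finset.powersetCard (k + 1) Finset.univ, f (S.map (Fin.succEmb N)) := by
  have h0 : (0 : Fin (N + 1)) ∉ Finset.univ.map (Fin.succEmb N) := zero_notMem_map_succ _
  have h1 : (Finset.univ : Finset (Fin (N + 1))) = insert 0 (Finset.univ.map (Fin.succEmb N)) := by
    rw [Fin.univ_succ, Finset.cons_eq_insert]
    rfl
  rw [h1, Finset.powersetCard_succ_insert h0, Finset.sum_union, add_comm, Finset.sum_image,
    Finset.powersetCard_map, Finset.powersetCard_map, Finset.sum_map, Finset.sum_map]
  · rfl
  · intro S hS T hT hST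
    have h2 : ∀ U ∈ Finset.powersetCard k (Finset.univ.map (Fin.succEmb N)), 0 ∉ U :=
      fun U hU h => h0 ((Finset.mem_powersetCard.1 hU).1 h)
    rw [← Finset.erase_insert (h2 S hS), ← Finset.erase_insert (h2 T hT)]
    exact congrArg (Finset.erase · 0) hST
  · rw [Finset.disjoint_left]
    intro S hS hS'
    obtain ⟨T, -, rfl⟩ := Finset.mem_image.1 hS'
    exact h0 ((Finset.mem_powersetCard.1 hS).1 (Finset.mem_insert_self _ _))

/-- The `i`-th smallest coordinate of `Y` with index in `S`, for a set `S` of `k` indices (and `0` if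
`S` has a different number of elements). -/
noncomputable def subConfig {N : ℕ} (Y : Fin N → ℤ) (k : ℕ) (S : Finset (Fin N)) (i : Fin k) : ℤ :=
  if h : S.card = k then Y (S.orderEmbOfFin h i) else 0

theorem subConfig_map_succ {N k : ℕ} (Y : Fin (N + 1) → ℤ) {S : Finset (Fin N)} (h : S.card = k) :
    subConfig Y k (S.map (Fin.succEmb N)) = subConfig (Fin.tail Y) k S := by
  have h1 : (S.map (Fin.succEmb N)).card = k := by rw [Finset.card_map, h]
  have h2 := Finset.orderEmbOfFin_unique h1 (f := fun i => (S.orderEmbOfFin h i).succ)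
    (fun i => Finset.mem_map_of_mem (Fin.succEmb N) (Finset.orderEmbOfFin_mem S h i))
    (fun i j hij => Fin.succ_lt_succ_iff.2 ((S.orderEmbOfFin h).strictMono hij))
  funext i
  rw [subConfig, dif_pos h1, subConfig, dif_pos h, ← h2]
  rfl

theorem subConfig_insert {N k : ℕ} (Y : Fin (N + 1) → ℤ) {S : Finset (Fin N)} (h : S.card = k) :
    subConfig Y (k + 1) (insert 0 (S.map (Fin.succEmb N))) =
      Fin.cons (Y 0) (subConfig (Fin.tail Y) k S) := by
  have h1 : (insert 0 (S.map (Fin.succEmb N))).card = k + 1 := by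
    rw [Finset.card_insert_of_notMem (zero_notMem_map_succ S), Finset.card_map, h]
  have h2 := Finset.orderEmbOfFin_unique h1
    (f := Fin.cons 0 fun i => (S.orderEmbOfFin h i).succ)
    (fun i => by
      refine Fin.cases ?_ (fun i => ?_) i
      · simp
      · rw [Fin.cons_succ]
        exact Finset.mem_insert_of_mem
          (Finset.mem_map_of_mem (Fin.succEmb N) (Finset.orderEmbOfFin_mem S h i)))
    (by
      intro i j hij
      cases j using Fin.cases with
      | zero => exact absurd hij (Fin.not_lt_zero i)
      | succ j =>
        cases i using Fin.cases with
        | zero => simp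
        | succ i =>
          exact Fin.succ_lt_succ_iff.2
            ((S.orderEmbOfFin h).strictMono (Fin.succ_lt_succ_iff.1 hij)))
  funext i
  rw [subConfig, dif_pos h1, ← h2]
  refine Fin.cases ?_ (fun i => ?_) i
  · simp
  · simp [subConfig, h, Fin.tail]

theorem subConfig_strictMono {N k : ℕ} {Y : Fin N → ℤ} (hY : StrictMono Y) {S : Finset (Fin N)}
    (h : S.card = k) : StrictMono (subConfig Y k S) := by
  intro i j hij
  rw [subConfig, dif_pos h, subConfig, dif_pos h]
  exact hY ((S.orderEmbOfFin h).strictMono hij)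

theorem wave_eq_sum {τ : ℝ} (hτ : 0 < τ) {N k : ℕ} (Y : Fin N → ℤ) (p : Fin k → ℂ) :
    wave τ Y p = ∑ S ∈ Finset.powersetCard k Finset.univ,
      (τ : ℂ) ^ kappa S * ∏ i, p i ^ subConfig Y k S i := by
  have hτ' : (τ : ℂ) ≠ 0 := Complex.ofReal_ne_zero.2 hτ.ne'
  induction N generalizing k with
  | zero =>
    cases k with
    | zero => simp [wave, kappa]
    | succ k =>
      rw [Finset.powersetCard_eq_empty.2 (by simp)]
      rfl
  | succ N ih =>
    cases k with
    | zero => simp [wave_zero_right, kappa]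
    | succ k =>
      rw [wave_succ, ih, ih, sum_powersetCard_succ, mul_add, Finset.mul_sum, Finset.mul_sum,
        Finset.mul_sum]
      congr 1
      · refine Finset.sum_congr rfl fun S hS => ?_
        have h := (Finset.mem_powersetCard.1 hS).2
        rw [subConfig_insert Y h, kappa_insert_map_succ, Fin.prod_univ_succ, h, zpow_add₀ hτ',
          ← Nat.cast_add_one, zpow_natCast]
        simp only [Fin.cons_zero, Fin.cons_succ, Fin.tail]
        ring
      · refine Finset.sum_congr rfl fun S hS => ?_
        have h := (Finset.mem_powersetCard.1 hS).2
        rw [subConfig_map_succ Y h, kappa_map_succ, h, zpow_add₀ hτ', zpow_natCast]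
        ring

/-- The number of coordinates of `Y` to the left of `x`. -/
def countLT {N : ℕ} (Y : Fin N → ℤ) (x : ℤ) : ℕ := (Finset.univ.filter fun i => Y i < x).card

theorem sum_indicator_eq_subsetSum {τ : ℝ} (hτ : 0 < τ) {N k : ℕ} {Y : Fin N → ℤ}
    (hY : StrictMono Y) (x : ℤ) :
    ∑ S ∈ Finset.powersetCard k Finset.univ,
      (τ : ℂ) ^ kappa S * (if ∀ i, subConfig Y k S i < x then 1 else 0) =
      subsetSum τ (countLT Y x) k := by
  have hτ' : (τ : ℂ) ≠ 0 := Complex.ofReal_ne_zero.2 hτ.ne'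
  induction N generalizing k with
  | zero =>
    cases k with
    | zero => simp [subsetSum_zero_right, kappa]
    | succ k =>
      rw [Finset.powersetCard_eq_empty.2 (by simp)]
      rfl
  | succ N ih =>
    cases k with
    | zero => simp [subsetSum_zero_right, kappa]
    | succ k =>
      have hY' : StrictMono (Fin.tail Y) := fun i j hij => hY (Fin.succ_lt_succ_iff.2 hij)
      have hcount : countLT Y x = (if Y 0 < x then 1 else 0) + countLT (Fin.tail Y) x := by
        rw [countLT, Finset.card_filter, Fin.sum_univ_succ, countLT, Finset.card_filter]
        rfl
      have h1 : ∀ S ∈ Finset.powersetCard k (Finset.univ : Finset (Fin N)),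
          (τ : ℂ) ^ kappa (insert 0 (S.map (Fin.succEmb N))) *
            (if ∀ i, subConfig Y (k + 1) (insert 0 (S.map (Fin.succEmb N))) i < x then 1 else 0) =
          (τ : ℂ) ^ (k + 1) * (if Y 0 < x then 1 else 0) * ((τ : ℂ) ^ kappa S *
            (if ∀ i, subConfig (Fin.tail Y) k S i < x then 1 else 0)) := by
        intro S hS
        have h := (Finset.mem_powersetCard.1 hS).2
        rw [subConfig_insert Y h, kappa_insert_map_succ, h, zpow_add₀ hτ', ← Nat.cast_add_one,
          zpow_natCast]
        simp only [Fin.forall_fin_succ, Fin.cons_zero, Fin.cons_succ, ite_and]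
        split_ifs <;> simp
      have h2 : ∀ S ∈ Finset.powersetCard (k + 1) (Finset.univ : Finset (Fin N)),
          (τ : ℂ) ^ kappa (S.map (Fin.succEmb N)) *
            (if ∀ i, subConfig Y (k + 1) (S.map (Fin.succEmb N)) i < x then 1 else 0) =
          (τ : ℂ) ^ (k + 1) * ((τ : ℂ) ^ kappa S *
            (if ∀ i, subConfig (Fin.tail Y) (k + 1) S i < x then 1 else 0)) := by
        intro S hS
        have h := (Finset.mem_powersetCard.1 hS).2
        rw [subConfig_map_succ Y h, kappa_map_succ, h, zpow_add₀ hτ', zpow_natCast, mul_assoc]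
      rw [sum_powersetCard_succ, Finset.sum_congr rfl h1, Finset.sum_congr rfl h2,
        ← Finset.mul_sum, ← Finset.mul_sum, ih hY', ih hY', hcount]
      by_cases hx : Y 0 < x
      · rw [if_pos hx, if_pos hx, add_comm 1, subsetSum]
        push_cast
        ring
      · have h3 : countLT (Fin.tail Y) x = 0 := by
          rw [countLT, Finset.card_eq_zero, Finset.filter_eq_empty_iff]
          intro i _
          have := hY (Fin.succ_pos i)
          simp only [Fin.tail]
          omega
        simp [hx, h3, subsetSum]

end SixVertex

namespace SixVertex

/-! ### The contour integrals in the inverse variables -/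

open MeasureTheory

theorem radius_condition {τ b₂ R : ℝ} (hτ : 0 < τ) (hR : EnclosesSingularities τ b₂ R) :
    (1 + τ) * R⁻¹ + τ * R⁻¹ ^ 2 < 1 := by
  obtain ⟨h1, -, h2⟩ := hR
  have hR0 : 0 < R := by linarith
  have hRc : (R : ℂ) ≠ 0 := Complex.ofReal_ne_zero.2 hR0.ne'
  have hτc : (τ : ℂ) ≠ 0 := Complex.ofReal_ne_zero.2 hτ.ne'
  -- the zero of largest modulus belongs to `z = -R`
  have h3 := h2 (-R) ((1 + τ + τ / R : ℝ) : ℂ)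
    (by rw [norm_neg, Complex.norm_real, Real.norm_of_nonneg hR0.le]) (Or.inl (by
      rw [cross]
      push_cast
      field_simp
      ring))
  rw [Complex.norm_real, Real.norm_of_nonneg (by positivity)] at h3
  have h4 : (1 + τ) * R⁻¹ + τ * R⁻¹ ^ 2 = (1 + τ + τ / R) / R := by
    field_simp
  rw [h4, div_lt_one hR0]
  exact h3

theorem pi_smul_measure {k : ℕ} {X : Type*} [MeasurableSpace X] (μ : Measure X)
    [IsFiniteMeasure μ] {c : ENNReal} (hc : c ≠ ⊤) :
    Measure.pi (fun _ : Fin k => c • μ) = c ^ k • Measure.pi fun _ : Fin k => μ := by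
  have : IsFiniteMeasure (c • μ) := μ.smul_finite hc
  refine Measure.pi_eq fun s _ => ?_
  rw [Measure.smul_apply, Measure.pi_pi, smul_eq_mul]
  simp [Finset.prod_mul_distrib]

theorem integral_torus_eq_integral_angles {r : ℝ} {k : ℕ} {g : (Fin k → Circ r) → ℂ}
    (hg : Continuous g) :
    ∫ w, g w ∂torusMeasure r k = ((2 * Real.pi) ^ k)⁻¹ *
      ∫ θ in Set.Icc (0 : Fin k → ℝ) fun _ => 2 * Real.pi, g fun i => circParam r (θ i) := by
  have hc : (ENNReal.ofReal (2 * Real.pi))⁻¹ ≠ ⊤ :=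
    ENNReal.inv_ne_top.2 (by simp [Real.pi_pos])
  have : IsFiniteMeasure ((ENNReal.ofReal (2 * Real.pi))⁻¹ •
      (volume : Measure ℝ).restrict (Set.Icc 0 (2 * Real.pi))) :=
    Measure.smul_finite _ hc
  have hm := continuous_circParam r
  have hm' : Continuous fun (θ : Fin k → ℝ) i => circParam r (θ i) :=
    continuous_pi fun i => hm.comp (continuous_apply i)
  have h1 : torusMeasure r k = (((ENNReal.ofReal (2 * Real.pi))⁻¹) ^ k •
      (volume : Measure (Fin k → ℝ)).restrict (Set.Icc 0 fun _ => 2 * Real.pi)).map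
        fun θ i => circParam r (θ i) := by
    have h2 : (volume : Measure (Fin k → ℝ)).restrict (Set.Icc 0 fun _ => 2 * Real.pi) =
        Measure.pi fun _ => (volume : Measure ℝ).restrict (Set.Icc 0 (2 * Real.pi)) := by
      rw [volume_pi, ← Set.pi_univ_Icc, Measure.restrict_pi_pi]
      rfl
    rw [h2, ← pi_smul_measure _ hc, Measure.pi_map_pi fun _ => hm.aemeasurable]
    rfl
  rw [h1, integral_map hm'.aemeasurable hg.aestronglyMeasurable, integral_smul_measure,
    ENNReal.toReal_pow, ENNReal.toReal_inv, ENNReal.toReal_ofReal (by positivity),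
    Complex.real_smul]
  push_cast
  rw [inv_pow]

/-- The factor of one variable in the contour integrals, without the power that depends on the
configuration. -/
noncomputable def oneBody (b₁ b₂ : ℝ) (n : ℤ) (t : ℕ) (p : ℂ) : ℂ :=
  p ^ n * (1 - p)⁻¹ * eigen b₁ b₂ p ^ t

/-- The pairing of a function on the torus with the Bethe kernel at time `t`, for the event that a
coordinate equals `x`: the difference of the two products comes from the factor `1 - ∏ z_i` of the
integrand. -/
noncomputable def pairing (b₁ b₂ τ r : ℝ) (x : ℤ) (t : ℕ) {k : ℕ} (F : (Fin k → Circ r) → ℂ) : ℂ :=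
  ∫ w, bethe τ (toC w) * (∏ i, oneBody b₁ b₂ (1 - x) t (w i) - ∏ i, oneBody b₁ b₂ (-x) t (w i)) *
    F w ∂torusMeasure r k

variable {b₁ b₂ τ r : ℝ}

theorem continuous_oneBody (hr0 : 0 < r) (hr1 : r < 1) (hb₂ : 0 < b₂) (hb₂' : b₂ < 1) (n : ℤ)
    (t : ℕ) : Continuous fun w : Circ r => oneBody b₁ b₂ n t w := by
  refine ((continuous_zpow_circ hr0 n).mul (Continuous.inv₀ (by fun_prop) fun w => ?_)).mul
    ((continuous_eigen hr0 hr1 hb₂ hb₂').pow t)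
  exact one_sub_circ_ne_zero hr0 hr1 w

theorem continuous_pairing (hτ : 0 < τ) (hr0 : 0 < r) (hr : (1 + τ) * r + τ * r ^ 2 < 1)
    (hb₂ : 0 < b₂) (hb₂' : b₂ < 1) (x : ℤ) (t : ℕ) {k : ℕ} {F : (Fin k → Circ r) → ℂ}
    (hF : Continuous F) : Continuous fun w => bethe τ (toC w) *
      (∏ i, oneBody b₁ b₂ (1 - x) t (w i) - ∏ i, oneBody b₁ b₂ (-x) t (w i)) * F w := by
  have hr1 := radius_lt_one hτ hr0 hr
  have h : ∀ n, Continuous fun w : Fin k → Circ r => ∏ i, oneBody b₁ b₂ n t (w i) := fun n =>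
    continuous_finsetProd _ fun i _ =>
      (continuous_oneBody hr0 hr1 hb₂ hb₂' n t).comp (continuous_apply i)
  exact ((continuous_bethe hτ hr0 hr k).mul ((h _).sub (h _))).mul hF

theorem pairFactor_inv (hτ : 0 < τ) {p q : ℂ} (hp : p ≠ 0) (hq : q ≠ 0) (h : twoBody τ p q ≠ 0) :
    (q⁻¹ - p⁻¹) / cross τ p⁻¹ q⁻¹ = τ * pairFactor τ p q := by
  have hτc : (τ : ℂ) ≠ 0 := Complex.ofReal_ne_zero.2 hτ.ne'
  have h1 : cross τ p⁻¹ q⁻¹ = twoBody τ p q / (τ * p * q) := by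
    rw [cross, twoBody]
    field_simp
    ring
  rw [h1, pairFactor]
  field_simp

theorem prod_pairs_const (a : ℂ) (k : ℕ) :
    ∏ i : Fin k, ∏ _j ∈ Finset.Ioi i, a = a ^ (k * (k - 1) / 2) := by
  induction k with
  | zero => simp
  | succ k ih =>
    rw [Fin.prod_univ_succ, Fin.prod_Ioi_zero]
    simp only [Fin.prod_Ioi_succ]
    rw [ih, Finset.prod_const, Finset.card_univ, Fintype.card_fin, ← pow_add, Nat.add_sub_cancel]
    congr 1
    rcases k with - | k
    · rfl
    · rw [Nat.add_sub_cancel, show (k + 1 + 1) * (k + 1) = (k + 1) * k + (k + 1) * 2 by ring,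
        Nat.add_mul_div_right _ _ two_pos, add_comm]

theorem integrand_inv (hτ : 0 < τ) (hr0 : 0 < r) (hr : (1 + τ) * r + τ * r ^ 2 < 1)
    (hτb : τ = b₂ / b₁) {N : ℕ} (Y : Config N) (x : ℤ) (t : ℕ) (S : Finset (Fin N))
    (w : Fin S.card → Circ r) :
    integrand b₁ b₂ Y x t S (fun i => (w i : ℂ)⁻¹) =
      (τ : ℂ) ^ (S.card * (S.card - 1) / 2) * (-1) ^ S.card * (bethe τ (toC w) *
        (∏ i, oneBody b₁ b₂ (1 - x) t (w i) - ∏ i, oneBody b₁ b₂ (-x) t (w i)) *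
          ∏ i, (w i : ℂ) ^ subConfig Y.1 S.card S i) * ∏ i, (w i : ℂ) := by
  have hr1 := radius_lt_one hτ hr0 hr
  have hw : ∀ i, (w i : ℂ) ≠ 0 := fun i => circ_ne_zero hr0 _
  have hsub : ∀ i, subConfig Y.1 S.card S i = Y.1 (S.orderEmbOfFin rfl i) := fun i => by
    rw [subConfig, dif_pos rfl]
  have h1 : ∏ i, ∏ j ∈ Finset.Ioi i, ((w j : ℂ)⁻¹ - (w i : ℂ)⁻¹) /
      cross (b₂ / b₁) (w i : ℂ)⁻¹ (w j : ℂ)⁻¹ =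
      (τ : ℂ) ^ (S.card * (S.card - 1) / 2) * bethe τ (toC w) := by
    rw [← hτb, bethe_eq_prod, ← prod_pairs_const, ← Finset.prod_mul_distrib]
    refine Finset.prod_congr rfl fun i _ => ?_
    rw [← Finset.prod_mul_distrib]
    exact Finset.prod_congr rfl fun j _ => pairFactor_inv hτ (hw i) (hw j)
      (twoBody_ne_zero hτ hr (norm_circ hr0 _).le (norm_circ hr0 _).le)
  have h2 : ∀ i, ((b₁ : ℂ) + (1 - b₁ - b₂) * ((w i : ℂ)⁻¹)⁻¹) / (1 - b₂ * ((w i : ℂ)⁻¹)⁻¹) =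
      eigen b₁ b₂ (w i) := fun i => by
    rw [inv_inv, eigen]
  have h3 : (1 - ∏ i, (w i : ℂ)⁻¹) / ∏ i, (1 - (w i : ℂ)⁻¹) =
      (-1) ^ S.card * (∏ i, ((w i : ℂ) * (1 - (w i : ℂ))⁻¹) - ∏ i, (1 - (w i : ℂ))⁻¹) := by
    have h4 : ∀ i, (1 - (w i : ℂ)⁻¹)⁻¹ = (-1) * ((w i : ℂ) * (1 - (w i : ℂ))⁻¹) := by
      intro i
      have h5 := one_sub_circ_ne_zero hr0 hr1 (w i)
      have h6 : (1 - (w i : ℂ)⁻¹) = -(1 - w i) * (w i : ℂ)⁻¹ := by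
        have := hw i
        field_simp
        ring
      rw [h6, mul_inv, inv_inv, inv_neg]
      ring
    have h7 : (∏ i, (w i : ℂ)⁻¹) * ∏ i, (w i : ℂ) = 1 := by
      rw [← Finset.prod_mul_distrib]
      exact Finset.prod_eq_one fun i _ => inv_mul_cancel₀ (hw i)
    rw [div_eq_mul_inv, ← Finset.prod_inv_distrib, Finset.prod_congr rfl fun i _ => h4 i,
      Finset.prod_mul_distrib, Finset.prod_const, Finset.card_univ, Fintype.card_fin,
      Finset.prod_mul_distrib]
    linear_combination (-(-1 : ℂ) ^ S.card * ∏ i, (1 - (w i : ℂ))⁻¹) * h7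
  have h8 : ∀ i, ((w i : ℂ)⁻¹) ^ (x - Y.1 (S.orderEmbOfFin rfl i) - 1) =
      (w i : ℂ) ^ (-x) * (w i : ℂ) ^ subConfig Y.1 S.card S i * w i := by
    intro i
    rw [hsub, inv_zpow', ← zpow_add₀ (hw i), ← zpow_add_one₀ (hw i)]
    congr 1
    ring
  have h9 : ∀ i, oneBody b₁ b₂ (1 - x) t (w i) =
      (w i : ℂ) ^ (-x) * (w i * (1 - (w i : ℂ))⁻¹) * eigen b₁ b₂ (w i) ^ t := by
    intro i
    rw [oneBody, show 1 - x = -x + 1 by ring, zpow_add_one₀ (hw i), mul_assoc (_ ^ (-x))]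
  rw [integrand, h1, h3, Finset.prod_congr rfl fun i _ => h9 i]
  simp only [h2, h8, oneBody, Finset.prod_mul_distrib]
  ring

theorem torusMap_eq_inv {R : ℝ} {k : ℕ} (θ : Fin k → ℝ) :
    torusMap 0 (fun _ => R) θ = fun i => (circParam R⁻¹ (θ i) : ℂ)⁻¹ := by
  funext i
  change _ = (circleMap 0 R⁻¹ (-θ i))⁻¹
  rw [torusMap, circleMap_zero, mul_inv, ← Complex.exp_neg]
  simp

theorem torusIntegrable_integrand (hτ : 0 < τ) {R : ℝ} (hR0 : 0 < R)
    (hR : (1 + τ) * R⁻¹ + τ * R⁻¹ ^ 2 < 1) (hb₂ : 0 < b₂) (hb₂' : b₂ < 1) (hτb : τ = b₂ / b₁)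
    {N : ℕ} (Y : Config N) (x : ℤ) (t : ℕ) (S : Finset (Fin N)) :
    TorusIntegrable (integrand b₁ b₂ Y x t S) 0 (fun _ => R) := by
  have hr0 : 0 < R⁻¹ := inv_pos.2 hR0
  have hc : Continuous fun θ => integrand b₁ b₂ Y x t S (torusMap 0 (fun _ => R) θ) := by
    simp only [torusMap_eq_inv, integrand_inv hτ hr0 hR hτb]
    have h1 : Continuous fun (θ : Fin S.card → ℝ) i => circParam R⁻¹ (θ i) :=
      continuous_pi fun i => (continuous_circParam _).comp (continuous_apply i)
    have h2 := continuous_pairing (b₁ := b₁) hτ hr0 hR hb₂ hb₂' x t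
      (continuous_prod_zpow hr0 (subConfig Y.1 S.card S))
    exact (continuous_const.mul (h2.comp h1)).mul (continuous_finsetProd _ fun i _ =>
      continuous_subtype_val.comp ((continuous_apply i).comp h1))
  exact hc.continuousOn.integrableOn_compact isCompact_Icc

theorem contourIntegral_eq_pairing (hτ : 0 < τ) {R : ℝ} (hR0 : 0 < R)
    (hR : (1 + τ) * R⁻¹ + τ * R⁻¹ ^ 2 < 1) (hb₂ : 0 < b₂) (hb₂' : b₂ < 1) (hτb : τ = b₂ / b₁)
    {N : ℕ} (Y : Config N) (x : ℤ) (t : ℕ) {k : ℕ} {S : Finset (Fin N)} (hS : S.card = k) :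
    contourIntegral b₁ b₂ Y x t R S = (τ : ℂ) ^ (k * (k - 1) / 2) * (-1) ^ k *
      pairing b₁ b₂ τ R⁻¹ x t
        fun w : Fin k → Circ R⁻¹ => ∏ i, (w i : ℂ) ^ subConfig Y.1 k S i := by
  subst hS
  have hr0 : 0 < R⁻¹ := inv_pos.2 hR0
  rw [contourIntegral, torusIntegral, pairing, integral_torus_eq_integral_angles
    (continuous_pairing hτ hr0 hR hb₂ hb₂' x t (continuous_prod_zpow hr0 _)), mul_left_comm]
  rw [one_div, mul_pow _ Complex.I, mul_inv, mul_assoc]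
  push_cast
  congr 1
  rw [← integral_const_mul, ← integral_const_mul]
  refine setIntegral_congr_fun measurableSet_Icc fun θ _ => ?_
  have h1 : ∏ i : Fin S.card, ((R : ℂ) * Complex.exp (θ i * Complex.I) * Complex.I) =
      Complex.I ^ S.card * (∏ i, (circParam R⁻¹ (θ i) : ℂ))⁻¹ := by
    rw [Finset.prod_mul_distrib, Finset.prod_const, Finset.card_univ, Fintype.card_fin, mul_comm,
      ← Finset.prod_inv_distrib]
    congr 1
    refine Finset.prod_congr rfl fun i _ => ?_
    have := congrFun (torusMap_eq_inv (R := R) θ) i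
    rw [← this, torusMap]
    simp
  have h2 : ∏ i, (circParam R⁻¹ (θ i) : ℂ) ≠ 0 :=
    Finset.prod_ne_zero_iff.2 fun i _ => circ_ne_zero hr0 _
  rw [torusMap_eq_inv, integrand_inv hτ hr0 hR hτb, h1, smul_eq_mul]
  field_simp

end SixVertex

namespace SixVertex

/-! ### Time evolution of the pairings -/

open MeasureTheory

variable {b₁ b₂ τ r : ℝ}

theorem norm_wave_le (hτ : 0 < τ) (hr0 : 0 < r) {N k : ℕ} (Y : Fin N → ℤ) (w : Fin k → Circ r) :
    ‖wave τ Y (toC w)‖ ≤ ‖wave τ Y fun _ : Fin k => (r : ℂ)‖ := by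
  have h1 : (wave τ Y fun _ : Fin k => (r : ℂ)) =
      ((∑ S ∈ Finset.powersetCard k Finset.univ, τ ^ kappa S * ∏ i, r ^ subConfig Y k S i : ℝ) : ℂ) :=
    by
    rw [wave_eq_sum hτ]
    push_cast
    rfl
  rw [h1, Complex.norm_real, Real.norm_of_nonneg (Finset.sum_nonneg fun S _ => by positivity),
    wave_eq_sum hτ]
  refine (norm_sum_le _ _).trans (Finset.sum_le_sum fun S _ => ?_)
  rw [norm_mul, norm_zpow, Complex.norm_real, Real.norm_of_nonneg hτ.le, norm_prod]
  simp only [toC, norm_zpow, norm_circ hr0]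
  exact le_rfl

theorem pairing_wave (hτ : 0 < τ) (hr0 : 0 < r) (hr : (1 + τ) * r + τ * r ^ 2 < 1) (hb₂ : 0 < b₂)
    (hb₂' : b₂ < 1) (x : ℤ) (t : ℕ) {N k : ℕ} (Y : Fin N → ℤ) :
    pairing b₁ b₂ τ r x t (fun w : Fin k → Circ r => wave τ Y (toC w)) =
      ∑ S ∈ Finset.powersetCard k Finset.univ, (τ : ℂ) ^ kappa S *
        pairing b₁ b₂ τ r x t fun w : Fin k → Circ r => ∏ i, (w i : ℂ) ^ subConfig Y k S i := by
  simp only [pairing, ← integral_const_mul]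
  rw [← integral_finsetSum]
  · refine integral_congr_ae (Filter.Eventually.of_forall fun w => ?_)
    beta_reduce
    rw [wave_eq_sum hτ, Finset.mul_sum]
    exact Finset.sum_congr rfl fun S _ => mul_left_comm _ _ _
  · exact fun S _ => (integrable_of_continuous_compact (continuous_pairing hτ hr0 hr hb₂ hb₂' x t
      (continuous_prod_zpow hr0 _))).const_mul _

theorem pairing_zero_zpow (hτ : 0 < τ) (hr0 : 0 < r) (hr : (1 + τ) * r + τ * r ^ 2 < 1)
    (x : ℤ) {k : ℕ} {y : Fin k → ℤ} (hy : StrictMono y) :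
    pairing b₁ b₂ τ r x 0 (fun w : Fin k → Circ r => ∏ i, (w i : ℂ) ^ y i) =
      (if ∀ i, y i < x then 1 else 0) - if ∀ i, y i < x + 1 then 1 else 0 := by
  have h1 : ∀ c : ℤ, StrictAnti fun i => c - y i := fun c i j hij => by
    have := hy hij
    simp only
    omega
  have h2 : ∀ c : ℤ, (∀ i, 0 ≤ c - y i) ↔ ∀ i, y i < c + 1 := fun c =>
    forall_congr' fun i => by omega
  have h3 : ∀ (c : ℤ) (w : Fin k → Circ r), (∏ i, oneBody b₁ b₂ (-c) 0 (w i)) *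
      ∏ i, (w i : ℂ) ^ y i = ∏ i, ((w i : ℂ) ^ (-(c - y i)) * (1 - (w i : ℂ))⁻¹) := by
    intro c w
    rw [← Finset.prod_mul_distrib]
    refine Finset.prod_congr rfl fun i _ => ?_
    rw [oneBody, show -(c - y i) = -c + y i by ring, zpow_add₀ (circ_ne_zero hr0 _)]
    ring
  have h4 := integral_bethe_initial hτ hr0 hr _ (h1 (x - 1))
  have h5 := integral_bethe_initial hτ hr0 hr _ (h1 x)
  rw [if_congr (h2 _) rfl rfl] at h4 h5
  rw [sub_add_cancel] at h4
  rw [← h4, ← h5, pairing, ← integral_sub (integrable_of_continuous_compact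
    (continuous_initial hτ hr0 hr _)) (integrable_of_continuous_compact
    (continuous_initial hτ hr0 hr _))]
  refine integral_congr_ae (Filter.Eventually.of_forall fun w => ?_)
  beta_reduce
  rw [← h3, ← h3, neg_sub]
  ring

theorem pairing_zero_wave (hτ : 0 < τ) (hr0 : 0 < r) (hr : (1 + τ) * r + τ * r ^ 2 < 1)
    (hb₂ : 0 < b₂) (hb₂' : b₂ < 1) (x : ℤ) {N k : ℕ} {Y : Fin N → ℤ} (hY : StrictMono Y) :
    pairing b₁ b₂ τ r x 0 (fun w : Fin k → Circ r => wave τ Y (toC w)) =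
      subsetSum τ (countLT Y x) k - subsetSum τ (countLT Y (x + 1)) k := by
  rw [pairing_wave hτ hr0 hr hb₂ hb₂', ← sum_indicator_eq_subsetSum hτ hY,
    ← sum_indicator_eq_subsetSum hτ hY, ← Finset.sum_sub_distrib]
  refine Finset.sum_congr rfl fun S hS => ?_
  rw [pairing_zero_zpow hτ hr0 hr x
    (subConfig_strictMono hY (Finset.mem_powersetCard.1 hS).2), mul_sub]

/-- One step of the chain advances the time in the pairing with the waves. The sum over the
configurations and the integral are interchanged by domination with the wave at the
point `p₁ = ⋯ = p_k = r`. -/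
theorem hasSum_pairing_wave (hτ : 0 < τ) (hr0 : 0 < r) (hr : (1 + τ) * r + τ * r ^ 2 < 1)
    (hb₁ : 0 < b₁) (hb₂ : 0 < b₂) (hb₂' : b₂ < 1) (hτb : τ = b₂ / b₁) (x : ℤ)
    (t : ℕ) {N : ℕ} (k : ℕ) {Y : Fin N → ℤ} (hY : StrictMono Y) :
    HasSum (fun Z => (jumpWeight b₁ b₂ false Y Z : ℂ) *
        pairing b₁ b₂ τ r x t fun w : Fin k → Circ r => wave τ Z (toC w))
      (pairing b₁ b₂ τ r x (t + 1) fun w : Fin k → Circ r => wave τ Y (toC w)) := by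
  have hr1 := radius_lt_one hτ hr0 hr
  obtain ⟨v, hv, hnull⟩ := (stepsTo (hτ := hτ) (hr0 := hr0) (hr := hr) hb₁.ne' hb₂ hb₂' hτb N).1
    Y hY k
  set ψ : (Fin k → Circ r) → ℂ := fun w => waveStep b₁ b₂ τ false Y (toC w) with hψ
  have hψc : Continuous ψ := (continuous_finsetProd _ fun i _ =>
    (continuous_eigen hr0 hr1 hb₂ hb₂').comp (continuous_apply i)).mul (continuous_wave hr0 Y)
  have hvψ : Continuous (v - ψ) := hnull.1
  have hvc : Continuous v := by
    have := hvψ.add hψc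
    rwa [sub_add_cancel] at this
  have hob : ∀ n, Continuous fun a : Circ r => oneBody b₁ b₂ n t a := fun n =>
    continuous_oneBody hr0 hr1 hb₂ hb₂' n t
  have hG : Continuous fun w : Fin k → Circ r => bethe τ (toC w) *
      (∏ i, oneBody b₁ b₂ (1 - x) t (w i) - ∏ i, oneBody b₁ b₂ (-x) t (w i)) := by
    simpa using continuous_pairing (b₁ := b₁) hτ hr0 hr hb₂ hb₂' x t
      (continuous_const (y := (1 : ℂ)) (X := Fin k → Circ r))
  obtain ⟨G, hGdef⟩ : ∃ G : (Fin k → Circ r) → ℂ, ∀ w, G w = bethe τ (toC w) *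
      (∏ i, oneBody b₁ b₂ (1 - x) t (w i) - ∏ i, oneBody b₁ b₂ (-x) t (w i)) := ⟨_, fun _ => rfl⟩
  rw [← funext hGdef] at hG
  obtain ⟨C, hC⟩ := (isCompact_range hG).isBounded.exists_norm_le
  have hC' : ∀ w, ‖G w‖ ≤ C := fun w => hC _ ⟨w, rfl⟩
  have hdom : HasSum (fun Z => ∫ w, G w * ((jumpWeight b₁ b₂ false Y Z : ℂ) * wave τ Z (toC w))
      ∂torusMeasure r k) (∫ w, G w * v w ∂torusMeasure r k) := by
    have hsum : Summable fun Z => C * ‖(jumpWeight b₁ b₂ false Y Z : ℂ) *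
        wave τ Z fun _ : Fin k => (r : ℂ)‖ := by
      have h1 : (r : ℂ) ∈ Metric.sphere (0 : ℂ) |r| := by simp
      exact ((hv fun _ => ⟨r, h1⟩).summable.norm).mul_left C
    refine hasSum_integral_of_dominated_convergence
      (fun Z _ => C * ‖(jumpWeight b₁ b₂ false Y Z : ℂ) * wave τ Z fun _ : Fin k => (r : ℂ)‖)
      (fun Z => ?_) (fun Z => ?_) ?_ ?_ ?_
    · exact (hG.mul (continuous_const.mul (continuous_wave hr0 Z))).aestronglyMeasurable
    · refine Filter.Eventually.of_forall fun w => ?_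
      have := norm_wave_le hτ hr0 Z w
      rw [norm_mul, norm_mul, norm_mul _ (wave τ Z fun _ => (r : ℂ))]
      have h2 := hC' w
      have h0 : 0 ≤ C := (norm_nonneg _).trans h2
      gcongr
    · exact Filter.Eventually.of_forall fun _ => hsum
    · exact integrable_const _
    · exact Filter.Eventually.of_forall fun w => (hv w).mul_left _
  have hstep : ∀ n (w : Fin k → Circ r), ∏ i, oneBody b₁ b₂ n (t + 1) (w i) =
      (∏ i, oneBody b₁ b₂ n t (w i)) * ∏ i, eigen b₁ b₂ (w i) := by
    intro n w
    rw [← Finset.prod_mul_distrib]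
    exact Finset.prod_congr rfl fun i _ => by rw [oneBody, pow_succ, ← mul_assoc, oneBody]
  have hzero : ∫ w, G w * (v - ψ) w ∂torusMeasure r k = 0 := by
    have h1 := hnull.2 _ (hob (1 - x))
    have h2 := hnull.2 _ (hob (-x))
    have hint : ∀ n, Integrable (fun w : Fin k → Circ r => bethe τ (toC w) *
        (∏ i, oneBody b₁ b₂ n t (w i)) * (v - ψ) w) (torusMeasure r k) := fun n =>
      integrable_of_continuous_compact (((continuous_bethe hτ hr0 hr k).mul
        (continuous_finsetProd _ fun i _ => (hob n).comp (continuous_apply i))).mul hvψ)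
    have h3 := integral_sub (hint (1 - x)) (hint (-x))
    rw [h1, h2, sub_zero] at h3
    refine (integral_congr_ae ?_).trans h3
    refine (Filter.Eventually.of_forall fun w => ?_)
    simp only [hGdef]
    ring
  refine hdom.of_eq (fun Z => ?_) ?_
  · rw [pairing, ← integral_const_mul]
    refine integral_congr_ae (Filter.Eventually.of_forall fun w => ?_)
    simp only [hGdef]
    ring
  · have h1 : ∫ w, G w * v w ∂torusMeasure r k =
        (∫ w, G w * (v - ψ) w ∂torusMeasure r k) + ∫ w, G w * ψ w ∂torusMeasure r k := by
      refine Eq.trans ?_ (integral_add (integrable_of_continuous_compact (hG.mul hvψ))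
        (integrable_of_continuous_compact (hG.mul hψc)))
      refine integral_congr_ae (Filter.Eventually.of_forall fun w => ?_)
      simp only [Pi.sub_apply]
      ring
    rw [h1, hzero, zero_add, pairing]
    refine integral_congr_ae (Filter.Eventually.of_forall fun w => ?_)
    simp only [hGdef, hψ, hstep, waveStep]
    simp only [toC]
    ring

/-- The right side of the formula at time `t`, with the contour integrals over the subsets of size
`k` collected into one pairing with a wave. -/
noncomputable def formula (b₁ b₂ τ r : ℝ) (x : ℤ) (m t : ℕ) {N : ℕ} (Y : Fin N → ℤ) : ℂ :=
  (-1) ^ (m - 1) * (τ : ℂ) ^ (m * (m - 1) / 2) * ∑ k ∈ Finset.Icc m N,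
    (-1) ^ k * ((τ : ℂ)⁻¹) ^ (m * k) * qBinom τ (k - 1) (m - 1) *
      pairing b₁ b₂ τ r x t fun w : Fin k → Circ r => wave τ Y (toC w)

theorem hasSum_formula (hτ : 0 < τ) (hr0 : 0 < r) (hr : (1 + τ) * r + τ * r ^ 2 < 1)
    (hb₁ : 0 < b₁) (hb₁' : b₁ < 1) (hb₂ : 0 < b₂) (hb₂' : b₂ < 1) (hτb : τ = b₂ / b₁) (x : ℤ)
    (m t : ℕ) {N : ℕ} (Y : Config N) :
    HasSum (fun Z : Config N => (transfer 1 b₁ b₂ (1 - b₁) (1 - b₂) Y Z : ℂ) *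
      formula b₁ b₂ τ r x m t Z.1) (formula b₁ b₂ τ r x m (t + 1) Y.1) := by
  have h1 : HasSum (fun Z => (jumpWeight b₁ b₂ false Y.1 Z : ℂ) * formula b₁ b₂ τ r x m t Z)
      (formula b₁ b₂ τ r x m (t + 1) Y.1) := by
    refine (((hasSum_sum fun k (_ : k ∈ Finset.Icc m N) => (hasSum_pairing_wave hτ hr0 hr hb₁
      hb₂ hb₂' hτb x t k Y.2).mul_left ((-1) ^ k * ((τ : ℂ)⁻¹) ^ (m * k) *
        qBinom τ (k - 1) (m - 1))).mul_left
          ((-1) ^ (m - 1) * (τ : ℂ) ^ (m * (m - 1) / 2)))).of_eq (fun Z => ?_) rfl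
    rw [formula, mul_left_comm, Finset.mul_sum]
    congr 1
    exact Finset.sum_congr rfl fun k _ => mul_left_comm _ _ _
  have h2 : (Function.support fun Z => (jumpWeight b₁ b₂ false Y.1 Z : ℂ) *
      formula b₁ b₂ τ r x m t Z) ⊆ {Z | StrictMono Z} := by
    intro Z hZ
    refine (jumpWeight_ne_zero (b₁ := b₁) (b₂ := b₂) (f := false) Y.2 fun h => hZ ?_).2.1
    simp [h]
  refine ((hasSum_subtype_iff_of_support_subset h2).2 h1).of_eq (fun Z => ?_) rfl
  rw [transfer_eq_jumpWeight hb₁'.ne]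
  rfl

theorem lt_countLT_iff {N : ℕ} {Y : Fin N → ℤ} (hY : StrictMono Y) (l : Fin N) (x : ℤ) :
    (l : ℕ) < countLT Y x ↔ Y l < x := by
  constructor
  · intro h
    by_contra hx
    have h1 : (Finset.univ.filter fun i => Y i < x) ⊆ Finset.Iio l := by
      intro i hi
      rw [Finset.mem_Iio]
      by_contra hil
      have h2 := hY.monotone (not_lt.1 hil)
      have h3 := (Finset.mem_filter.1 hi).2
      omega
    have h2 := Finset.card_le_card h1
    rw [Fin.card_Iio] at h2
    exact absurd h (not_lt.2 h2)
  · intro h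
    have h1 : Finset.Iic l ⊆ Finset.univ.filter fun i => Y i < x := by
      intro i hi
      exact Finset.mem_filter.2
        ⟨Finset.mem_univ _, (hY.monotone (Finset.mem_Iic.1 hi)).trans_lt h⟩
    have h2 := Finset.card_le_card h1
    rw [Fin.card_Iic] at h2
    exact h2

/-- At time `0` the formula is the indicator of the event. -/
theorem formula_zero (hτ : 0 < τ) (hr0 : 0 < r) (hr : (1 + τ) * r + τ * r ^ 2 < 1)
    (hb₂ : 0 < b₂) (hb₂' : b₂ < 1) (x : ℤ) {N : ℕ} (l : Fin N) {Y : Fin N → ℤ}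
    (hY : StrictMono Y) :
    formula b₁ b₂ τ r x (l + 1) 0 Y = if Y l = x then 1 else 0 := by
  have hτc : (τ : ℂ) ≠ 0 := Complex.ofReal_ne_zero.2 hτ.ne'
  have h1 : ∀ n, n ≤ N → ∑ k ∈ Finset.Icc ((l : ℕ) + 1) N, (-1) ^ k * (τ⁻¹) ^ ((l + 1) * k) *
      qBinom τ (k - 1) (l + 1 - 1) * subsetSum τ n k =
        if (l : ℕ) < n then -(-1) ^ (l : ℕ) * (τ⁻¹) ^ (((l : ℕ) + 1) * l / 2) else 0 := by
    intro n hn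
    have h2 := Finset.sum_Ico_add' (fun k => (-1) ^ k * (τ⁻¹) ^ (((l : ℕ) + 1) * k) *
      qBinom τ (k - 1) l * subsetSum τ n k) 0 N 1
    simp only [Nat.add_sub_cancel, Nat.Ico_zero_eq_range, zero_add] at h2 ⊢
    rw [← sum_qBinom_mul_subsetSum hτ l hn, h2]
    refine Finset.sum_subset (fun k hk => ?_) fun k hk hk' => ?_
    · rw [Finset.mem_Icc] at hk
      rw [Finset.mem_Ico]
      omega
    · rw [Finset.mem_Ico] at hk
      rw [Finset.mem_Icc] at hk'
      rw [qBinom_eq_zero τ (by omega), mul_zero, zero_mul]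
  have hle : ∀ x, countLT Y x ≤ N := fun x => (Finset.card_filter_le _ _).trans (by simp)
  have h2 : ∑ k ∈ Finset.Icc ((l : ℕ) + 1) N, (-1 : ℂ) ^ k * ((τ : ℂ)⁻¹) ^ (((l : ℕ) + 1) * k) *
      qBinom τ (k - 1) (l + 1 - 1) *
        pairing b₁ b₂ τ r x 0 (fun w : Fin k → Circ r => wave τ Y (toC w)) =
      (((if (l : ℕ) < countLT Y x then -(-1) ^ (l : ℕ) * (τ⁻¹) ^ (((l : ℕ) + 1) * l / 2) else 0) -
        (if (l : ℕ) < countLT Y (x + 1) then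
          -(-1) ^ (l : ℕ) * (τ⁻¹) ^ (((l : ℕ) + 1) * l / 2) else 0) : ℝ) : ℂ) := by
    rw [← h1 _ (hle x), ← h1 _ (hle (x + 1)), ← Finset.sum_sub_distrib]
    push_cast
    refine Finset.sum_congr rfl fun k _ => ?_
    rw [pairing_zero_wave hτ hr0 hr hb₂ hb₂' x hY, mul_sub]
  have h3 : (τ : ℂ) ^ (((l : ℕ) + 1) * l / 2) * ((τ : ℂ)⁻¹) ^ (((l : ℕ) + 1) * l / 2) = 1 := by
    rw [← mul_pow, mul_inv_cancel₀ hτc, one_pow]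
  have h4 : (-1 : ℂ) ^ (l : ℕ) * (-1) ^ (l : ℕ) = 1 := by
    rw [← mul_pow]
    simp
  rw [formula, h2]
  simp only [lt_countLT_iff hY, Nat.add_sub_cancel]
  rcases lt_trichotomy (Y l) x with h | h | h
  · rw [if_pos h, if_pos (by omega), if_neg h.ne]
    simp
  · rw [if_neg (by omega), if_pos (by omega), if_pos h]
    push_cast
    linear_combination ((-1 : ℂ) ^ (l : ℕ) * (-1) ^ (l : ℕ)) * h3 + h4
  · rw [if_neg (by omega), if_neg (by omega), if_neg h.ne']
    simp

end SixVertex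

namespace SixVertex

/-! ### Transition probabilities -/

variable {b₁ b₂ τ r : ℝ}

theorem transfer_nonneg (hb₁ : 0 < b₁) (hb₁' : b₁ < 1) (hb₂ : 0 < b₂) (hb₂' : b₂ < 1) {N : ℕ}
    (X Y : Config N) : 0 ≤ transfer 1 b₁ b₂ (1 - b₁) (1 - b₂) X Y := by
  rw [transfer_eq_jumpWeight hb₁'.ne]
  exact jumpWeight_nonneg hb₁.le hb₁'.le hb₂.le hb₂'.le false X.1 Y.1

/-- If `f` satisfies the backward equation of a nonnegative transfer matrix, then the powers of the
matrix map `f 0` to `f t`. -/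
theorem hasSum_transferPow {wa₂ wb₁ wb₂ wc₁ wc₂ : ℝ} {N : ℕ}
    (hT : ∀ X Y : Config N, 0 ≤ transfer wa₂ wb₁ wb₂ wc₁ wc₂ X Y) {f : ℕ → Config N → ℝ}
    (hf : ∀ t X, 0 ≤ f t X)
    (h : ∀ t Y, HasSum (fun Z => transfer wa₂ wb₁ wb₂ wc₁ wc₂ Y Z * f t Z) (f (t + 1) Y))
    (t s : ℕ) (Y : Config N) :
    HasSum (fun X => transferPow wa₂ wb₁ wb₂ wc₁ wc₂ t Y X * f s X) (f (s + t) Y) := by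
  have hP : ∀ t X Y, 0 ≤ transferPow wa₂ wb₁ wb₂ wc₁ wc₂ (N := N) t X Y := by
    intro t
    induction t with
    | zero =>
      intro X Y
      rw [transferPow]
      split_ifs <;> norm_num
    | succ t ih => exact fun X Y => tsum_nonneg fun Z => mul_nonneg (ih X Z) (hT Z Y)
  induction t generalizing s with
  | zero =>
    have h0 := hasSum_single (f := fun X => transferPow wa₂ wb₁ wb₂ wc₁ wc₂ 0 Y X * f s X) Y
      fun X hX => by
        simp only [transferPow, if_neg hX.symm, zero_mul]
    simpa [transferPow] using h0
  | succ t ih =>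
    -- the double sum over the configurations at the times `t` and `t + 1`
    set G : Config N × Config N → ℝ := fun Q => transferPow wa₂ wb₁ wb₂ wc₁ wc₂ t Y Q.1 *
      transfer wa₂ wb₁ wb₂ wc₁ wc₂ Q.1 Q.2 * f s Q.2 with hG
    have hrow : ∀ Z, HasSum (fun X => G (Z, X))
        (transferPow wa₂ wb₁ wb₂ wc₁ wc₂ t Y Z * f (s + 1) Z) := by
      intro Z
      have h1 := (h s Z).mul_left (transferPow wa₂ wb₁ wb₂ wc₁ wc₂ t Y Z)
      simpa only [hG, mul_assoc] using h1
    have hG0 : 0 ≤ G := fun Q => mul_nonneg (mul_nonneg (hP _ _ _) (hT _ _)) (hf _ _)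
    have hsum : Summable G := (summable_prod_of_nonneg hG0).2
      ⟨fun Z => (hrow Z).summable, by
        simp only [(hrow _).tsum_eq]
        exact (ih (s + 1)).summable⟩
    have htot : HasSum G (f (s + (t + 1)) Y) := by
      have h1 := hsum.hasSum.prod_fiberwise hrow
      have h2 := ih (s + 1)
      rw [show s + (t + 1) = s + 1 + t by ring, ← h1.unique h2]
      exact hsum.hasSum
    have hswap : HasSum (fun Q : Config N × Config N => G Q.swap) (f (s + (t + 1)) Y) :=
      (Equiv.prodComm _ _).hasSum_iff.2 htot
    refine hswap.prod_fiberwise fun X => ?_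
    have h3 : Summable fun Z => G (Z, X) := hswap.summable.prod_factor X
    have h4 : transferPow wa₂ wb₁ wb₂ wc₁ wc₂ (t + 1) Y X * f s X = ∑' Z, G (Z, X) := by
      rw [transferPow, ← tsum_mul_right]
    rw [h4]
    exact h3.hasSum

theorem formula_eq_ofReal (hτ : 0 < τ) (hr0 : 0 < r) (hr : (1 + τ) * r + τ * r ^ 2 < 1)
    (hb₁ : 0 < b₁) (hb₁' : b₁ < 1) (hb₂ : 0 < b₂) (hb₂' : b₂ < 1) (hτb : τ = b₂ / b₁) (x : ℤ)
    {N : ℕ} (l : Fin N) (t : ℕ) (Y : Config N) :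
    0 ≤ (formula b₁ b₂ τ r x (l + 1) t Y.1).re ∧
      ((formula b₁ b₂ τ r x (l + 1) t Y.1).re : ℂ) = formula b₁ b₂ τ r x (l + 1) t Y.1 := by
  induction t generalizing Y with
  | zero =>
    rw [formula_zero hτ hr0 hr hb₂ hb₂' x l Y.2]
    split_ifs <;> simp
  | succ t ih =>
    have h := hasSum_formula hτ hr0 hr hb₁ hb₁' hb₂ hb₂' hτb x (l + 1) t Y
    have h1 : ∀ Z : Config N, (transfer 1 b₁ b₂ (1 - b₁) (1 - b₂) Y Z : ℂ) *
        formula b₁ b₂ τ r x (l + 1) t Z.1 = ((transfer 1 b₁ b₂ (1 - b₁) (1 - b₂) Y Z *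
          (formula b₁ b₂ τ r x (l + 1) t Z.1).re : ℝ) : ℂ) := by
      intro Z
      rw [Complex.ofReal_mul, (ih Z).2]
    simp only [h1] at h
    have hre := Complex.hasSum_re h
    have him := Complex.hasSum_im h
    simp only [Complex.ofReal_re, Complex.ofReal_im] at hre him
    refine ⟨hre.nonneg fun Z => mul_nonneg (transfer_nonneg hb₁ hb₁' hb₂ hb₂' Y Z) (ih Z).1, ?_⟩
    exact Complex.ext (by simp) (by simpa using (him.unique hasSum_zero).symm)

theorem hasSum_stochasticPow (hτ : 0 < τ) (hr0 : 0 < r) (hr : (1 + τ) * r + τ * r ^ 2 < 1)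
    (hb₁ : 0 < b₁) (hb₁' : b₁ < 1) (hb₂ : 0 < b₂) (hb₂' : b₂ < 1) (hτb : τ = b₂ / b₁) (x : ℤ)
    {N : ℕ} (l : Fin N) (t : ℕ) (Y : Config N) :
    HasSum (fun X : {X : Config N | X.1 l = x} => stochasticPow b₁ b₂ t Y X.1)
      (formula b₁ b₂ τ r x (l + 1) t Y.1).re := by
  have hreal := formula_eq_ofReal hτ hr0 hr hb₁ hb₁' hb₂ hb₂' hτb x l
  have h := hasSum_transferPow (fun X Y => transfer_nonneg hb₁ hb₁' hb₂ hb₂' X Y)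
    (f := fun t Y => (formula b₁ b₂ τ r x (l + 1) t Y.1).re) (fun t X => (hreal t X).1)
    (fun t Y => by
      have h1 := Complex.hasSum_re (hasSum_formula hτ hr0 hr hb₁ hb₁' hb₂ hb₂' hτb x (l + 1) t Y)
      simpa only [Complex.re_ofReal_mul] using h1) t 0 Y
  rw [zero_add] at h
  refine hasSum_subtype_iff_indicator.2 ?_
  convert h using 2 with X
  rw [formula_zero hτ hr0 hr hb₂ hb₂' x l X.2, Set.indicator_apply]
  simp only [Set.mem_ofPred_eq]
  split_ifs <;> simp

theorem formula_eq_sum_contourIntegral (hτ : 0 < τ) {R : ℝ} (hR0 : 0 < R)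
    (hR : (1 + τ) * R⁻¹ + τ * R⁻¹ ^ 2 < 1) (hb₂ : 0 < b₂) (hb₂' : b₂ < 1) (hτb : τ = b₂ / b₁)
    {N : ℕ} (Y : Config N) (x : ℤ) {m : ℕ} (hm : 1 ≤ m) (t : ℕ) :
    formula b₁ b₂ τ R⁻¹ x m t Y.1 = (-1) ^ (m - 1) * (τ : ℂ) ^ (m * (m - 1) / 2) *
      ∑ k ∈ Finset.Icc m N, ∑ S ∈ Finset.powersetCard k (Finset.univ : Finset (Fin N)),
        (τ : ℂ) ^ (kappa S - (m : ℤ) * k - (k : ℤ) * (k - 1) / 2) *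
          (qBinom τ (k - 1) (m - 1) : ℂ) * contourIntegral b₁ b₂ Y x t R S := by
  have hτc : (τ : ℂ) ≠ 0 := Complex.ofReal_ne_zero.2 hτ.ne'
  rw [formula]
  congr 1
  refine Finset.sum_congr rfl fun k hk => ?_
  have hk1 : 1 ≤ k := hm.trans (Finset.mem_Icc.1 hk).1
  rw [pairing_wave hτ (inv_pos.2 hR0) hR hb₂ hb₂', Finset.mul_sum]
  refine Finset.sum_congr rfl fun S hS => ?_
  have h1 : (k : ℤ) * (k - 1) / 2 = ((k * (k - 1) / 2 : ℕ) : ℤ) := by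
    rw [Int.natCast_div, Nat.cast_mul, Nat.cast_sub hk1]
    rfl
  have h2 : (m : ℤ) * k = ((m * k : ℕ) : ℤ) := by push_cast; rfl
  rw [contourIntegral_eq_pairing hτ hR0 hR hb₂ hb₂' hτb Y x t (Finset.mem_powersetCard.1 hS).2, h1,
    h2, zpow_sub₀ hτc, zpow_sub₀ hτc, zpow_natCast, zpow_natCast, inv_pow]
  field_simp

end SixVertex

theorem mainTheorem6 (N : ℕ) (b₁ b₂ : ℝ) (hb₁ : 0 < b₁) (hb₁' : b₁ < 1) (hb₂ : 0 < b₂)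
    (hb₂' : b₂ < 1) (t : ℕ) (ht : 0 < t) (τ : ℝ) (hτ : τ = b₂ / b₁)
    (m : ℕ) (hm : 1 ≤ m) (hmN : m ≤ N) (Y : SixVertex.Config N) (x : ℤ)
    (R : ℝ) (hR : SixVertex.EnclosesSingularities τ b₂ R) :
    Summable (fun X : {X : SixVertex.Config N | X.1 ⟨m - 1, by omega⟩ = x} =>
      SixVertex.stochasticPow b₁ b₂ t Y X.1) ∧
    (∀ S : Finset (Fin N),
      TorusIntegrable (SixVertex.integrand b₁ b₂ Y x t S) 0 (fun _ => R)) ∧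
    (SixVertex.prob b₁ b₂ Y {X : SixVertex.Config N | X.1 ⟨m - 1, by omega⟩ = x} t : ℂ) =
      (-1) ^ (m - 1) * (τ : ℂ) ^ (m * (m - 1) / 2) *
        ∑ k ∈ Finset.Icc m N, ∑ S ∈ Finset.powersetCard k (Finset.univ : Finset (Fin N)),
          (τ : ℂ) ^ (SixVertex.kappa S - (m : ℤ) * k - (k : ℤ) * (k - 1) / 2) *
            (SixVertex.qBinom τ (k - 1) (m - 1) : ℂ) *
            SixVertex.contourIntegral b₁ b₂ Y x t R S := by
  have hτ0 : 0 < τ := hτ ▸ div_pos hb₂ hb₁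
  have hR0 : 0 < R := one_pos.trans hR.1
  have hr := SixVertex.radius_condition hτ0 hR
  have h := SixVertex.hasSum_stochasticPow hτ0 (inv_pos.2 hR0) hr hb₁ hb₁' hb₂ hb₂' hτ x
    (⟨m - 1, by omega⟩ : Fin N) t Y
  have h1 := (SixVertex.formula_eq_ofReal hτ0 (inv_pos.2 hR0) hr hb₁ hb₁' hb₂ hb₂' hτ x
    (⟨m - 1, by omega⟩ : Fin N) t Y).2
  refine ⟨h.summable, SixVertex.torusIntegrable_integrand hτ0 hR0 hr hb₂ hb₂' hτ Y x t, ?_⟩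
  rw [SixVertex.prob, h.tsum_eq, h1,
    ← SixVertex.formula_eq_sum_contourIntegral hτ0 hR0 hr hb₂ hb₂' hτ Y x hm t]
  simp only [Nat.sub_add_cancel hm]
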